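/- All vector spaces are over $\mathbb C$. Let $G$ be the group of linear transformations $g(x)=g_0x+g_1$ ($g_0\in\mathbb C^\times$, $g_1\in\mathbb C$) of $\mathbb C$, with the product $(gh)(x)=h(g(x))$. For a vector space $W$ put $\mathcal E^o(W)=\mathrm{Hom}(W,W((x^{-1})))$. For $a(x)=\sum_n a_nx^{-n-1}\in\mathcal E^o(W)$ and $g\in G$ let $R_ga(x)=a(g(x))$, where $(g_0x+g_1)^m$ is expanded in nonnegative powers of $g_1$. A subset $S\subset\mathcal E^o(W)$ is *$\Gamma$-local*, for a subgroup $\Gamma\le G$, if for all $a(x),b(x)\in S$ there are $g_1,\dots,g_r\in\Gamma$ with $(x_1-g_1(x_2))\cdots(x_1-g_r(x_2))[a(x_1),b(x_2)]=0$. It is *quasi-compatible* if for every finite sequence $a_1(x),\dots,a_r(x)$ in $S$ there is a nonzero polynomial $p(x,y)$ with $\prod_{i<j}p(x_i,x_j)\,a_1(x_1)\cdots a_r(x_r)\in\mathrm{Hom}(W,W((x_1^{-1},\dots,x_r^{-1})))$. For a quasi-compatible pair $(a(x),b(x))$, define $a(x)_nb(x)\in\mathcal E^o(W)$ by $$\sum_{n\in\mathbb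 Z}a(x)_nb(x)\,x_0^{-n-1}=Y_{\mathcal E^o}(a(x),x_0)b(x)=\iota\bigl(1/p(x_0+x,x)\bigr)\bigl(p(x_1,x)a(x_1)b(x)\bigr)\big|_{x_1=x+x_0},$$ where $p\neq0$ is any polynomial with $p(x_1,x_2)a(x_1)b(x_2)\in\mathrm{Hom}(W,W((x_1^{-1},x_2^{-1})))$, and $\iota$ is the embedding of $\mathbb C(x,x_0)$ in $\mathbb C((x^{-1}))((x_0))$. A quasi-compatible subspace is *closed* if it is closed under all products $a(x)_nb(x)$. For a quasi-compatible set $T$, $\langle T\rangle$ is the smallest closed quasi-compatible subspace containing $T$ and the identity operator $1_W$. A *nonlocal vertex algebra* is a vector space $V$ with a linear map $Y:V\to\mathrm{Hom}(V,V((x)))$ and a vector $\mathbf 1$ such that $Y(\mathbf 1,x)v=v$, $Y(v,x)\mathbf 1\in v+xV[[x]]$, and for all $u,v,w\in V$ there is $l\ge0$ with $(x_0+x_2)^lY(u,x_0+x_2)Y(v,x_2)w=(x_0+x_2)^lY(Y(u,x_0)v,x_2)w$. It is a *vertex algebra* if moreover for all $u,v$ there is $k\ge0$ with $(x_1-x_2)^k[Y(u,x_1),Y(v,x_2)]=0$.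 For a group $\Gamma$, a *$\Gamma$-vertex algebra* is a vertex algebra $V$ with group homomorphisms $R:\Gamma\to GL(V)$ and $\phi:\Gamma\to\mathbb C^\times$ such that $R_g\mathbf 1=\mathbf 1$ and $R_gY(u,x)v=Y(R_gu,\phi(g)^{-1}x)R_gv$. A *quasi module-at-infinity* for it is a vector space $W$ with a linear map $Y_W:V\to\mathcal E^o(W)$ and a group homomorphism $\Phi:\Gamma\to G$ such that: * $Y_W(\mathbf 1,x)=1_W$; * for all $u,v\in V$ there is a nonzero polynomial $p$ with $p(x_1,x_2)Y_W(u,x_1)Y_W(v,x_2)\in\mathrm{Hom}(W,W((x_1^{-1},x_2^{-1})))$ and $p(x_0+x_2,x_2)Y_W(Y(u,x_0)v,x_2)=\bigl(p(x_1,x_2)Y_W(u,x_1)Y_W(v,x_2)\bigr)|_{x_1=x_2+x_0}$; * $\phi(g)=\Phi(g)_0$ and $Y_W(R_gv,x)=Y_W(v,\Phi(g)(x))$ for all $g\in\Gamma$, $v\in V$; * $\{Y_W(v,x): v\in V\}$ is $\Phi(\Gamma)$-local. **Theorem.** Let $W$ be a vector space, $\Gamma$ a subgroup of $G$, and $S$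 a $\Gamma$-local subset of $\mathcal E^o(W)$. Set $\Gamma\cdot S=\mathrm{span}\{a(g(x)) : g\in\Gamma,\ a(x)\in S\}$. Then: 1. $\Gamma\cdot S$ is $\Gamma$-local; it is quasi-compatible, and $\langle\Gamma\cdot S\rangle$ exists. 2. $(\langle\Gamma\cdot S\rangle,Y_{\mathcal E^o},1_W)$ is a $\Gamma$-vertex algebra with $R_g(\alpha(x))=\alpha(g(x))$ for $g\in\Gamma$, $\alpha(x)\in\langle\Gamma\cdot S\rangle$, and $\phi(g)=g_0$ for $g(x)=g_0x+g_1\in\Gamma$. 3. $W$ is a quasi module-at-infinity for the $\Gamma$-vertex algebra $\langle\Gamma\cdot S\rangle$, with $Y_W(\alpha(x),x_0)=\alpha(x_0)$ and with $\Phi:\Gamma\to G$ the identity (inclusion) map. -/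

import Mathlib

open OrderDual

noncomputable section

namespace AtInfinity

universe u v

/-! ### The group of invertible affine-linear transformations of the complex line -/

/-- The transformation `z ↦ c₀ z + c₁` of `ℂ`, with `c₀` a nonzero complex number. -/
@[ext]
structure LinTransf where
  c₀ : ℂˣ
  c₁ : ℂ

namespace LinTransf

/-- The value `g(z) = c₀ z + c₁`. -/
def eval (g : LinTransf) (z : ℂ) : ℂ := g.c₀ * z + g.c₁

/-- The product of `g` and `h` is the result of substituting `g(z)` for `z` in `h`, that is
`(g * h)(z) = h(g(z))`.  This is the order of multiplication for which `a(x) ↦ a(g(x))` is a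
(left) action of the group on series. -/
instance : Mul LinTransf := ⟨fun g h => ⟨h.c₀ * g.c₀, h.c₀ * g.c₁ + h.c₁⟩⟩

instance : One LinTransf := ⟨⟨1, 0⟩⟩

instance : Inv LinTransf := ⟨fun g => ⟨g.c₀⁻¹, -((g.c₀⁻¹ : ℂˣ) * g.c₁)⟩⟩

theorem mul_def (g h : LinTransf) : g * h = ⟨h.c₀ * g.c₀, h.c₀ * g.c₁ + h.c₁⟩ := rfl
theorem one_def : (1 : LinTransf) = ⟨1, 0⟩ := rfl
theorem inv_def (g : LinTransf) : g⁻¹ = ⟨g.c₀⁻¹, -((g.c₀⁻¹ : ℂˣ) * g.c₁)⟩ := rfl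

theorem eval_mul (g h : LinTransf) (z : ℂ) : (g * h).eval z = h.eval (g.eval z) := by
  simp only [eval, mul_def, Units.val_mul]; ring

instance : Group LinTransf :=
  Group.ofLeftAxioms
    (fun a b c => by
      simp only [mul_def, Units.val_mul, LinTransf.mk.injEq]
      exact ⟨(mul_assoc _ _ _).symm, by ring⟩)
    (fun a => by simp [mul_def, one_def])
    (fun a => by simp [mul_def, one_def, inv_def])

end LinTransf

/-! ### Formal series in several variables -/

section Formal

variable {M : Type*} [AddCommGroup M] [Module ℂ M]

/-- The product of a polynomial in `x₁, …, x_r` and a doubly infinite formal series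
`F = ∑ F(n) x₁^{n 1} ⋯ x_r^{n r}` with coefficients in a vector space. -/
def polyMul {r : ℕ} (p : MvPolynomial (Fin r) ℂ) (F : (Fin r → ℤ) → M) : (Fin r → ℤ) → M :=
  fun n => ∑ s ∈ p.support, p.coeff s • F (fun i => n i - (s i : ℤ))

/-- `F(x₂ + x₀, x₂)` for a series `F(x₁, x₂)` with powers of `x₁` and of `x₂` bounded above;
powers of `x₂ + x₀` are expanded in nonnegative powers of `x₀`.  The value at `![i, k]` is the
coefficient of `x₀^i x₂^k`. -/
def substInf (F : (Fin 2 → ℤ) → M) : (Fin 2 → ℤ) → M := fun n =>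
  if 0 ≤ n 0 then ∑ᶠ m : ℤ, Ring.choose m (n 0).toNat • F ![m, n 1 + n 0 - m] else 0

/-- `F(x₀ + x₂, x₂)` for a series `F(x₁, x₂)` with powers of `x₂` bounded below; powers of
`x₀ + x₂` are expanded in nonnegative powers of `x₂`.  The value at `![p, q]` is the
coefficient of `x₀^p x₂^q`. -/
def substZero (F : (Fin 2 → ℤ) → M) : (Fin 2 → ℤ) → M := fun n =>
  ∑ᶠ i : ℕ, Ring.choose (n 0 + i) i • F ![n 0 + i, n 1 - i]

end Formal

/-! ### Nonlocal vertex algebras, vertex algebras and `Γ`-vertex algebras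

`HVertexOperator.coeff (Y u) n v` is the coefficient of `x ^ n` in `Y(u, x) v`. -/

/-- A nonlocal vertex algebra structure on a complex vector space `V`. -/
structure NonlocalVertexAlgebra (V : Type u) [AddCommGroup V] [Module ℂ V] where
  /-- the vertex operator map from `V` to `Hom(V, V((x)))` -/
  Y : V →ₗ[ℂ] VertexOperator ℂ V
  /-- the vacuum vector -/
  vac : V
  vacuum : ∀ (v : V) (n : ℤ), HVertexOperator.coeff (Y vac) n v = if n = 0 then v else 0
  creation_neg : ∀ (v : V) (n : ℤ), n < 0 → HVertexOperator.coeff (Y v) n vac = 0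
  creation_zero : ∀ v : V, HVertexOperator.coeff (Y v) 0 vac = v
  /-- `(x₀+x₂)^l Y(u, x₀+x₂) Y(v, x₂) w = (x₀+x₂)^l Y(Y(u, x₀) v, x₂) w` -/
  weak_assoc : ∀ u v w : V, ∃ l : ℕ,
    polyMul ((MvPolynomial.X 0 + MvPolynomial.X 1) ^ l)
      (substZero fun n =>
        HVertexOperator.coeff (Y u) (n 0) (HVertexOperator.coeff (Y v) (n 1) w)) =
    polyMul ((MvPolynomial.X 0 + MvPolynomial.X 1) ^ l)
      (fun n => HVertexOperator.coeff (Y (HVertexOperator.coeff (Y u) (n 0) v)) (n 1) w)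

/-- A vertex algebra is a nonlocal vertex algebra whose vertex operators are mutually local. -/
structure VertexAlgebra (V : Type u) [AddCommGroup V] [Module ℂ V] extends
    NonlocalVertexAlgebra V where
  /-- `(x₁-x₂)^k Y(u, x₁) Y(v, x₂) = (x₁-x₂)^k Y(v, x₂) Y(u, x₁)` -/
  locality : ∀ u v : V, ∃ k : ℕ,
    polyMul ((MvPolynomial.X 0 - MvPolynomial.X 1) ^ k)
      (fun n : Fin 2 → ℤ =>
        (HVertexOperator.coeff (Y u) (n 0) * HVertexOperator.coeff (Y v) (n 1) :
          Module.End ℂ V)) =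
    polyMul ((MvPolynomial.X 0 - MvPolynomial.X 1) ^ k)
      (fun n : Fin 2 → ℤ =>
        (HVertexOperator.coeff (Y v) (n 1) * HVertexOperator.coeff (Y u) (n 0) :
          Module.End ℂ V))

/-- A `Γ`-vertex algebra structure on a complex vector space `V`. -/
structure GammaVertexAlgebra (Γ : Type v) [Group Γ] (V : Type u) [AddCommGroup V] [Module ℂ V]
    extends VertexAlgebra V where
  R : Γ →* (V ≃ₗ[ℂ] V)
  φ : Γ →* ℂˣ
  R_vac : ∀ g : Γ, R g vac = vac
  /-- `R_g Y(u, x) v = Y(R_g u, φ(g)⁻¹ x) R_g v` -/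
  R_Y : ∀ (g : Γ) (u v : V) (n : ℤ),
    R g (HVertexOperator.coeff (Y u) n v) =
      ((φ g : ℂ)⁻¹ ^ n) • HVertexOperator.coeff (Y (R g u)) n (R g v)

/-! ### The space `Hom(W, W((x⁻¹)))` -/

section Fields

variable (W : Type u) [AddCommGroup W] [Module ℂ W]

/-- `Hom(W, W((x⁻¹)))`: series in `x` are indexed by exponents in `ℤᵒᵈ`, so that a well-ordered
support is one that is bounded above in `ℤ`. -/
abbrev EInf := HVertexOperator ℤᵒᵈ ℂ W W

variable {W}

set_option linter.unusedSectionVars false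

/-- The coefficient of `x ^ n` in `a(x)`, an endomorphism of `W`. -/
def cf (a : EInf W) (n : ℤ) : Module.End ℂ W := HVertexOperator.coeff a (toDual n)

theorem isPWO_of_bound {s : Set ℤᵒᵈ} (N : ℤ) (h : ∀ n ∈ s, ofDual n ≤ N) : s.IsPWO := by
  have : BddBelow s := ⟨toDual N, fun n hn => h n hn⟩
  exact this.isWF.isPWO

theorem cf_bound (a : EInf W) (w : W) : ∃ N : ℤ, ∀ n : ℤ, N < n → cf a n w = 0 := by
  have h := HVertexOperator.coeff_isPWOsupport a w
  by_cases hs : (Function.support ((HahnModule.of ℂ).symm (a w)).coeff).Nonempty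
  · refine ⟨ofDual (h.isWF.min hs), fun n hn => ?_⟩
    by_contra hne
    exact h.isWF.not_lt_min hs (a := toDual n) hne hn
  · refine ⟨0, fun n _ => ?_⟩
    by_contra hne
    exact hs ⟨toDual n, hne⟩

/-- The series `∑ f n xⁿ`, for operators `f n` such that for each `w` the vectors `f n w`
vanish for `n` large. -/
def mkEInf (f : ℤ → Module.End ℂ W) (hf : ∀ w, ∃ N : ℤ, ∀ n : ℤ, N < n → f n w = 0) : EInf W :=
  HVertexOperator.of_coeff (fun n : ℤᵒᵈ => f (ofDual n)) fun w => by
    obtain ⟨N, hN⟩ := hf w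
    exact isPWO_of_bound N fun n hn => not_lt.1 fun h => hn (hN _ h)

@[simp] theorem cf_mkEInf (f : ℤ → Module.End ℂ W)
    (hf : ∀ w, ∃ N : ℤ, ∀ n : ℤ, N < n → f n w = 0) (n : ℤ) : cf (mkEInf f hf) n = f n := by
  simp [cf, mkEInf]

/-- The identity operator `1_W`, as a constant series. -/
def oneW : EInf W :=
  mkEInf (fun n => if n = 0 then 1 else 0) fun _ => ⟨0, fun n hn => by simp [hn.ne']⟩

theorem affine_support (a : EInf W) (k : ℤ) (w : W) :
    ∃ N : ℕ, ∀ i : ℕ, N ≤ i → cf a (k + i) w = 0 := by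
  obtain ⟨N, hN⟩ := cf_bound a w
  exact ⟨(N - k).toNat + 1, fun i hi => hN _ (by omega)⟩

/-- The coefficient of `x ^ k` in `a(g(x))`, where for `g(x) = c₀ x + c₁` each power
`(c₀ x + c₁)^n` is expanded in nonnegative powers of `c₁`. -/
def affineCoeff (g : LinTransf) (a : EInf W) (k : ℤ) : Module.End ℂ W where
  toFun w := ∑ᶠ i : ℕ,
    (((Ring.choose (k + i) i : ℤ) : ℂ) * (g.c₀ : ℂ) ^ k * g.c₁ ^ i) • cf a (k + i) w
  map_add' v w := by
    have hfin : ∀ u : W, (Function.support fun i : ℕ =>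
        (((Ring.choose (k + i) i : ℤ) : ℂ) * (g.c₀ : ℂ) ^ k * g.c₁ ^ i) • cf a (k + i) u).Finite := by
      intro u
      obtain ⟨N, hN⟩ := affine_support a k u
      refine (Set.finite_lt_nat N).subset fun i hi => ?_
      by_contra hlt
      exact hi (by simp [hN i (not_lt.1 hlt)])
    rw [← finsum_add_distrib (hfin v) (hfin w)]
    simp
  map_smul' c w := by
    simp only [map_smul, RingHom.id_apply]
    rw [smul_finsum]
    exact finsum_congr fun i => smul_comm _ _ _

/-- `R_g a(x) = a(g(x))`. -/
def subst (g : LinTransf) (a : EInf W) : EInf W :=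
  mkEInf (affineCoeff g a) fun w => by
    obtain ⟨N, hN⟩ := cf_bound a w
    refine ⟨N, fun n hn => ?_⟩
    change (∑ᶠ i : ℕ, _) = (0 : W)
    rw [finsum_eq_zero_of_forall_eq_zero]
    intro i
    rw [hN _ (by omega), smul_zero]

/-! ### Quasi-compatibility -/

/-- The formal product `a₁(x₁) ⋯ a_r(x_r)`. -/
def opProd {r : ℕ} (a : Fin r → EInf W) : (Fin r → ℤ) → Module.End ℂ W :=
  fun n => (List.ofFn fun i => cf (a i) (n i)).prod

/-- Membership of an operator-valued series in `Hom(W, W((x₁⁻¹, …, x_r⁻¹)))`: applied to a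
vector, it has exponents bounded above in every variable. -/
def IsTruncated {r : ℕ} (T : (Fin r → ℤ) → Module.End ℂ W) : Prop :=
  ∀ w : W, ∃ N : ℤ, ∀ n : Fin r → ℤ, (∃ i, N < n i) → T n w = 0

/-- Quasi-compatibility of a finite sequence `a₁(x), …, a_r(x)`. -/
def QuasiCompatibleSeq {r : ℕ} (a : Fin r → EInf W) : Prop :=
  ∃ p : MvPolynomial (Fin 2) ℂ, p ≠ 0 ∧
    IsTruncated (polyMul
      (∏ ij : Fin r × Fin r with ij.1 < ij.2, MvPolynomial.rename ![ij.1, ij.2] p) (opProd a))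

/-- A set is quasi-compatible if all finite sequences in it are. -/
def QuasiCompatible (S : Set (EInf W)) : Prop :=
  ∀ (r : ℕ) (a : Fin r → EInf W), (∀ i, a i ∈ S) → QuasiCompatibleSeq a

/-! ### The products `a(x)_n b(x)` -/

/-- The field `ℂ((x⁻¹))((x₀))`. -/
def IterField := HahnSeries ℤ (HahnSeries ℤᵒᵈ ℂ)

instance : Field IterField := inferInstanceAs (Field (HahnSeries ℤ (HahnSeries ℤᵒᵈ ℂ)))

instance : Algebra ℂ IterField := inferInstanceAs (Algebra ℂ (HahnSeries ℤ (HahnSeries ℤᵒᵈ ℂ)))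

/-- The monomial `c x₀^i x^k` in `ℂ((x⁻¹))((x₀))`. -/
def IterField.monomial (i k : ℤ) (c : ℂ) : IterField :=
  (HahnSeries.single i (HahnSeries.single (toDual k) c) : HahnSeries ℤ (HahnSeries ℤᵒᵈ ℂ))

variable (W) in
/-- The space `W((x⁻¹))((x₀))`. -/
def IterSeries := HahnModule ℤ (HahnSeries ℤᵒᵈ ℂ) (HahnModule ℤᵒᵈ ℂ W)

instance : AddCommGroup (IterSeries W) :=
  inferInstanceAs (AddCommGroup (HahnModule ℤ (HahnSeries ℤᵒᵈ ℂ) (HahnModule ℤᵒᵈ ℂ W)))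

/-- `W((x⁻¹))((x₀))` is a vector space over the field `ℂ((x⁻¹))((x₀))`. -/
instance : Module IterField (IterSeries W) :=
  inferInstanceAs (Module (HahnSeries ℤ (HahnSeries ℤᵒᵈ ℂ))
    (HahnModule ℤ (HahnSeries ℤᵒᵈ ℂ) (HahnModule ℤᵒᵈ ℂ W)))

/-- The coefficient of `x₀ ^ j` in an element of `W((x⁻¹))((x₀))`. -/
def IterSeries.coeff (y : IterSeries W) (j : ℤ) : HahnModule ℤᵒᵈ ℂ W :=
  ((HahnModule.of (HahnSeries ℤᵒᵈ ℂ)).symm y).coeff j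

theorem IterSeries.ext' {y z : IterSeries W} (h : ∀ j, y.coeff j = z.coeff j) : y = z :=
  HahnModule.ext y z (funext h)

theorem IterSeries.coeff_add (y z : IterSeries W) (j : ℤ) :
    (y + z).coeff j = y.coeff j + z.coeff j := rfl

theorem IterSeries.coeff_constSmul (c : ℂ) (y : IterSeries W) (j : ℤ) :
    (IterField.monomial 0 0 c • y).coeff j = c • y.coeff j :=
  (HahnModule.coeff_single_zero_smul (Γ := ℤ) (R := HahnSeries ℤᵒᵈ ℂ)
    (V := HahnModule ℤᵒᵈ ℂ W) (x := y)).trans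
    (HahnModule.single_zero_smul_eq_smul ℤᵒᵈ (x := y.coeff j))

/-- `p(x₀ + x, x)` as an element of the field `ℂ((x⁻¹))((x₀))`. -/
def shiftPoly (p : MvPolynomial (Fin 2) ℂ) : IterField :=
  MvPolynomial.aeval
    ![IterField.monomial 1 0 1 + IterField.monomial 0 1 1, IterField.monomial 0 1 1] p

theorem substInf_bound {F : (Fin 2 → ℤ) → W} {N : ℤ}
    (hN : ∀ n : Fin 2 → ℤ, (∃ i, N < n i) → F n = 0) (i k : ℤ) (h : 2 * N < k + i) :
    substInf F ![i, k] = 0 := by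
  unfold substInf
  split_ifs
  · refine finsum_eq_zero_of_forall_eq_zero fun m => ?_
    rw [hN, smul_zero]
    by_cases hm : N < m
    · exact ⟨0, hm⟩
    · exact ⟨1, by simp; omega⟩
  · rfl

theorem substInf_of_neg {F : (Fin 2 → ℤ) → W} (i k : ℤ) (h : i < 0) :
    substInf F ![i, k] = 0 := if_neg (not_le.2 h)

theorem substInf_finite {T : (Fin 2 → ℤ) → Module.End ℂ W} (hT : IsTruncated T) (w : W)
    (i : ℕ) (k : ℤ) :
    (Function.support fun m : ℤ => Ring.choose m i • T ![m, k - m] w).Finite := by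
  obtain ⟨N, hN⟩ := hT w
  refine (Set.finite_Icc (k - N) N).subset fun m hm => ?_
  by_contra hmem
  refine hm ?_
  simp only
  rw [hN, smul_zero]
  by_cases h : N < m
  · exact ⟨0, h⟩
  · refine ⟨1, ?_⟩
    simp only [Set.mem_Icc, not_and_or] at hmem
    simp; omega

theorem substInf_add {T : (Fin 2 → ℤ) → Module.End ℂ W} (hT : IsTruncated T) (v w : W)
    (n : Fin 2 → ℤ) :
    substInf (fun n => T n (v + w)) n =
      substInf (fun n => T n v) n + substInf (fun n => T n w) n := by
  unfold substInf
  split_ifs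
  · rw [← finsum_add_distrib (substInf_finite hT v _ _) (substInf_finite hT w _ _)]
    simp
  · simp

theorem substInf_smul (T : (Fin 2 → ℤ) → Module.End ℂ W) (c : ℂ) (w : W) (n : Fin 2 → ℤ) :
    substInf (fun n => T n (c • w)) n = c • substInf (fun n => T n w) n := by
  unfold substInf
  split_ifs
  · rw [smul_finsum]
    refine finsum_congr fun i => ?_
    simp only [map_smul]
    rw [smul_comm]
  · simp

/-- For `A(x₁, x) ∈ Hom(W, W((x₁⁻¹, x⁻¹)))` and `w ∈ W`, the coefficient of `x₀ ^ i` in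
`A(x + x₀, x) w`, an element of `W((x⁻¹))`. -/
def shiftSeriesCoeff (T : (Fin 2 → ℤ) → Module.End ℂ W) (hT : IsTruncated T) (w : W) (i : ℤ) :
    HahnModule ℤᵒᵈ ℂ W :=
  HahnModule.of ℂ (V := W)
    { coeff := fun k => substInf (fun n => T n w) ![i, ofDual k]
      isPWO_support' := by
        obtain ⟨N, hN⟩ := hT w
        exact isPWO_of_bound (2 * N - i) fun k hk =>
          not_lt.1 fun h => hk (substInf_bound hN i (ofDual k) (by omega)) }

/-- For `A(x₁, x) ∈ Hom(W, W((x₁⁻¹, x⁻¹)))` and `w ∈ W`, the series `A(x + x₀, x) w`, as an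
element of `W((x⁻¹))((x₀))`. -/
def shiftSeries (T : (Fin 2 → ℤ) → Module.End ℂ W) (hT : IsTruncated T) (w : W) :
    IterSeries W :=
  HahnModule.of (HahnSeries ℤᵒᵈ ℂ)
    (⟨shiftSeriesCoeff T hT w, by
        have : BddBelow (Function.support (shiftSeriesCoeff T hT w)) := by
          refine ⟨0, fun i hi => ?_⟩
          by_contra hneg
          exact hi (HahnModule.ext (shiftSeriesCoeff T hT w i) 0
            (funext fun k =>
              substInf_of_neg (F := fun n => T n w) i (ofDual k) (not_le.1 hneg)))
        exact this.isWF.isPWO⟩ : HahnSeries ℤ (HahnModule ℤᵒᵈ ℂ W))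

theorem shiftSeries_add (T : (Fin 2 → ℤ) → Module.End ℂ W) (hT : IsTruncated T) (v w : W) :
    shiftSeries T hT (v + w) = shiftSeries T hT v + shiftSeries T hT w := by
  refine IterSeries.ext' fun i => HahnModule.ext _ _ (funext fun k => ?_)
  exact substInf_add hT v w _

theorem shiftSeries_smul (T : (Fin 2 → ℤ) → Module.End ℂ W) (hT : IsTruncated T) (c : ℂ) (w : W) :
    shiftSeries T hT (c • w) =
      IterField.monomial 0 0 c • shiftSeries T hT w := by
  refine IterSeries.ext' fun i => ?_
  rw [IterSeries.coeff_constSmul]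
  refine HahnModule.ext _ _ (funext fun k => ?_)
  exact substInf_smul T c w _

/-- The coefficient of `x₀ ^ j` in `ι(1 / p(x₀ + x, x)) A(x + x₀, x)`, an element of
`Hom(W, W((x⁻¹)))`, with `1 / p(x₀ + x, x)` taken in the field `ℂ((x⁻¹))((x₀))`. -/
def divShiftCoeff (p : MvPolynomial (Fin 2) ℂ) (T : (Fin 2 → ℤ) → Module.End ℂ W)
    (hT : IsTruncated T) (j : ℤ) : EInf W where
  toFun w := ((shiftPoly p)⁻¹ • shiftSeries T hT w).coeff j
  map_add' v w := by rw [shiftSeries_add, smul_add, IterSeries.coeff_add]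
  map_smul' c w := by
    rw [shiftSeries_smul, smul_smul, mul_comm, ← smul_smul, IterSeries.coeff_constSmul,
      RingHom.id_apply]

open Classical in
/-- The coefficient of `x₀ ^ j` in
`Y(a(x), x₀) b(x) = ι(1 / p(x₀ + x, x)) (p(x₁, x) a(x₁) b(x))|_{x₁ = x + x₀}`, where `p` is a
nonzero polynomial such that `p(x₁, x₂) a(x₁) b(x₂) ∈ Hom(W, W((x₁⁻¹, x₂⁻¹)))`.  It is only used
for quasi-compatible pairs, for which such a `p` exists; the result does not depend on `p`. -/
def YCoeff (a b : EInf W) (j : ℤ) : EInf W :=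
  if h : ∃ p : MvPolynomial (Fin 2) ℂ, p ≠ 0 ∧ IsTruncated (polyMul p (opProd ![a, b])) then
    divShiftCoeff h.choose _ h.choose_spec.2 j
  else 0

/-- `a(x)_n b(x)`, defined by `Y(a(x), x₀) b(x) = ∑ a(x)_n b(x) x₀^{-n-1}`. -/
def nProd (a b : EInf W) (n : ℤ) : EInf W := YCoeff a b (-n - 1)

/-- A quasi-compatible subspace closed under all the products `a(x)_n b(x)`. -/
structure IsClosedQC (U : Submodule ℂ (EInf W)) : Prop where
  quasiCompatible : QuasiCompatible (U : Set (EInf W))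
  closed : ∀ a ∈ U, ∀ b ∈ U, ∀ n : ℤ, nProd a b n ∈ U

/-- The closed quasi-compatible subspaces that contain `S` and `1_W`. -/
def closedContaining (S : Set (EInf W)) : Set (Submodule ℂ (EInf W)) :=
  {U | IsClosedQC U ∧ S ⊆ U ∧ oneW ∈ U}

/-- `⟨S⟩`, the intersection of all closed quasi-compatible subspaces that contain `S` and `1_W`. -/
def generated (S : Set (EInf W)) : Submodule ℂ (EInf W) := sInf (closedContaining S)

/-! ### `Γ`-locality -/

/-- The polynomial `x₁ - g(x₂)`. -/
def linFactor (g : LinTransf) : MvPolynomial (Fin 2) ℂ :=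
  MvPolynomial.X 0 - (MvPolynomial.C (g.c₀ : ℂ) * MvPolynomial.X 1 + MvPolynomial.C g.c₁)

/-- The commutator `[a(x₁), b(x₂)]`. -/
def commSeries (a b : EInf W) : (Fin 2 → ℤ) → Module.End ℂ W :=
  fun n => cf a (n 0) * cf b (n 1) - cf b (n 1) * cf a (n 0)

/-- `S` is `Γ`-local: for `a(x), b(x) ∈ S` there are `g₁, …, g_r ∈ Γ` with
`(x₁ - g₁(x₂)) ⋯ (x₁ - g_r(x₂)) [a(x₁), b(x₂)] = 0`. -/
def GammaLocal (Γ : Subgroup LinTransf) (S : Set (EInf W)) : Prop :=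
  ∀ a ∈ S, ∀ b ∈ S, ∃ l : List LinTransf, (∀ g ∈ l, g ∈ Γ) ∧
    polyMul (l.map linFactor).prod (commSeries a b) = 0

/-- `Γ · S`, the span of all `a(g(x))` with `g ∈ Γ` and `a(x) ∈ S`. -/
def gammaSpan (Γ : Subgroup LinTransf) (S : Set (EInf W)) : Submodule ℂ (EInf W) :=
  Submodule.span ℂ {b | ∃ g ∈ Γ, ∃ a ∈ S, b = subst g a}

/-! ### Quasi modules-at-infinity -/

variable {V : Type v} [AddCommGroup V] [Module ℂ V]

variable (W) in
/-- A quasi module-at-infinity structure on `W` for a nonlocal vertex algebra `V`. -/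
structure QuasiModuleAtInfinity (A : NonlocalVertexAlgebra V) where
  YW : V →ₗ[ℂ] EInf W
  YW_vac : YW A.vac = oneW
  /-- There is `p ≠ 0` with `p(x₁, x₂) Y_W(u, x₁) Y_W(v, x₂) ∈ Hom(W, W((x₁⁻¹, x₂⁻¹)))` and
  `p(x₀+x₂, x₂) Y_W(Y(u, x₀) v, x₂) = (p(x₁, x₂) Y_W(u, x₁) Y_W(v, x₂))|_{x₁ = x₂ + x₀}`. -/
  quasi_assoc : ∀ u v : V, ∃ p : MvPolynomial (Fin 2) ℂ, p ≠ 0 ∧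
    IsTruncated (polyMul p (opProd ![YW u, YW v])) ∧
    ∀ w : W,
      polyMul (MvPolynomial.aeval
          ![(MvPolynomial.X 0 + MvPolynomial.X 1 : MvPolynomial (Fin 2) ℂ), MvPolynomial.X 1] p)
        (fun n => cf (YW (HVertexOperator.coeff (A.Y u) (n 0) v)) (n 1) w) =
      substInf (fun n => polyMul p (opProd ![YW u, YW v]) n w)

variable (W) in
/-- A quasi module-at-infinity structure on `W` for a `Γ`-vertex algebra `V`. -/
structure GammaQuasiModuleAtInfinity {Γ : Type*} [Group Γ] (A : GammaVertexAlgebra Γ V) extends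
    QuasiModuleAtInfinity W A.toNonlocalVertexAlgebra where
  Φ : Γ →* LinTransf
  Φ_c₀ : ∀ g : Γ, (Φ g).c₀ = A.φ g
  /-- `Y_W(R_g v, x) = Y_W(v, Φ(g)(x))` -/
  YW_R : ∀ (g : Γ) (v : V), YW (A.R g v) = subst (Φ g) (YW v)
  gammaLocal : GammaLocal Φ.range (Set.range YW)

end Fields

end AtInfinity

end

open AtInfinity

noncomputable section

namespace AtInfinity

set_option linter.unusedSectionVars false

/-! ### Multiplication of formal series by polynomials -/

section PolyMul

variable {M N : Type*} [AddCommGroup M] [Module ℂ M] [AddCommGroup N] [Module ℂ N] {r : ℕ}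

open MvPolynomial

/-! The whole proof is a cancellation argument. The series `Y(a(x), x₀) b(x) w` is the only series
in `W((x⁻¹))((x₀))` that becomes `(p(x₁, x) a(x₁) b(x) w)|_{x₁ = x + x₀}` after multiplication by
`p(x₀ + x, x)`, since nonzero polynomials act invertibly there (`Yser_spec`, `Yser_unique`). Every
identity between such series is therefore checked after multiplication by a nonzero polynomial,
where it becomes an identity between substitutions in one truncated series.

Γ-locality implies quasi-compatibility: once the polynomials that kill the commutators are
multiplied in, any chosen operator can be moved to the right, next to `w`, which bounds the
exponents of its variable (`isTruncated_of_comm`). Dong's lemma (`LocalPair.YCoeff`) shows that the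
products `a(x)_n b(x)` stay Γ-local with everything that `a` and `b` are Γ-local with. A commutant
and double commutant argument then places a Γ-local set in a Γ-local closed space, so the generated
space is itself Γ-local. The substitutions `x ↦ g(x)` preserve Γ-locality and carry the products to
rescaled products (`subst_YCoeff`), so minimality makes the generated space stable under Γ.

The heart is that Γ-locality on `W` yields genuine, not merely quasi, locality and associativity of
the operators `Y(a(x), x₀)`. A suitable polynomial multiple of `a(x₁) b(x₂) c(x₃) w` is truncated,
and its substitutions describe the iterated operators. After the substitution a factor `x₁ - g(x₂)`
becomes `(x₀ + x) - g(x₁ + x)`. For `g ≠ 1` it is a nonzero polynomial in `x` at `x₀ = x₁ = 0`,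
hence cancels in the relevant spaces of series; for `g = 1` it becomes `x₀ - x₁` in the commutator
computation. The factors from the other two pairs contribute powers of `x₀` and `x₁`, and
multiplication by these is injective, so only a power of `x₀ - x₁` survives (`exists_YRow_comm`). In
the associativity computation only a power of `x₀ + x₁` survives, for the same reason
(`exists_YRow_assoc`).

The module axiom on `W` is then the defining property of `Y` itself. -/

theorem polyMul_eq_sum_of_subset (p : MvPolynomial (Fin r) ℂ) (F : (Fin r → ℤ) → M)
    (n : Fin r → ℤ) (t : Finset (Fin r →₀ ℕ)) (ht : p.support ⊆ t) :
    polyMul p F n = ∑ s ∈ t, p.coeff s • F (fun i => n i - (s i : ℤ)) := by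
  unfold polyMul
  refine Finset.sum_subset ht fun s _ hs => ?_
  rw [MvPolynomial.notMem_support_iff.1 hs, zero_smul]

theorem polyMul_add_left (p q : MvPolynomial (Fin r) ℂ) (F : (Fin r → ℤ) → M) :
    polyMul (p + q) F = polyMul p F + polyMul q F := by
  funext n
  classical
  rw [Pi.add_apply,
    polyMul_eq_sum_of_subset (p + q) F n (p.support ∪ q.support) MvPolynomial.support_add,
    polyMul_eq_sum_of_subset p F n (p.support ∪ q.support) Finset.subset_union_left,
    polyMul_eq_sum_of_subset q F n (p.support ∪ q.support) Finset.subset_union_right,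
    ← Finset.sum_add_distrib]
  simp [add_smul]

theorem polyMul_monomial (s : Fin r →₀ ℕ) (c : ℂ) (F : (Fin r → ℤ) → M) (n : Fin r → ℤ) :
    polyMul (monomial s c) F n = c • F (fun i => n i - (s i : ℤ)) := by
  classical
  rw [polyMul_eq_sum_of_subset _ F n {s} support_monomial_subset]
  simp

theorem polyMul_C (c : ℂ) (F : (Fin r → ℤ) → M) : polyMul (C c) F = c • F := by
  funext n
  rw [C_apply, polyMul_monomial]; simp

@[simp] theorem polyMul_one (F : (Fin r → ℤ) → M) : polyMul 1 F = F := by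
  rw [← C_1, polyMul_C, one_smul]

theorem polyMul_X (i : Fin r) (F : (Fin r → ℤ) → M) (n : Fin r → ℤ) :
    polyMul (X i) F n = F (n - Pi.single i 1) := by
  rw [X, polyMul_monomial, one_smul]
  congr 1
  funext j
  simp [Finsupp.single_apply, Pi.single_apply, eq_comm]

theorem polyMul_mul (p q : MvPolynomial (Fin r) ℂ) (F : (Fin r → ℤ) → M) :
    polyMul (p * q) F = polyMul p (polyMul q F) := by
  induction p using MvPolynomial.induction_on' with
  | monomial s c =>
    induction q using MvPolynomial.induction_on' with
    | monomial t d =>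
      funext n
      rw [monomial_mul, polyMul_monomial, polyMul_monomial, polyMul_monomial, mul_smul]
      simp [sub_sub]
    | add a b ha hb =>
      funext n
      have ha' := congrFun ha n
      have hb' := congrFun hb n
      rw [mul_add, polyMul_add_left, polyMul_add_left, Pi.add_apply, ha', hb']
      simp [polyMul_monomial]
  | add a b ha hb => rw [add_mul, polyMul_add_left, polyMul_add_left, ha, hb]

theorem polyMul_comm (p q : MvPolynomial (Fin r) ℂ) (F : (Fin r → ℤ) → M) :
    polyMul p (polyMul q F) = polyMul q (polyMul p F) := by
  rw [← polyMul_mul, mul_comm, polyMul_mul]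

theorem polyMul_add (p : MvPolynomial (Fin r) ℂ) (F G : (Fin r → ℤ) → M) :
    polyMul p (F + G) = polyMul p F + polyMul p G := by
  funext n; simp [polyMul, Finset.sum_add_distrib]

theorem polyMul_sub (p : MvPolynomial (Fin r) ℂ) (F G : (Fin r → ℤ) → M) :
    polyMul p (F - G) = polyMul p F - polyMul p G := by
  funext n; simp [polyMul, smul_sub]

@[simp] theorem polyMul_zero (p : MvPolynomial (Fin r) ℂ) :
    polyMul p (0 : (Fin r → ℤ) → M) = 0 := by
  funext n; simp [polyMul]

theorem polyMul_smul (p : MvPolynomial (Fin r) ℂ) (c : ℂ) (F : (Fin r → ℤ) → M) :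
    polyMul p (c • F) = c • polyMul p F := by
  rw [← polyMul_C, polyMul_comm, polyMul_C]

/-- Coefficientwise linear maps commute with multiplication by polynomials. -/
theorem map_polyMul (L : M →ₗ[ℂ] N) (p : MvPolynomial (Fin r) ℂ) (F : (Fin r → ℤ) → M)
    (n : Fin r → ℤ) : L (polyMul p F n) = polyMul p (fun n => L (F n)) n := by
  simp [polyMul]

theorem polyMul_apply (p : MvPolynomial (Fin r) ℂ) (F : (Fin r → ℤ) → Module.End ℂ M)
    (n : Fin r → ℤ) (w : M) : polyMul p F n w = polyMul p (fun n => F n w) n :=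
  map_polyMul (LinearMap.applyₗ w) p F n

/-- The value of `polyMul p F` at `n` depends only on the values of `F` at exponents below `n`. -/
theorem polyMul_congr {p : MvPolynomial (Fin r) ℂ} {F G : (Fin r → ℤ) → M} {n : Fin r → ℤ}
    (h : ∀ m, (∀ i, m i ≤ n i) → F m = G m) : polyMul p F n = polyMul p G n := by
  unfold polyMul
  refine Finset.sum_congr rfl fun s _ => ?_
  rw [h _ fun i => by simp]

/-- The restriction of a series to the variables `x_{e 0}, x_{e 1}, …`, the exponents of the other
variables being those of `n`. -/
def slice {s : ℕ} (e : Fin s → Fin r) (F : (Fin r → ℤ) → M) (n : Fin r → ℤ) :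
    (Fin s → ℤ) → M := fun k => F (Function.extend e k n)

theorem extend_comp_self {s : ℕ} {e : Fin s → Fin r} (he : Function.Injective e) (n : Fin r → ℤ) :
    Function.extend e (n ∘ e) n = n := by
  funext j
  by_cases hj : ∃ t, e t = j
  · obtain ⟨t, rfl⟩ := hj; simp [he.extend_apply]
  · rw [Function.extend_apply' _ _ _ hj]

theorem slice_self {s : ℕ} {e : Fin s → Fin r} (he : Function.Injective e)
    (F : (Fin r → ℤ) → M) (n : Fin r → ℤ) : slice e F n (n ∘ e) = F n := by
  rw [slice, extend_comp_self he]

/-- A polynomial in the variables `x_{e 0}, x_{e 1}, …` never moves the other exponents, so these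
can be frozen. This reduces computations in three variables to computations in two. -/
theorem slice_polyMul {s : ℕ} {e : Fin s → Fin r} (he : Function.Injective e)
    (p : MvPolynomial (Fin s) ℂ) (F : (Fin r → ℤ) → M) (n : Fin r → ℤ) :
    slice e (polyMul (rename e p) F) n = polyMul p (slice e F n) := by
  induction p using MvPolynomial.induction_on generalizing F with
  | C c => rw [rename_C, polyMul_C, polyMul_C]; rfl
  | add p q hp hq => rw [map_add, polyMul_add_left, polyMul_add_left, ← hp, ← hq]; rfl
  | mul_X p i hp =>
    rw [map_mul, polyMul_mul, polyMul_mul, hp]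
    congr 1
    funext k
    simp only [slice, rename_X, polyMul_X]
    congr 1
    funext j
    by_cases hj : ∃ t, e t = j
    · obtain ⟨t, rfl⟩ := hj
      simp [he.extend_apply, Pi.single_apply, he.eq_iff]
    · rw [Pi.sub_apply, Function.extend_apply' _ _ _ hj, Function.extend_apply' _ _ _ hj,
        Pi.single_eq_of_ne (fun h => hj ⟨i, h.symm⟩), sub_zero]

theorem polyMul_rename {s : ℕ} {e : Fin s → Fin r} (he : Function.Injective e)
    (p : MvPolynomial (Fin s) ℂ) (F : (Fin r → ℤ) → M) (n : Fin r → ℤ) :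
    polyMul (rename e p) F n = polyMul p (slice e F n) (n ∘ e) := by
  rw [← slice_polyMul he, slice_self he]

/-- Closure of a property of series under multiplication by polynomials. -/
theorem polyMul_induction {P : ((Fin r → ℤ) → M) → Prop} (p : MvPolynomial (Fin r) ℂ)
    (add : ∀ F G, P F → P G → P (F + G)) (smul : ∀ (c : ℂ) F, P F → P (c • F))
    (X : ∀ i F, P F → P (polyMul (X i) F)) {F : (Fin r → ℤ) → M} (hF : P F) :
    P (polyMul p F) := by
  induction p using MvPolynomial.induction_on generalizing F with
  | C c => rw [polyMul_C]; exact smul c F hF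
  | add p q hp hq => rw [polyMul_add_left]; exact add _ _ (hp hF) (hq hF)
  | mul_X p i hp => rw [polyMul_mul]; exact hp (X i F hF)

/-- An additive operation that intertwines the multiplications by the variables with
multiplications by polynomials intertwines multiplication by `p` with multiplication by the
polynomial obtained from `p` by substitution. -/
theorem intertwine {s : ℕ} {P : ((Fin r → ℤ) → M) → Prop} (φ : Fin r → MvPolynomial (Fin s) ℂ)
    (T : ((Fin r → ℤ) → M) → (Fin s → ℤ) → N)
    (Padd : ∀ F G, P F → P G → P (F + G)) (Psmul : ∀ (c : ℂ) F, P F → P (c • F))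
    (PX : ∀ i F, P F → P (polyMul (X i) F))
    (Tadd : ∀ F G, P F → P G → T (F + G) = T F + T G)
    (Tsmul : ∀ (c : ℂ) F, P F → T (c • F) = c • T F)
    (TX : ∀ i F, P F → T (polyMul (X i) F) = polyMul (φ i) (T F))
    (p : MvPolynomial (Fin r) ℂ) {F : (Fin r → ℤ) → M} (hF : P F) :
    T (polyMul p F) = polyMul (aeval φ p) (T F) := by
  induction p using MvPolynomial.induction_on generalizing F with
  | C c => rw [polyMul_C, Tsmul c F hF, aeval_C, algebraMap_eq, polyMul_C]
  | add p q hp hq =>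
    rw [polyMul_add_left, map_add, polyMul_add_left, Tadd _ _ (polyMul_induction p Padd Psmul PX hF)
      (polyMul_induction q Padd Psmul PX hF), hp hF, hq hF]
  | mul_X p i hp =>
    rw [polyMul_mul, map_mul, polyMul_mul, hp (PX i F hF), TX i F hF, aeval_X]

end PolyMul

/-! ### Substitutions of formal series -/

section Subst

variable {M N : Type*} [AddCommGroup M] [Module ℂ M] [AddCommGroup N] [Module ℂ N] {r : ℕ}

open MvPolynomial Function

/-- The substitution that expands `x_i ^ m` as `∑_a κ(m, a) x_i^a x^{(m - a)(e_i - v)}`. -/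
def kerSubst (i : Fin r) (v : Fin r → ℤ) (κ : ℤ → ℤ → ℂ) (F : (Fin r → ℤ) → M) :
    (Fin r → ℤ) → M :=
  fun n => ∑ᶠ m : ℤ, κ m (n i) • F (n + (m - n i) • v)

/-- The series for which every coefficient of `kerSubst i v κ F` is a finite sum. -/
def KerDom (v : Fin r → ℤ) (κ : ℤ → ℤ → ℂ) (F : (Fin r → ℤ) → M) : Prop :=
  ∀ (n : Fin r → ℤ) (a : ℤ), {m : ℤ | κ m a ≠ 0 ∧ F (n + m • v) ≠ 0}.Finite

section Ker

variable {i : Fin r} {v : Fin r → ℤ} {κ : ℤ → ℤ → ℂ} {F G : (Fin r → ℤ) → M}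

theorem KerDom.finite_support (h : KerDom v κ F) (n : Fin r → ℤ) (a c : ℤ) :
    (support fun m : ℤ => κ (m + c) a • F (n + m • v)).Finite := by
  refine ((h (n - c • v) a).preimage ((add_left_injective c).injOn)).subset fun m hm => ?_
  have h1 : κ (m + c) a ≠ 0 := fun h0 => hm (by simp [h0])
  have h2 : F (n + m • v) ≠ 0 := fun h0 => hm (by change _ • _ = _; rw [h0, smul_zero])
  refine ⟨h1, ?_⟩
  rwa [show n - c • v + (m + c) • v = n + m • v by rw [add_smul]; abel]

theorem KerDom.finite_support' (h : KerDom v κ F) (n : Fin r → ℤ) (a b : ℤ) :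
    (support fun m : ℤ => κ m a • F (n + (m - b) • v)).Finite := by
  have := h.finite_support (n - b • v) a 0
  simp only [add_zero] at this
  convert this using 5
  rw [sub_smul]; abel

theorem KerDom.add (hF : KerDom v κ F) (hG : KerDom v κ G) : KerDom v κ (F + G) := by
  intro n a
  refine ((hF n a).union (hG n a)).subset fun m hm => ?_
  by_contra hne
  simp only [Set.mem_union, Set.mem_ofPred_eq, not_or, not_and, not_not] at hne
  exact hm.2 (by rw [Pi.add_apply, hne.1 hm.1, hne.2 hm.1, add_zero])

theorem KerDom.smul (c : ℂ) (hF : KerDom v κ F) : KerDom v κ (c • F) := by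
  intro n a
  refine (hF n a).subset fun m hm => ⟨hm.1, fun h => hm.2 ?_⟩
  rw [Pi.smul_apply, h, smul_zero]

theorem KerDom.X (k : Fin r) (hF : KerDom v κ F) : KerDom v κ (polyMul (X k) F) := by
  intro n a
  refine (hF (n - Pi.single k 1) a).subset fun m hm => ⟨hm.1, ?_⟩
  have := hm.2
  rwa [polyMul_X, add_sub_right_comm] at this

theorem KerDom.map (L : M →ₗ[ℂ] N) (hF : KerDom v κ F) : KerDom v κ (fun n => L (F n)) := by
  intro n a
  refine (hF n a).subset fun m hm => ⟨hm.1, fun h => hm.2 ?_⟩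
  change L (F _) = 0
  rw [h, map_zero]

theorem kerSubst_add (hF : KerDom v κ F) (hG : KerDom v κ G) :
    kerSubst i v κ (F + G) = kerSubst i v κ F + kerSubst i v κ G := by
  funext n
  simp only [kerSubst, Pi.add_apply, smul_add]
  exact finsum_add_distrib (hF.finite_support' n _ _) (hG.finite_support' n _ _)

theorem kerSubst_smul (c : ℂ) : kerSubst i v κ (c • F) = c • kerSubst i v κ F := by
  funext n
  simp only [kerSubst, Pi.smul_apply]
  rw [smul_finsum]
  exact finsum_congr fun m => smul_comm _ _ _

theorem kerSubst_sub (hF : KerDom v κ F) (hG : KerDom v κ G) :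
    kerSubst i v κ (F - G) = kerSubst i v κ F - kerSubst i v κ G := by
  have h : F - G = F + (-1 : ℂ) • G := by simp [sub_eq_add_neg]
  rw [h, kerSubst_add hF (hG.smul _), kerSubst_smul]; simp [sub_eq_add_neg]

theorem kerSubst_map (L : M →ₗ[ℂ] N) (hF : KerDom v κ F) (n : Fin r → ℤ) :
    kerSubst i v κ (fun n => L (F n)) n = L (kerSubst i v κ F n) := by
  unfold kerSubst
  have h := L.toAddMonoidHom.map_finsum (hF.finite_support' n (n i) (n i))
  simp only [LinearMap.toAddMonoidHom_coe, map_smul] at h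
  exact h.symm

/-- By `intertwine` only multiplication by a single variable matters. For `x_i` the hypothesis `hκ`
is Pascal's rule, the expansion of `y^m = y · y^{m-1}` with `y = c₀ x_i + c₁ x^{e_i - v}`. One
statement thus serves shifts, where `e_i - v = e_j`, and affine maps, where `e_i - v = 0`, in either
direction of expansion. -/
theorem kerSubst_polyMul {c₀ c₁ : ℂ} {φ : Fin r → MvPolynomial (Fin r) ℂ} (hv : v i = 1)
    (hκ : ∀ m a, κ m a = c₀ * κ (m - 1) (a - 1) + c₁ * κ (m - 1) a)
    (hφi : ∀ (G : (Fin r → ℤ) → M) (n : Fin r → ℤ), polyMul (φ i) G n =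
      c₀ • G (n - Pi.single i 1) + c₁ • G (n - Pi.single i 1 + v))
    (hφ : ∀ k, k ≠ i → φ k = X k) (p : MvPolynomial (Fin r) ℂ) (hF : KerDom v κ F) :
    kerSubst i v κ (polyMul p F) = polyMul (aeval φ p) (kerSubst i v κ F) := by
  refine intertwine (P := KerDom v κ) φ (kerSubst i v κ) (fun _ _ => KerDom.add)
    (fun c _ => KerDom.smul c) (fun k _ => KerDom.X k) (fun _ _ => kerSubst_add)
    (fun c _ _ => kerSubst_smul c) (fun k F hF => ?_) p hF
  funext n
  by_cases hk : k = i
  · subst hk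
    rw [hφi]
    simp only [kerSubst, polyMul_X]
    have h1 : (n - Pi.single k 1 : Fin r → ℤ) k = n k - 1 := by simp
    have h2 : (n - Pi.single k 1 + v : Fin r → ℤ) k = n k := by simp [hv]
    rw [h1, h2, smul_finsum, smul_finsum]
    rw [← finsum_add_distrib]
    -- The factor `x_k` moves the summation index by one; after reindexing, the recursion applies
    -- term by term.
    · rw [← finsum_comp_equiv (Equiv.addRight (1 : ℤ))]
      refine finsum_congr fun m => ?_
      simp only [Equiv.coe_addRight]
      rw [hκ, add_smul, mul_smul, mul_smul]
      have e : ∀ b : ℤ, n + b • v - Pi.single k 1 = n - Pi.single k 1 + b • v := fun b => by abel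
      congr 4
      · simp
      · rw [e]; congr 2; ring
      · simp
      · rw [e, add_assoc]; congr 1
        rw [show m + 1 - n k = 1 + (m - n k) by ring, add_smul, one_smul]
    · exact (hF.finite_support' (n - Pi.single k 1) (n k - 1) (n k - 1)).subset
        (support_const_smul_subset _ _)
    · exact (hF.finite_support' (n - Pi.single k 1 + v) (n k) (n k)).subset
        (support_const_smul_subset _ _)
  · rw [hφ k hk, polyMul_X]
    simp only [kerSubst, polyMul_X]
    have h1 : (n - Pi.single k 1 : Fin r → ℤ) i = n i := by simp [Ne.symm hk]
    rw [h1]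
    refine finsum_congr fun m => ?_
    congr 2
    abel

end Ker

/-! ### The binomial kernels -/

/-- The coefficient of `x^a y^{m-a}` in `(y + x)^m`, expanded in nonnegative powers of `x`. -/
def kerInf (m a : ℤ) : ℂ := if 0 ≤ a then ((Ring.choose m a.toNat : ℤ) : ℂ) else 0

/-- The coefficient of `x^a` in `(c₀ x + c₁)^m`, expanded in nonnegative powers of `c₁`. -/
def kerZero (c₀ c₁ : ℂ) (m a : ℤ) : ℂ :=
  if a ≤ m then ((Ring.choose m (m - a).toNat : ℤ) : ℂ) * c₀ ^ a * c₁ ^ (m - a).toNat else 0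

theorem kerInf_natCast (m : ℤ) (a : ℕ) : kerInf m a = ((Ring.choose m a : ℤ) : ℂ) := by
  simp [kerInf]

theorem kerInf_of_neg {m a : ℤ} (h : a < 0) : kerInf m a = 0 := if_neg (not_le.2 h)

theorem kerZero_add_natCast (c₀ c₁ : ℂ) (a : ℤ) (t : ℕ) :
    kerZero c₀ c₁ (a + t) a = ((Ring.choose (a + t) t : ℤ) : ℂ) * c₀ ^ a * c₁ ^ t := by
  simp [kerZero]

theorem kerZero_of_lt {c₀ c₁ : ℂ} {m a : ℤ} (h : m < a) : kerZero c₀ c₁ m a = 0 :=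
  if_neg (not_le.2 h)

theorem choose_pascal (m : ℤ) (k : ℕ) :
    Ring.choose m (k + 1) = Ring.choose (m - 1) k + Ring.choose (m - 1) (k + 1) := by
  have := Ring.choose_succ_succ (m - 1) k
  rwa [sub_add_cancel] at this

/-- Pascal's rule. It holds for every integer `a` because the kernel is set to zero for `a < 0`. -/
theorem kerInf_rec (m a : ℤ) :
    kerInf m a = 1 * kerInf (m - 1) (a - 1) + 1 * kerInf (m - 1) a := by
  rcases lt_trichotomy a 0 with h | rfl | h
  · rw [kerInf_of_neg h, kerInf_of_neg h, kerInf_of_neg (by omega)]; simp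
  · rw [kerInf_of_neg (show (0 : ℤ) - 1 < 0 by norm_num)]; simp [kerInf]
  · obtain ⟨k, rfl⟩ : ∃ k : ℕ, a = k + 1 := ⟨(a - 1).toNat, by omega⟩
    rw [show ((k : ℤ) + 1) = ((k + 1 : ℕ) : ℤ) by simp, kerInf_natCast, kerInf_natCast,
      show ((k + 1 : ℕ) : ℤ) - 1 = (k : ℤ) by simp, kerInf_natCast, choose_pascal]
    push_cast; ring

/-- Pascal's rule in `m - a`. As `a` may be negative, `c₀ * c₀ ^ (a - 1) = c₀ ^ a` needs `c₀ ≠ 0`.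
-/
theorem kerZero_rec {c₀ : ℂ} (h₀ : c₀ ≠ 0) (c₁ : ℂ) (m a : ℤ) :
    kerZero c₀ c₁ m a =
      c₀ * kerZero c₀ c₁ (m - 1) (a - 1) + c₁ * kerZero c₀ c₁ (m - 1) a := by
  rcases lt_trichotomy m a with h | rfl | h
  · rw [kerZero_of_lt h, kerZero_of_lt (by omega), kerZero_of_lt (by omega)]; simp
  · rw [kerZero_of_lt (show m - 1 < m by omega)]
    simp only [kerZero, le_refl, sub_self, if_true]
    rw [zpow_sub_one₀ h₀]
    simp
    field_simp
  · obtain ⟨t, rfl⟩ : ∃ t : ℕ, m = a + ((t + 1 : ℕ) : ℤ) := ⟨(m - a - 1).toNat, by omega⟩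
    rw [show a + ((t + 1 : ℕ) : ℤ) - 1 = (a - 1) + ((t + 1 : ℕ) : ℤ) by ring,
      kerZero_add_natCast, kerZero_add_natCast,
      show (a - 1) + ((t + 1 : ℕ) : ℤ) = a + (t : ℤ) by push_cast; ring,
      kerZero_add_natCast, choose_pascal,
      show a + ((t + 1 : ℕ) : ℤ) - 1 = a + (t : ℤ) by push_cast; ring, zpow_sub_one₀ h₀]
    push_cast
    field_simp
    ring

/-! ### The shift and affine substitutions -/

/-- `x_i ↦ x_j + x_i` with expansion in nonnegative powers of `x_i`. -/
def shiftInf (i j : Fin r) : ((Fin r → ℤ) → M) → (Fin r → ℤ) → M :=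
  kerSubst i (Pi.single i 1 - Pi.single j 1) kerInf

/-- `x_i ↦ x_i + x_j` with expansion in nonnegative powers of `x_j`. -/
def shiftZero (i j : Fin r) : ((Fin r → ℤ) → M) → (Fin r → ℤ) → M :=
  kerSubst i (Pi.single i 1 - Pi.single j 1) (kerZero 1 1)

/-- `x_i ↦ g(x_i)` with expansion in nonnegative powers of `c₁`. -/
def affineSubst (i : Fin r) (g : LinTransf) : ((Fin r → ℤ) → M) → (Fin r → ℤ) → M :=
  kerSubst i (Pi.single i 1) (kerZero g.c₀ g.c₁)

/-- `x_i ↦ x_i + x_j` on polynomials. -/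
def shiftPolyVar (i j : Fin r) : MvPolynomial (Fin r) ℂ →ₐ[ℂ] MvPolynomial (Fin r) ℂ :=
  aeval (update X i (X i + X j))

/-- `x_i ↦ g(x_i)` on polynomials. -/
def affinePolyVar (i : Fin r) (g : LinTransf) :
    MvPolynomial (Fin r) ℂ →ₐ[ℂ] MvPolynomial (Fin r) ℂ :=
  aeval (update X i (C (g.c₀ : ℂ) * X i + C g.c₁))

abbrev ShiftInfDom (i j : Fin r) (F : (Fin r → ℤ) → M) : Prop :=
  KerDom (Pi.single i 1 - Pi.single j 1) kerInf F

abbrev ShiftZeroDom (i j : Fin r) (F : (Fin r → ℤ) → M) : Prop :=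
  KerDom (Pi.single i 1 - Pi.single j 1) (kerZero 1 1) F

abbrev AffineDom (i : Fin r) (g : LinTransf) (F : (Fin r → ℤ) → M) : Prop :=
  KerDom (Pi.single i 1) (kerZero g.c₀ g.c₁) F

theorem shiftInf_polyMul {i j : Fin r} (hij : i ≠ j) (p : MvPolynomial (Fin r) ℂ)
    {F : (Fin r → ℤ) → M} (hF : ShiftInfDom i j F) :
    shiftInf i j (polyMul p F) = polyMul (shiftPolyVar i j p) (shiftInf i j F) := by
  refine kerSubst_polyMul (c₀ := 1) (c₁ := 1) (by simp [hij]) kerInf_rec (fun G n => ?_)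
    (fun k hk => update_of_ne hk _ _) p hF
  rw [update_self, polyMul_add_left, Pi.add_apply, polyMul_X, polyMul_X, one_smul, one_smul]
  congr 2
  abel

theorem shiftZero_polyMul {i j : Fin r} (hij : i ≠ j) (p : MvPolynomial (Fin r) ℂ)
    {F : (Fin r → ℤ) → M} (hF : ShiftZeroDom i j F) :
    shiftZero i j (polyMul p F) = polyMul (shiftPolyVar i j p) (shiftZero i j F) := by
  refine kerSubst_polyMul (c₀ := 1) (c₁ := 1) (by simp [hij]) (kerZero_rec one_ne_zero 1)
    (fun G n => ?_) (fun k hk => update_of_ne hk _ _) p hF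
  rw [update_self, polyMul_add_left, Pi.add_apply, polyMul_X, polyMul_X, one_smul, one_smul]
  congr 2
  abel

theorem affineSubst_polyMul (i : Fin r) (g : LinTransf) (p : MvPolynomial (Fin r) ℂ)
    {F : (Fin r → ℤ) → M} (hF : AffineDom i g F) :
    affineSubst i g (polyMul p F) = polyMul (affinePolyVar i g p) (affineSubst i g F) := by
  refine kerSubst_polyMul (c₀ := g.c₀) (c₁ := g.c₁) (by simp) (kerZero_rec g.c₀.ne_zero g.c₁)
    (fun G n => ?_) (fun k hk => update_of_ne hk _ _) p hF
  rw [update_self, polyMul_add_left, Pi.add_apply, polyMul_mul, polyMul_C, polyMul_C,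
    Pi.smul_apply, Pi.smul_apply, polyMul_X, sub_add_cancel]

theorem finsum_nat_eq_finsum_int (a : ℤ) (f : ℤ → M) (hf : ∀ m, m < a → f m = 0) :
    ∑ᶠ t : ℕ, f (a + t) = ∑ᶠ m : ℤ, f m := by
  have hinj : Injective fun t : ℕ => a + (t : ℤ) := fun s t h => by simpa using h
  rw [← finsum_mem_range (f := f) hinj, finsum_mem_def]
  refine finsum_congr fun m => ?_
  by_cases hm : m ∈ Set.range fun t : ℕ => a + (t : ℤ)
  · exact Set.indicator_of_mem hm _
  · rw [Set.indicator_of_notMem hm, hf]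
    by_contra hlt
    exact hm ⟨(m - a).toNat, by simp; omega⟩

theorem substInf_eq_shiftInf (F : (Fin 2 → ℤ) → M) : substInf F = shiftInf 0 1 F := by
  funext n
  unfold substInf shiftInf kerSubst
  split_ifs with h
  · refine finsum_congr fun m => ?_
    rw [kerInf, if_pos h, Int.cast_smul_eq_zsmul]
    congr 2
    funext k
    fin_cases k <;> simp
    ring
  · rw [finsum_eq_zero_of_forall_eq_zero]
    intro m
    rw [kerInf_of_neg (not_le.1 h), zero_smul]

theorem substZero_eq_shiftZero (F : (Fin 2 → ℤ) → M) : substZero F = shiftZero 0 1 F := by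
  funext n
  unfold substZero shiftZero kerSubst
  rw [← finsum_nat_eq_finsum_int (n 0) _ fun m hm => by rw [kerZero_of_lt hm, zero_smul]]
  refine finsum_congr fun t => ?_
  rw [kerZero_add_natCast, one_zpow, one_pow, mul_one, mul_one, Int.cast_smul_eq_zsmul]
  congr 2
  funext k
  fin_cases k <;> simp
  ring

theorem shiftInf_apply (i j : Fin r) (F : (Fin r → ℤ) → M) (n : Fin r → ℤ) :
    shiftInf i j F n =
      ∑ᶠ m : ℤ, kerInf m (n i) • F (n + (m - n i) • (Pi.single i 1 - Pi.single j 1)) := rfl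

theorem shiftInf_of_neg {i j : Fin r} {F : (Fin r → ℤ) → M} {n : Fin r → ℤ} (h : n i < 0) :
    shiftInf i j F n = 0 := by
  rw [shiftInf_apply]
  exact finsum_eq_zero_of_forall_eq_zero fun m => by rw [kerInf_of_neg h, zero_smul]

theorem pair_injective {i j : Fin r} (h : i ≠ j) : Injective ![i, j] := by
  intro a b
  fin_cases a <;> fin_cases b <;> simp [h, h.symm]

/-- The substitution mixes only the exponents of `x_i` and `x_j`, so it commutes with freezing the
others. -/
theorem slice_shiftInf {i j : Fin r} (hij : i ≠ j) (F : (Fin r → ℤ) → M) (n : Fin r → ℤ) :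
    slice ![i, j] (shiftInf i j F) n = shiftInf 0 1 (slice ![i, j] F n) := by
  have hinj := pair_injective hij
  funext k
  simp only [slice, shiftInf_apply]
  have e0 : extend ![i, j] k n i = k 0 := hinj.extend_apply k n 0
  rw [e0]
  refine finsum_congr fun m => ?_
  congr 2
  funext l
  by_cases hl : ∃ t, ![i, j] t = l
  · obtain ⟨t, rfl⟩ := hl
    rw [Pi.add_apply, hinj.extend_apply, hinj.extend_apply]
    fin_cases t <;> simp [hij, hij.symm]
  · rw [Pi.add_apply, extend_apply' _ _ _ hl, extend_apply' _ _ _ hl]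
    have h0 : l ≠ i := fun h => hl ⟨0, h.symm⟩
    have h1 : l ≠ j := fun h => hl ⟨1, h.symm⟩
    simp [h0, h1]

section Fields

variable {W : Type*} [AddCommGroup W] [Module ℂ W]

theorem cf_subst_apply (g : LinTransf) (a : EInf W) (k : ℤ) (w : W) :
    cf (subst g a) k w = ∑ᶠ m : ℤ, kerZero g.c₀ g.c₁ m k • cf a m w := by
  rw [← finsum_nat_eq_finsum_int k _ fun m hm => by rw [kerZero_of_lt hm, zero_smul], subst,
    cf_mkEInf]
  change (∑ᶠ i : ℕ, _) = _
  exact finsum_congr fun t => by rw [kerZero_add_natCast]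

end Fields

end Subst

/-! ### The vertex operators `Y(a(x), x₀)` in terms of multiplication by polynomials -/

section Iter

variable {W : Type*} [AddCommGroup W] [Module ℂ W]

open MvPolynomial Function

/-- The coefficients of an element of `W((x⁻¹))((x₀))`. -/
def IterSeries.coeffs (y : IterSeries W) : (Fin 2 → ℤ) → W :=
  fun n => ((HahnModule.of ℂ).symm (y.coeff (n 0))).coeff (toDual (n 1))

theorem IterSeries.coeffs_injective : Injective (IterSeries.coeffs (W := W)) := by
  intro y z h
  refine IterSeries.ext' fun j => HahnModule.ext _ _ (funext fun k => ?_)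
  exact congrFun h ![j, ofDual k]

/-- The embedding of `ℂ[x₀, x]` in `ℂ((x⁻¹))((x₀))`. -/
def polyToIter : MvPolynomial (Fin 2) ℂ →ₐ[ℂ] IterField :=
  aeval ![IterField.monomial 1 0 1, IterField.monomial 0 1 1]

theorem IterSeries.coeffs_C_smul (c : ℂ) (y : IterSeries W) :
    (polyToIter (C c) • y).coeffs = c • y.coeffs := by
  funext n
  have h : polyToIter (C c) = IterField.monomial 0 0 c := by
    rw [polyToIter, aeval_C]
    refine (HahnSeries.algebraMap_apply' (Γ := ℤ) (R := HahnSeries ℤᵒᵈ ℂ) (S := ℂ)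
      (x := c)).trans ?_
    rw [PowerSeries.algebraMap_apply, HahnSeries.ofPowerSeries_C, HahnSeries.algebraMap_apply]
    rfl
  simp only [h, IterSeries.coeffs, IterSeries.coeff_constSmul]
  rfl

theorem IterSeries.coeffs_X_smul (i : Fin 2) (y : IterSeries W) :
    (polyToIter (X i) • y).coeffs = polyMul (X i) y.coeffs := by
  funext n
  rw [polyMul_X]
  fin_cases i
  · have h : polyToIter (X 0) = IterField.monomial 1 0 1 := by simp [polyToIter]
    have h' : (IterField.monomial 1 0 1 • y).coeff (1 + (n 0 - 1)) = y.coeff (n 0 - 1) :=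
      (HahnModule.coeff_single_smul_vadd (Γ := ℤ) (R := HahnSeries ℤᵒᵈ ℂ)
        (V := HahnModule ℤᵒᵈ ℂ W) (x := y) (b := (1 : ℤ)) (a := (n 0 - 1 : ℤ))).trans
        (one_smul (HahnSeries ℤᵒᵈ ℂ) _)
    simp only [Fin.zero_eta, h, IterSeries.coeffs]
    rw [show n 0 = 1 + (n 0 - 1) by ring, h']
    simp
  · have h : polyToIter (X 1) = IterField.monomial 0 1 1 := by simp [polyToIter]
    have h' : (IterField.monomial 0 1 1 • y).coeff (n 0) =
        (HahnSeries.single (toDual (1 : ℤ)) (1 : ℂ)) • y.coeff (n 0) :=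
      HahnModule.coeff_single_zero_smul (Γ := ℤ) (R := HahnSeries ℤᵒᵈ ℂ)
        (V := HahnModule ℤᵒᵈ ℂ W) (x := y)
    simp only [Fin.mk_one, h, IterSeries.coeffs, h']
    have := HahnModule.coeff_single_smul_vadd (Γ := ℤᵒᵈ) (R := ℂ) (V := W) (r := 1)
      (x := y.coeff (n 0)) (b := toDual (1 : ℤ)) (a := toDual (n 1 - 1 : ℤ))
    rw [show toDual (n 1) = toDual (1 : ℤ) +ᵥ toDual (n 1 - 1 : ℤ) from
      congrArg toDual (show n 1 = 1 + (n 1 - 1) by ring), this]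
    simp

theorem IterSeries.coeffs_add (y z : IterSeries W) : (y + z).coeffs = y.coeffs + z.coeffs := rfl

/-- Identifies the action of the field `ℂ((x⁻¹))((x₀))`, restricted to polynomials, with
multiplication of coefficient families. Division in the field thereby becomes cancellation of
polynomial factors. -/
theorem IterSeries.coeffs_smul (q : MvPolynomial (Fin 2) ℂ) (y : IterSeries W) :
    (polyToIter q • y).coeffs = polyMul q y.coeffs := by
  induction q using MvPolynomial.induction_on generalizing y with
  | C c => rw [coeffs_C_smul, polyMul_C]
  | add p q hp hq => rw [map_add, add_smul, coeffs_add, hp, hq, polyMul_add_left]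
  | mul_X p i hp => rw [map_mul, mul_smul, hp, coeffs_X_smul, polyMul_mul]

/-- Acting on the series `1` recovers the coefficients of `q`, one of which is nonzero. -/
theorem polyToIter_ne_zero {q : MvPolynomial (Fin 2) ℂ} (hq : q ≠ 0) : polyToIter q ≠ 0 := by
  intro h
  obtain ⟨s, hs⟩ := MvPolynomial.ne_zero_iff.1 hq
  let y : IterSeries ℂ := HahnModule.of (HahnSeries ℤᵒᵈ ℂ)
    (HahnSeries.single (0 : ℤ)
      (HahnModule.of ℂ (HahnSeries.single (toDual (0 : ℤ)) (1 : ℂ)) : HahnModule ℤᵒᵈ ℂ ℂ))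
  have hy0 : y.coeffs (fun _ => 0) = 1 := by
    change (((HahnModule.of ℂ).symm ((HahnSeries.single (0 : ℤ) (_ : HahnModule ℤᵒᵈ ℂ ℂ)).coeff
      0)).coeff _ : ℂ) = 1
    rw [HahnSeries.coeff_single_same]
    exact HahnSeries.coeff_single_same _ _
  have hy : ∀ n : Fin 2 → ℤ, n ≠ 0 → y.coeffs n = 0 := by
    intro n hn
    change (((HahnModule.of ℂ).symm ((HahnSeries.single (0 : ℤ) (_ : HahnModule ℤᵒᵈ ℂ ℂ)).coeff
      (n 0))).coeff (toDual (n 1)) : ℂ) = 0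
    by_cases h0 : n 0 = 0
    · rw [h0, HahnSeries.coeff_single_same]
      refine HahnSeries.coeff_single_of_ne fun h1 => hn ?_
      funext i
      fin_cases i
      · exact h0
      · exact congrArg ofDual h1
    · rw [HahnSeries.coeff_single_of_ne h0]; rfl
  have h1 := congrFun (IterSeries.coeffs_smul q y) (fun i => (s i : ℤ))
  rw [h, zero_smul, polyMul, Finset.sum_eq_single s] at h1
  · simp only [sub_self, hy0] at h1
    refine hs ?_
    exact (show _ = IterSeries.coeffs (0 : IterSeries ℂ) _ by simpa using h1.symm).trans rfl
  · intro t _ hts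
    rw [hy, smul_zero]
    intro h0
    apply hts
    ext i
    have := congrFun h0 i
    simp only [Pi.zero_apply] at this
    omega
  · intro h2
    rw [MvPolynomial.notMem_support_iff.1 h2, zero_smul]

/-- The inverse substitution is `x_i ↦ x_i - x_j`. -/
theorem shiftPolyVar_injective {r : ℕ} {i j : Fin r} (hij : i ≠ j) :
    Injective (shiftPolyVar i j) := by
  refine LeftInverse.injective (g := aeval (update X i (X i - X j : MvPolynomial (Fin r) ℂ)))
    fun p => ?_
  have : (aeval (update X i (X i - X j : MvPolynomial (Fin r) ℂ))).comp (shiftPolyVar i j) =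
      AlgHom.id ℂ _ := by
    ext k
    by_cases hk : k = i
    · subst hk; simp [shiftPolyVar, hij.symm]
    · simp [shiftPolyVar, hk]
  exact DFunLike.congr_fun this p

theorem shiftPolyVar_ne_zero {r : ℕ} {i j : Fin r} (hij : i ≠ j) {p : MvPolynomial (Fin r) ℂ}
    (hp : p ≠ 0) : shiftPolyVar i j p ≠ 0 :=
  (map_ne_zero_iff _ (shiftPolyVar_injective hij)).2 hp

theorem shiftPoly_eq (p : MvPolynomial (Fin 2) ℂ) :
    shiftPoly p = polyToIter (shiftPolyVar 0 1 p) := by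
  have : (polyToIter.comp (shiftPolyVar 0 1)) = aeval
    ![IterField.monomial 1 0 1 + IterField.monomial 0 1 1, IterField.monomial 0 1 1] := by
    ext k
    fin_cases k <;> simp [shiftPolyVar, polyToIter]
  exact (DFunLike.congr_fun this p).symm

/-! ### Cancellation of polynomials in `W((x⁻¹))((x₀))` -/

/-- Series with powers of `x_i` bounded below, and for each power of `x_i` powers of `x_j` bounded
above, in two variables. -/
structure IterBounded (D : (Fin 2 → ℤ) → W) : Prop where
  lower : ∃ J : ℤ, ∀ n, n 0 < J → D n = 0
  upper : ∀ i : ℤ, ∃ N : ℤ, ∀ n, n 0 = i → N < n 1 → D n = 0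

theorem IterBounded.exists_coeffs {D : (Fin 2 → ℤ) → W} (hD : IterBounded D) :
    ∃ y : IterSeries W, y.coeffs = D := by
  have h1 : ∀ j : ℤ, (support fun k : ℤᵒᵈ => D ![j, ofDual k]).IsPWO := fun j => by
    obtain ⟨N, hN⟩ := hD.upper j
    exact isPWO_of_bound N fun k hk => not_lt.1 fun h => hk (hN _ rfl h)
  have h2 : (support fun j : ℤ => (HahnModule.of ℂ (V := W)
      ⟨fun k : ℤᵒᵈ => D ![j, ofDual k], h1 j⟩ : HahnModule ℤᵒᵈ ℂ W)).IsPWO := by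
    obtain ⟨J, hJ⟩ := hD.lower
    have : BddBelow (support fun j : ℤ => (HahnModule.of ℂ (V := W)
      ⟨fun k : ℤᵒᵈ => D ![j, ofDual k], h1 j⟩ : HahnModule ℤᵒᵈ ℂ W)) := by
      refine ⟨J, fun j hj => not_lt.1 fun h => hj ?_⟩
      exact HahnModule.ext _ _ (funext fun k => hJ _ h)
    exact this.isWF.isPWO
  refine ⟨HahnModule.of (HahnSeries ℤᵒᵈ ℂ) ⟨_, h2⟩, ?_⟩
  funext n
  change D ![n 0, n 1] = D n
  congr 1
  funext i
  fin_cases i <;> rfl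

/-- Such a family is an element of `W((x⁻¹))((x₀))`, a vector space over a field in which `q` is
nonzero, so it has no `q`-torsion. The boundedness is essential: arbitrary doubly infinite series do
have torsion. -/
theorem IterBounded.eq_zero {D : (Fin 2 → ℤ) → W} (hD : IterBounded D)
    {q : MvPolynomial (Fin 2) ℂ} (hq : q ≠ 0) (h : polyMul q D = 0) : D = 0 := by
  obtain ⟨y, rfl⟩ := hD.exists_coeffs
  rw [← IterSeries.coeffs_smul] at h
  have : polyToIter q • y = 0 := IterSeries.coeffs_injective (h.trans rfl)
  rw [(smul_eq_zero_iff_right (polyToIter_ne_zero hq)).1 this]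
  rfl

theorem IterBounded.sub {D E : (Fin 2 → ℤ) → W} (hD : IterBounded D) (hE : IterBounded E) :
    IterBounded (D - E) := by
  obtain ⟨J, hJ⟩ := hD.lower
  obtain ⟨K, hK⟩ := hE.lower
  refine ⟨⟨min J K, fun n hn => ?_⟩, fun i => ?_⟩
  · rw [Pi.sub_apply, hJ n (by omega), hK n (by omega), sub_zero]
  · obtain ⟨N, hN⟩ := hD.upper i
    obtain ⟨N', hN'⟩ := hE.upper i
    exact ⟨max N N', fun n h0 hn => by
      rw [Pi.sub_apply, hN n h0 (by omega), hN' n h0 (by omega), sub_zero]⟩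

theorem IterBounded.eq {D E : (Fin 2 → ℤ) → W} (hD : IterBounded D) (hE : IterBounded E)
    {q : MvPolynomial (Fin 2) ℂ} (hq : q ≠ 0) (h : polyMul q D = polyMul q E) : D = E :=
  sub_eq_zero.1 ((hD.sub hE).eq_zero hq (by rw [polyMul_sub, h, sub_self]))

/-! ### The series `Y(a(x), x₀) b(x) w` and its defining property -/

/-- The series `Y(a(x), x₀) b(x) w` in `x₀, x`. -/
def Yser (a b : EInf W) (w : W) : (Fin 2 → ℤ) → W := fun n => cf (YCoeff a b (n 0)) (n 1) w

/-- Quasi-compatibility of a pair. -/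
def QCPair (a b : EInf W) : Prop :=
  ∃ p : MvPolynomial (Fin 2) ℂ, p ≠ 0 ∧ IsTruncated (polyMul p (opProd ![a, b]))

/-- The sum runs along a line of constant total degree in the two variables; two upper bounds leave
finitely many points on it. -/
theorem IsTruncated.shiftInfDom {T : (Fin 2 → ℤ) → Module.End ℂ W} (hT : IsTruncated T) (w : W) :
    ShiftInfDom 0 1 fun n => T n w := by
  intro n a
  obtain ⟨N, hN⟩ := hT w
  refine (Set.finite_Icc (n 1 - N) (N - n 0)).subset fun m hm => ?_
  by_contra hmem
  refine hm.2 (hN _ ?_)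
  rw [Set.mem_Icc, not_and_or] at hmem
  rcases hmem with h | h
  · exact ⟨1, by simp; omega⟩
  · exact ⟨0, by simp; omega⟩

theorem coeffs_shiftSeries (T : (Fin 2 → ℤ) → Module.End ℂ W) (hT : IsTruncated T) (w : W) :
    (shiftSeries T hT w).coeffs = shiftInf 0 1 fun n => T n w := by
  rw [← substInf_eq_shiftInf]
  funext n
  change substInf (fun n => T n w) ![n 0, n 1] = _
  congr 1
  funext i
  fin_cases i <;> rfl

theorem YCoeff_of_not_qcPair {a b : EInf W} (h : ¬ QCPair a b) (j : ℤ) : YCoeff a b j = 0 :=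
  dif_neg h

/-- Isolates the polynomial selected by choice in the definition of `YCoeff`. -/
theorem QCPair.exists_coeffs {a b : EInf W} (h : QCPair a b) :
    ∃ (p : MvPolynomial (Fin 2) ℂ) (_ : p ≠ 0) (hT : IsTruncated (polyMul p (opProd ![a, b]))),
      (∀ j, YCoeff a b j = divShiftCoeff p _ hT j) ∧
      ∀ w, Yser a b w = ((shiftPoly p)⁻¹ • shiftSeries _ hT w).coeffs := by
  have hY : ∀ j, YCoeff a b j = divShiftCoeff h.choose _ h.choose_spec.2 j := fun j => dif_pos h
  refine ⟨h.choose, h.choose_spec.1, h.choose_spec.2, hY, fun w => ?_⟩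
  funext n
  simp only [Yser, hY]
  rfl

/-- `p(x₀ + x, x) Y(a(x), x₀) b(x) = (p(x₁, x) a(x₁) b(x))|_{x₁ = x + x₀}`. -/
theorem Yser_spec {a b : EInf W} (h : QCPair a b) {p : MvPolynomial (Fin 2) ℂ}
    (hT : IsTruncated (polyMul p (opProd ![a, b]))) (w : W) :
    polyMul (shiftPolyVar 0 1 p) (Yser a b w) =
      shiftInf 0 1 fun n => polyMul p (opProd ![a, b]) n w := by
  obtain ⟨p₀, hp₀, hT₀, -, hY⟩ := h.exists_coeffs
  have hne : shiftPoly p₀ ≠ 0 := by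
    rw [shiftPoly_eq]; exact polyToIter_ne_zero (shiftPolyVar_ne_zero (by decide) hp₀)
  have key : polyMul (shiftPolyVar 0 1 p₀) (Yser a b w) =
      shiftInf 0 1 fun n => polyMul p₀ (opProd ![a, b]) n w := by
    rw [hY, ← IterSeries.coeffs_smul, ← shiftPoly_eq, smul_inv_smul₀ hne, coeffs_shiftSeries]
  rw [hY, ← coeffs_shiftSeries _ hT, ← IterSeries.coeffs_smul]
  congr 1
  have hne' := hne
  rw [shiftPoly_eq] at hne'
  -- Multiply both sides by `p₀(x₀ + x, x)`, with `p₀` the chosen polynomial: each becomes the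
  -- substitution `x₁ = x + x₀` in `p p₀ a(x₁) b(x) w`. This is the independence of `Y` from the
  -- polynomial.
  refine (smul_right_injective _ hne') (IterSeries.coeffs_injective ?_)
  simp only
  rw [IterSeries.coeffs_smul, IterSeries.coeffs_smul, IterSeries.coeffs_smul, coeffs_shiftSeries,
    ← hY, polyMul_comm, key, ← shiftInf_polyMul (by decide) p (hT₀.shiftInfDom w),
    ← shiftInf_polyMul (by decide) p₀ (hT.shiftInfDom w)]
  congr 1
  have e : ∀ q : MvPolynomial (Fin 2) ℂ, (fun n => polyMul q (opProd ![a, b]) n w) =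
      polyMul q (fun n => opProd ![a, b] n w) := fun q => funext fun n => polyMul_apply _ _ _ _
  rw [e, e, polyMul_comm]

/-- The series `A(x + x₀, x) w` has only nonnegative powers of `x₀`, so the order of `1 / p(x₀ + x,
x)` in `x₀` is a lower bound. It does not depend on `w`, which gives truncation of `Y(a(x), x₀)
b(x)` as an operator-valued series. -/
theorem YCoeff_lower (a b : EInf W) : ∃ J : ℤ, ∀ j < J, YCoeff a b j = 0 := by
  by_cases h : QCPair a b
  · obtain ⟨p, hp, hT, hY, -⟩ := h.exists_coeffs
    let s : HahnSeries ℤ (HahnSeries ℤᵒᵈ ℂ) := (shiftPoly p)⁻¹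
    -- The order in `x₀` of the inverse of `p(x₀ + x, x)`.
    refine ⟨s.order, fun j hj => ?_⟩
    rw [hY]
    refine LinearMap.ext fun w => ?_
    by_contra hne
    have hmem : j ∈ ((HahnModule.of (HahnSeries ℤᵒᵈ ℂ)).symm
      ((shiftPoly p)⁻¹ • shiftSeries _ hT w : IterSeries W)).support := hne
    obtain ⟨i, hi, k, hk, rfl⟩ := Set.mem_vadd.1 (HahnModule.support_smul_subset_vadd_support
      (Γ := ℤ) (Γ' := ℤ) (R := HahnSeries ℤᵒᵈ ℂ) (V := HahnModule ℤᵒᵈ ℂ W) (x := s)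
      (y := shiftSeries _ hT w) hmem)
    have hi' : s.order ≤ i := HahnSeries.order_le_of_coeff_ne_zero hi
    have hk' : 0 ≤ k := by
      by_contra hk0
      refine hk (HahnModule.ext _ _ (funext fun l => ?_))
      exact substInf_of_neg (F := fun n => polyMul p (opProd ![a, b]) n w) k (ofDual l) (by omega)
    simp only [vadd_eq_add] at hj
    omega
  · exact ⟨0, fun j _ => YCoeff_of_not_qcPair h j⟩

theorem Yser_iterBounded (a b : EInf W) (w : W) : IterBounded (Yser a b w) := by
  obtain ⟨J, hJ⟩ := YCoeff_lower a b
  refine ⟨⟨J, fun n hn => ?_⟩, fun i => ?_⟩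
  · rw [Yser, hJ _ hn]; simp [cf]
  · obtain ⟨N, hN⟩ := cf_bound (YCoeff a b i) w
    exact ⟨N, fun n h0 hn => by rw [Yser, h0, hN _ hn]⟩

end Iter

/-! ### Locality -/

section Locality

variable {W : Type*} [AddCommGroup W] [Module ℂ W]

open MvPolynomial Function

theorem cf_add (a b : EInf W) (n : ℤ) : cf (a + b) n = cf a n + cf b n := by
  simp only [cf, map_add, Pi.add_apply]

theorem cf_smul (c : ℂ) (a : EInf W) (n : ℤ) : cf (c • a) n = c • cf a n := by
  simp only [cf, map_smul, Pi.smul_apply]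

@[simp] theorem cf_zero (n : ℤ) : cf (0 : EInf W) n = 0 := by
  simp only [cf, map_zero, Pi.zero_apply]

theorem cf_ext {a b : EInf W} (h : ∀ n w, cf a n w = cf b n w) : a = b :=
  HVertexOperator.coeff_inj (funext fun n => LinearMap.ext fun w => h (ofDual n) w)

theorem cf_oneW (n : ℤ) : cf (oneW : EInf W) n = if n = 0 then 1 else 0 := by
  rw [oneW, cf_mkEInf]

/-! ### Series with all exponents but two frozen -/

section Slices

variable {M : Type*} [AddCommGroup M] [Module ℂ M] {r : ℕ}

theorem shiftInfDom_of_slice {i j : Fin r} (hij : i ≠ j) {F : (Fin r → ℤ) → M}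
    (h : ∀ n, ShiftInfDom 0 1 (slice ![i, j] F n)) : ShiftInfDom i j F := by
  intro n a
  have hinj := pair_injective hij
  refine (h n ![n i, n j] a).subset fun m hm => ⟨hm.1, ?_⟩
  have e : extend ![i, j] (![n i, n j] + m • (Pi.single 0 1 - Pi.single 1 1)) n =
      n + m • (Pi.single i 1 - Pi.single j 1) := by
    funext l
    by_cases hl : ∃ t, ![i, j] t = l
    · obtain ⟨t, rfl⟩ := hl
      rw [hinj.extend_apply]
      fin_cases t <;> simp [hij, hij.symm]
    · rw [extend_apply' _ _ _ hl]
      have h0 : l ≠ i := fun h => hl ⟨0, h.symm⟩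
      have h1 : l ≠ j := fun h => hl ⟨1, h.symm⟩
      simp [h0, h1]
  rw [slice, e]
  exact hm.2

/-- Series with powers of `x_i` bounded below, and for each power of `x_i` powers of `x_j` bounded
above, when the exponents of the other variables are fixed. -/
structure SliceBounded (i j : Fin r) (F : (Fin r → ℤ) → M) : Prop where
  lower : ∀ n : Fin r → ℤ, ∃ J : ℤ, ∀ m : Fin r → ℤ,
    (∀ k, k ≠ i → k ≠ j → m k = n k) → m i < J → F m = 0
  upper : ∀ n : Fin r → ℤ, ∃ N : ℤ, ∀ m : Fin r → ℤ, (∀ k, k ≠ j → m k = n k) → N < m j → F m = 0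

theorem SliceBounded.add {i j : Fin r} {F G : (Fin r → ℤ) → M} (hF : SliceBounded i j F)
    (hG : SliceBounded i j G) : SliceBounded i j (F + G) := by
  refine ⟨fun n => ?_, fun n => ?_⟩
  · obtain ⟨J, hJ⟩ := hF.lower n
    obtain ⟨K, hK⟩ := hG.lower n
    exact ⟨min J K, fun m hm h => by
      rw [Pi.add_apply, hJ m hm (by omega), hK m hm (by omega), add_zero]⟩
  · obtain ⟨J, hJ⟩ := hF.upper n
    obtain ⟨K, hK⟩ := hG.upper n
    exact ⟨max J K, fun m hm h => by
      rw [Pi.add_apply, hJ m hm (by omega), hK m hm (by omega), add_zero]⟩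

theorem SliceBounded.smul {i j : Fin r} {F : (Fin r → ℤ) → M} (c : ℂ) (hF : SliceBounded i j F) :
    SliceBounded i j (c • F) := by
  refine ⟨fun n => ?_, fun n => ?_⟩
  · obtain ⟨J, hJ⟩ := hF.lower n
    exact ⟨J, fun m hm h => by rw [Pi.smul_apply, hJ m hm h, smul_zero]⟩
  · obtain ⟨J, hJ⟩ := hF.upper n
    exact ⟨J, fun m hm h => by rw [Pi.smul_apply, hJ m hm h, smul_zero]⟩

theorem sub_single_apply_le (n : Fin r → ℤ) (k i : Fin r) :
    n i - 1 ≤ (n - Pi.single k 1 : Fin r → ℤ) i ∧ (n - Pi.single k 1 : Fin r → ℤ) i ≤ n i := by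
  by_cases h : i = k
  · subst h; simp
  · simp [h]

theorem SliceBounded.X {i j : Fin r} {F : (Fin r → ℤ) → M} (k : Fin r) (hF : SliceBounded i j F) :
    SliceBounded i j (polyMul (X k) F) := by
  refine ⟨fun n => ?_, fun n => ?_⟩
  · obtain ⟨J, hJ⟩ := hF.lower (n - Pi.single k 1)
    refine ⟨J, fun m hm h => ?_⟩
    rw [polyMul_X]
    refine hJ _ (fun l h1 h2 => ?_) ((sub_single_apply_le m k i).2.trans_lt h)
    rw [Pi.sub_apply, Pi.sub_apply, hm l h1 h2]
  · obtain ⟨J, hJ⟩ := hF.upper (n - Pi.single k 1)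
    refine ⟨J + 1, fun m hm h => ?_⟩
    rw [polyMul_X]
    refine hJ _ (fun l h1 => ?_) ?_
    · rw [Pi.sub_apply, Pi.sub_apply, hm l h1]
    · have := (sub_single_apply_le m k j).1
      omega

theorem SliceBounded.polyMul {i j : Fin r} {F : (Fin r → ℤ) → M} (hF : SliceBounded i j F)
    (p : MvPolynomial (Fin r) ℂ) : SliceBounded i j (polyMul p F) :=
  polyMul_induction p (fun _ _ => SliceBounded.add) (fun c _ => SliceBounded.smul c)
    (fun k _ => SliceBounded.X k) hF

theorem SliceBounded.iterBounded {i j : Fin r} (hij : i ≠ j) {F : (Fin r → ℤ) → W}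
    (hF : SliceBounded i j F) (n : Fin r → ℤ) : IterBounded (slice ![i, j] F n) := by
  have hinj := pair_injective hij
  have h0 : ∀ k, extend ![i, j] k n i = k 0 := fun k => hinj.extend_apply k n 0
  have h1 : ∀ k, extend ![i, j] k n j = k 1 := fun k => hinj.extend_apply k n 1
  have h2 : ∀ k l, l ≠ i → l ≠ j → extend ![i, j] k n l = n l := fun k l hi hj => by
    refine extend_apply' _ _ _ ?_
    rintro ⟨t, rfl⟩
    fin_cases t
    · exact hi rfl
    · exact hj rfl
  refine ⟨?_, fun a => ?_⟩
  · obtain ⟨J, hJ⟩ := hF.lower n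
    exact ⟨J, fun k hk => hJ _ (h2 k) (by rwa [h0])⟩
  · obtain ⟨N, hN⟩ := hF.upper (update n i a)
    refine ⟨N, fun k hk0 hk => hN _ (fun l hl => ?_) (by rwa [h1])⟩
    by_cases hli : l = i
    · subst hli; rw [h0, hk0, update_self]
    · rw [h2 k l hli hl, update_of_ne hli]

/-- Cancellation of a nonzero polynomial in two of the variables. -/
theorem SliceBounded.eq {i j : Fin r} (hij : i ≠ j) {F G : (Fin r → ℤ) → W}
    (hF : SliceBounded i j F) (hG : SliceBounded i j G) {q : MvPolynomial (Fin 2) ℂ} (hq : q ≠ 0)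
    (n : Fin r → ℤ) (h : ∀ k, slice ![i, j] (AtInfinity.polyMul (rename ![i, j] q) F) n k =
      slice ![i, j] (AtInfinity.polyMul (rename ![i, j] q) G) n k) : F n = G n := by
  have hinj := pair_injective hij
  rw [← slice_self hinj F n, ← slice_self hinj G n,
    (hF.iterBounded hij n).eq (hG.iterBounded hij n) hq]
  rw [← slice_polyMul hinj, ← slice_polyMul hinj]
  exact funext h

end Slices

theorem extend01 (k : Fin 2 → ℤ) (n : Fin 3 → ℤ) :
    extend ![(0 : Fin 3), 1] k n = ![k 0, k 1, n 2] := by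
  have hinj : Injective ![(0 : Fin 3), 1] := pair_injective (by decide)
  funext l
  fin_cases l
  · exact hinj.extend_apply k n 0
  · exact hinj.extend_apply k n 1
  · exact extend_apply' _ _ _ (by decide)

theorem extend02 (k : Fin 2 → ℤ) (n : Fin 3 → ℤ) :
    extend ![(0 : Fin 3), 2] k n = ![k 0, n 1, k 1] := by
  have hinj : Injective ![(0 : Fin 3), 2] := pair_injective (by decide)
  funext l
  fin_cases l
  · exact hinj.extend_apply k n 0
  · exact extend_apply' _ _ _ (by decide)
  · exact hinj.extend_apply k n 1

theorem extend12 (k : Fin 2 → ℤ) (n : Fin 3 → ℤ) :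
    extend ![(1 : Fin 3), 2] k n = ![n 0, k 0, k 1] := by
  have hinj : Injective ![(1 : Fin 3), 2] := pair_injective (by decide)
  funext l
  fin_cases l
  · exact extend_apply' _ _ _ (by decide)
  · exact hinj.extend_apply k n 0
  · exact hinj.extend_apply k n 1

theorem extend10 (k n : Fin 2 → ℤ) : extend ![(1 : Fin 2), 0] k n = ![k 1, k 0] := by
  have hinj : Injective ![(1 : Fin 2), 0] := pair_injective (by decide)
  funext l
  fin_cases l
  · exact hinj.extend_apply k n 1
  · exact hinj.extend_apply k n 0

theorem inj01 : Injective ![(0 : Fin 3), 1] := pair_injective (by decide)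
theorem inj02 : Injective ![(0 : Fin 3), 2] := pair_injective (by decide)
theorem inj12 : Injective ![(1 : Fin 3), 2] := pair_injective (by decide)

/-! ### Local pairs and Dong's lemma -/

/-- `Γ`-locality of a pair. -/
def LocalPair (Γ : Subgroup LinTransf) (a b : EInf W) : Prop :=
  ∃ l : List LinTransf, (∀ g ∈ l, g ∈ Γ) ∧ polyMul (l.map linFactor).prod (commSeries a b) = 0

variable {Γ : Subgroup LinTransf}

theorem commSeries_add (a a' b : EInf W) :
    commSeries (a + a') b = commSeries a b + commSeries a' b := by
  funext n
  simp only [commSeries, cf_add, Pi.add_apply]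
  noncomm_ring

theorem commSeries_smul (c : ℂ) (a b : EInf W) : commSeries (c • a) b = c • commSeries a b := by
  funext n
  simp only [commSeries, cf_smul, Pi.smul_apply, smul_sub, smul_mul_assoc, mul_smul_comm]

theorem localPair_zero (b : EInf W) : LocalPair Γ 0 b :=
  ⟨[], by simp, by funext n; simp [commSeries]⟩

theorem localPair_oneW (b : EInf W) : LocalPair Γ oneW b :=
  ⟨[], by simp, by
    funext n
    simp only [commSeries, cf_oneW, List.map_nil, List.prod_nil, polyMul_one]
    split_ifs <;> simp⟩

theorem LocalPair.add {a a' b : EInf W} (h : LocalPair Γ a b) (h' : LocalPair Γ a' b) :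
    LocalPair Γ (a + a') b := by
  obtain ⟨l, hl, e⟩ := h
  obtain ⟨l', hl', e'⟩ := h'
  refine ⟨l ++ l', fun g hg => (List.mem_append.1 hg).elim (hl g) (hl' g), ?_⟩
  rw [commSeries_add, polyMul_add, List.map_append, List.prod_append, polyMul_mul, polyMul_mul, e',
    polyMul_comm, e]
  simp

theorem LocalPair.smul {a b : EInf W} (c : ℂ) (h : LocalPair Γ a b) : LocalPair Γ (c • a) b := by
  obtain ⟨l, hl, e⟩ := h
  exact ⟨l, hl, by rw [commSeries_smul, polyMul_smul, e, smul_zero]⟩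

/-- The equations `x₁ = g⁻¹(x₂)` and `x₂ = g(x₁)` are equivalent, so their linear forms differ by a
constant, here `-1/g₀`. This makes Γ-locality symmetric, because Γ contains inverses. -/
theorem linFactor_inv (g : LinTransf) :
    linFactor g⁻¹ = C (-((g.c₀⁻¹ : ℂˣ) : ℂ)) * rename ![(1 : Fin 2), 0] (linFactor g) := by
  have h : (C ((g.c₀⁻¹ : ℂˣ) : ℂ) * C (g.c₀ : ℂ) : MvPolynomial (Fin 2) ℂ) = 1 := by
    rw [← C_mul, ← Units.val_mul, inv_mul_cancel, Units.val_one, C_1]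
  simp only [linFactor, LinTransf.inv_def, map_sub, map_add, map_mul, rename_X, rename_C,
    C_neg, Matrix.cons_val_zero, Matrix.cons_val_one]
  linear_combination (-(X 0) : MvPolynomial (Fin 2) ℂ) * h

theorem LocalPair.symm {a b : EInf W} (h : LocalPair Γ a b) : LocalPair Γ b a := by
  obtain ⟨l, hl, e⟩ := h
  refine ⟨l.map (·⁻¹), fun g hg => ?_, ?_⟩
  · obtain ⟨g', hg', rfl⟩ := List.mem_map.1 hg
    exact Γ.inv_mem (hl g' hg')
  · have key : ∀ l : List LinTransf, ∃ c : ℂ, ((l.map (·⁻¹)).map linFactor).prod =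
        C c * rename ![(1 : Fin 2), 0] (l.map linFactor).prod := by
      intro l
      induction l with
      | nil => exact ⟨1, by simp⟩
      | cons g l ih =>
        obtain ⟨c, hc⟩ := ih
        refine ⟨-((g.c₀⁻¹ : ℂˣ) : ℂ) * c, ?_⟩
        rw [List.map_cons, List.map_cons, List.prod_cons, hc, linFactor_inv, List.map_cons,
          List.prod_cons, map_mul (rename _), map_mul C]
        ring
    obtain ⟨c, hc⟩ := key l
    rw [hc, polyMul_mul, polyMul_C]
    funext n
    have hs : slice ![(1 : Fin 2), 0] (commSeries b a) n = (-1 : ℂ) • commSeries a b := by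
      funext k
      simp only [slice, extend10, commSeries, Pi.smul_apply]
      simp
    rw [Pi.smul_apply, polyMul_rename (pair_injective (by decide)), hs, polyMul_smul, e]
    simp

/-- The coefficientwise form of a vanishing operator product. -/
theorem polyMul_apply_eq_zero {r : ℕ} {q : MvPolynomial (Fin r) ℂ}
    {F : (Fin r → ℤ) → Module.End ℂ W} (h : polyMul q F = 0) (w : W) :
    polyMul q (fun n => F n w) = 0 := by
  funext n
  rw [← polyMul_apply, h]; rfl

theorem shiftPolyVar_rename_of_ne {r t : ℕ} {i j : Fin r} {e : Fin t → Fin r} (he : ∀ k, e k ≠ i)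
    (q : MvPolynomial (Fin t) ℂ) : shiftPolyVar i j (rename e q) = rename e q := by
  have : (shiftPolyVar i j).comp (rename e) = rename e := by
    ext k
    simp [shiftPolyVar, he k]
  exact DFunLike.congr_fun this q

/-- At `x₀ = 0` the polynomial `q(x₀ + x₁, x₂)` becomes `q(x₁, x₂)`. The difference is thus
divisible by `x₀`. -/
theorem shiftPolyVar_rename02 (q : MvPolynomial (Fin 2) ℂ) :
    ∃ R, shiftPolyVar (0 : Fin 3) 1 (rename ![0, 2] q) = rename ![1, 2] q + X 0 * R := by
  induction q using MvPolynomial.induction_on with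
  | C c => exact ⟨0, by simp [shiftPolyVar]⟩
  | add p q hp hq =>
    obtain ⟨R, hR⟩ := hp
    obtain ⟨R', hR'⟩ := hq
    exact ⟨R + R', by rw [map_add, map_add, map_add, hR, hR']; ring⟩
  | mul_X p i hp =>
    obtain ⟨R, hR⟩ := hp
    fin_cases i
    · refine ⟨rename ![1, 2] p + R * (X 0 + X 1), ?_⟩
      rw [map_mul, map_mul, map_mul, hR]
      simp [shiftPolyVar]
      ring
    · refine ⟨R * X 2, ?_⟩
      rw [map_mul, map_mul, map_mul, hR]
      simp [shiftPolyVar]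
      ring

theorem polyMul_opProd_pair (a b : EInf W) (p : MvPolynomial (Fin 2) ℂ) (n : Fin 2 → ℤ) (w : W) :
    polyMul p (opProd ![a, b]) n w = polyMul p (fun k => cf a (k 0) (cf b (k 1) w)) n := by
  rw [polyMul_apply]
  congr 1

/-- If `(q₀ + x₀ R) f = 0` and `f` has powers of `x₀` bounded below, then some power of `q₀`
annihilates each coefficient of `f` in `x₀`. -/
theorem polyMul_pow_eq_zero {r : ℕ} {M : Type*} [AddCommGroup M] [Module ℂ M] (i : Fin r)
    {q R : MvPolynomial (Fin r) ℂ} {f : (Fin r → ℤ) → M} {J : ℤ} (hJ : ∀ n, n i < J → f n = 0)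
    (h : polyMul (q + X i * R) f = 0) (m : ℕ) (n : Fin r → ℤ) (hn : n i < J + m) :
    polyMul (q ^ m) f n = 0 := by
  induction m generalizing n with
  | zero => rw [pow_zero, polyMul_one]; exact hJ n (by simpa using hn)
  | succ m ih =>
    have e : polyMul q f = -polyMul (X i * R) f := by
      rw [polyMul_add_left] at h
      exact eq_neg_of_add_eq_zero_left h
    have e2 : polyMul (q ^ (m + 1)) f = -polyMul (X i) (polyMul R (polyMul (q ^ m) f)) := by
      rw [pow_succ, polyMul_mul, e, ← zero_sub, polyMul_sub, polyMul_zero, zero_sub,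
        polyMul_comm, polyMul_mul]
    rw [e2, Pi.neg_apply, polyMul_X, neg_eq_zero]
    rw [polyMul_congr (G := 0), polyMul_zero, Pi.zero_apply]
    intro k hk
    refine ih k ?_
    have := hk i
    simp only [Pi.sub_apply, Pi.single_eq_same] at this
    push_cast at hn
    omega

/-- Dong's lemma: `Γ`-locality is inherited by the products `a(x)_n b(x)`. -/
theorem LocalPair.YCoeff {a b c : EInf W} (hac : LocalPair Γ a c) (hbc : LocalPair Γ b c) (j : ℤ) :
    LocalPair Γ (YCoeff a b j) c := by
  by_cases hab : QCPair a b
  swap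
  -- For a pair that is not quasi-compatible the products take the default value zero.
  · rw [YCoeff_of_not_qcPair hab]; exact localPair_zero c
  obtain ⟨p, hp, hT⟩ := id hab
  obtain ⟨l, hl, hq⟩ := hac
  obtain ⟨l', hl', hs⟩ := hbc
  obtain ⟨J, hJ⟩ := YCoeff_lower a b
  set q := (l.map linFactor).prod with hqdef
  set s := (l'.map linFactor).prod with hsdef
  obtain ⟨R, hR⟩ := shiftPolyVar_rename02 q
  -- The left factor is `q(x₀ + x₁, x₂) s(x₁, x₂)` written as `q s` plus a multiple of `x₀`: it is
  -- what becomes of the polynomial that kills `[a b, c]` after the substitution defining `Y`.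
  have main : ∀ w : W, polyMul (rename ![1, 2] (q * s) + X 0 * (R * rename ![1, 2] s))
      (fun n : Fin 3 → ℤ => commSeries (AtInfinity.YCoeff a b (n 0)) c ![n 1, n 2] w) = 0 := by
    intro w
    let A₀ : (Fin 3 → ℤ) → W := fun n => cf a (n 0) (cf b (n 1) (cf c (n 2) w))
    let B₀ : (Fin 3 → ℤ) → W := fun n => cf c (n 2) (cf a (n 0) (cf b (n 1) w))
    let A : (Fin 3 → ℤ) → W := fun n =>
      polyMul p (opProd ![a, b]) ![n 0, n 1] (cf c (n 2) w)
    let B : (Fin 3 → ℤ) → W := fun n =>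
      cf c (n 2) (polyMul p (opProd ![a, b]) ![n 0, n 1] w)
    have comp01 : ∀ n : Fin 3 → ℤ, n ∘ ![0, 1] = ![n 0, n 1] := fun n => by
      funext i; fin_cases i <;> rfl
    have hA : A = polyMul (rename ![0, 1] p) A₀ := by
      funext n
      rw [polyMul_rename inj01, comp01]
      simp only [A, polyMul_opProd_pair]
      congr 1
      funext k
      simp [slice, extend01, A₀]
    have hB : B = polyMul (rename ![0, 1] p) B₀ := by
      funext n
      rw [polyMul_rename inj01, comp01]
      simp only [B, polyMul_opProd_pair, map_polyMul]
      congr 1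
      funext k
      simp [slice, extend01, B₀]
    have hAB₀ : polyMul (rename ![0, 2] q * rename ![1, 2] s) (A₀ - B₀) = 0 := by
      -- The derivation rule `[a b, c] = a [b, c] + [a, c] b`.
      have e : A₀ - B₀ = (fun n : Fin 3 → ℤ => cf a (n 0) (commSeries b c ![n 1, n 2] w)) +
          fun n : Fin 3 → ℤ => commSeries a c ![n 0, n 2] (cf b (n 1) w) := by
        funext n
        simp [A₀, B₀, commSeries]
      have e1 : polyMul (rename ![1, 2] s)
          (fun n : Fin 3 → ℤ => cf a (n 0) (commSeries b c ![n 1, n 2] w)) = 0 := by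
        funext n
        rw [polyMul_rename inj12]
        have : slice ![1, 2] (fun n : Fin 3 → ℤ => cf a (n 0) (commSeries b c ![n 1, n 2] w)) n =
            fun k => cf a (n 0) (commSeries b c k w) := by
          funext k
          simp only [slice, extend12]
          simp [commSeries]
        rw [this, ← map_polyMul (cf a (n 0)), polyMul_apply_eq_zero hs]
        simp
      have e2 : polyMul (rename ![0, 2] q)
          (fun n : Fin 3 → ℤ => commSeries a c ![n 0, n 2] (cf b (n 1) w)) = 0 := by
        funext n
        rw [polyMul_rename inj02]
        have : slice ![0, 2] (fun n : Fin 3 → ℤ => commSeries a c ![n 0, n 2] (cf b (n 1) w)) n =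
            fun k => commSeries a c k (cf b (n 1) w) := by
          funext k
          simp only [slice, extend02]
          simp [commSeries]
        rw [this, polyMul_apply_eq_zero hq]
        simp
      rw [e, polyMul_add, polyMul_mul, polyMul_mul, e1, polyMul_comm, e2]
      simp
    have hAB : polyMul (rename ![0, 2] q * rename ![1, 2] s) (A - B) = 0 := by
      rw [hA, hB, ← polyMul_sub, polyMul_comm, hAB₀, polyMul_zero]
    have sA : ∀ n, slice ![0, 1] A n = fun k => polyMul p (opProd ![a, b]) k (cf c (n 2) w) := by
      intro n
      funext k
      simp only [slice, extend01, A]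
      congr 2
      funext i; fin_cases i <;> rfl
    have sB : ∀ n, slice ![0, 1] B n = fun k => cf c (n 2) (polyMul p (opProd ![a, b]) k w) := by
      intro n
      funext k
      simp only [slice, extend01, B]
      congr 3
    have dA : ShiftInfDom 0 1 A := shiftInfDom_of_slice (by decide) fun n => by
      rw [sA]; exact hT.shiftInfDom _
    have dB : ShiftInfDom 0 1 B := shiftInfDom_of_slice (by decide) fun n => by
      rw [sB]; exact KerDom.map (cf c (n 2)) (hT.shiftInfDom _)
    let A' : (Fin 3 → ℤ) → W := fun n => cf (AtInfinity.YCoeff a b (n 0)) (n 1) (cf c (n 2) w)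
    let B' : (Fin 3 → ℤ) → W := fun n => cf c (n 2) (cf (AtInfinity.YCoeff a b (n 0)) (n 1) w)
    have hA' : shiftInf 0 1 A = polyMul (rename ![0, 1] (shiftPolyVar 0 1 p)) A' := by
      funext n
      rw [polyMul_rename inj01, ← slice_self inj01 (shiftInf 0 1 A), slice_shiftInf (by decide),
        sA, ← Yser_spec hab hT]
      congr 1
      funext k
      simp [slice, extend01, A', Yser]
    have hB' : shiftInf 0 1 B = polyMul (rename ![0, 1] (shiftPolyVar 0 1 p)) B' := by
      funext n
      rw [polyMul_rename inj01, ← slice_self inj01 (shiftInf 0 1 B), slice_shiftInf (by decide),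
        sB]
      have h1 := kerSubst_map (i := (0 : Fin 2)) (cf c (n 2)) (hT.shiftInfDom w) (n ∘ ![0, 1])
      change shiftInf 0 1 _ _ = cf c (n 2) (shiftInf 0 1 _ _) at h1
      rw [h1, ← Yser_spec hab hT, map_polyMul]
      congr 1
      funext k
      simp [slice, extend01, B', Yser]
    -- With the exponent of `c` fixed, only the two vectors `c_n w` and `w` occur, so the series is
    -- bounded enough to cancel `p(x₀ + x₁, x₁)`.
    have bd : SliceBounded 0 1 (A' - B') := by
      have hlow : ∀ m : Fin 3 → ℤ, m 0 < J → (A' - B') m = 0 := fun m h => by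
        simp [A', B', hJ _ h]
      refine ⟨fun n => ⟨J, fun m _ h => hlow m h⟩, fun n => ?_⟩
      obtain ⟨N, hN⟩ := cf_bound (AtInfinity.YCoeff a b (n 0)) (cf c (n 2) w)
      obtain ⟨N', hN'⟩ := cf_bound (AtInfinity.YCoeff a b (n 0)) w
      refine ⟨max N N', fun m hm h => ?_⟩
      simp only [A', B', Pi.sub_apply]
      rw [hm 0 (by decide), hm 2 (by decide), hN _ (by omega), hN' _ (by omega)]
      simp
    have hfin : polyMul (shiftPolyVar 0 1 (rename ![0, 2] q * rename ![1, 2] s)) (A' - B') = 0 := by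
      funext n
      refine (bd.polyMul _).eq (G := 0) (by decide) ⟨fun _ => ⟨0, fun _ _ _ => rfl⟩,
        fun _ => ⟨0, fun _ _ _ => rfl⟩⟩
        (shiftPolyVar_ne_zero (i := (0 : Fin 2)) (j := 1) (by decide) hp) n fun k => ?_
      rw [polyMul_comm, polyMul_sub, ← hA', ← hB']
      change slice _ (polyMul _ (kerSubst _ _ _ A - kerSubst _ _ _ B)) n k = _
      rw [← kerSubst_sub dA dB]
      change slice _ (polyMul _ (shiftInf 0 1 (A - B))) n k = _
      have dAB : ShiftInfDom 0 1 (A - B) := by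
        have : A - B = A + (-1 : ℂ) • B := by simp [sub_eq_add_neg]
        rw [this]; exact dA.add (dB.smul _)
      rw [← shiftInf_polyMul (by decide) _ dAB, hAB, polyMul_zero]
      simp [slice, shiftInf_apply]
    have hpoly : shiftPolyVar 0 1 (rename ![0, 2] q * rename ![1, 2] s) =
        rename ![1, 2] (q * s) + X 0 * (R * rename ![1, 2] s) := by
      rw [map_mul, shiftPolyVar_rename_of_ne (e := ![1, 2]) (by decide), hR, map_mul]
      ring
    rw [hpoly] at hfin
    exact hfin
  -- Powers of `x₀` start at `J`, and each further factor `q s` kills one more coefficient in `x₀`.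
  -- The exponent `j + 1 - J` is the number of factors needed to reach `x₀^j`.
  refine ⟨(List.replicate ((j + 1 - J).toNat) (l ++ l')).flatten, fun g hg => ?_, ?_⟩
  · obtain ⟨t, ht, hgt⟩ := List.mem_flatten.1 hg
    rw [List.eq_of_mem_replicate ht] at hgt
    exact (List.mem_append.1 hgt).elim (hl g) (hl' g)
  · have e : (((List.replicate ((j + 1 - J).toNat) (l ++ l')).flatten).map linFactor).prod =
        (q * s) ^ (j + 1 - J).toNat := by
      rw [List.map_flatten, List.prod_flatten]
      simp [hqdef, hsdef]
    rw [e]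
    funext k
    refine LinearMap.ext fun w => ?_
    rw [polyMul_apply]
    have := polyMul_pow_eq_zero 0 (J := J) (fun n hn => ?_) (main w) (j + 1 - J).toNat
      ![j, k 0, k 1] (by simp; omega)
    · rw [← map_pow, polyMul_rename inj12] at this
      have e2 : ![j, k 0, k 1] ∘ ![1, 2] = k := by funext i; fin_cases i <;> rfl
      rw [e2] at this
      refine Eq.trans (congrFun (congrArg _ (_root_.funext fun k => ?_)) _) this
      simp [slice, extend12, commSeries]
    · simp [hJ _ hn, commSeries]

theorem LocalPair.nProd {a b c : EInf W} (hac : LocalPair Γ a c) (hbc : LocalPair Γ b c) (n : ℤ) :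
    LocalPair Γ (nProd a b n) c := hac.YCoeff hbc _

variable (Γ) in
/-- The series that are `Γ`-local with all elements of `S`. -/
def localWith (S : Set (EInf W)) : Submodule ℂ (EInf W) where
  carrier := {a | ∀ c ∈ S, LocalPair Γ a c}
  add_mem' ha hb c hc := (ha c hc).add (hb c hc)
  zero_mem' c _ := localPair_zero c
  smul_mem' t _ ha c hc := (ha c hc).smul t

end Locality

/-! ### Locality implies quasi-compatibility -/

section Compat

variable {W : Type*} [AddCommGroup W] [Module ℂ W]

open MvPolynomial Function

/-- Powers of `x_i` are bounded above. -/
def UpperBounded {r : ℕ} {M : Type*} [AddCommGroup M] (i : Fin r) (F : (Fin r → ℤ) → M) : Prop :=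
  ∃ N : ℤ, ∀ n, N < n i → F n = 0

theorem UpperBounded.polyMul {r : ℕ} {M : Type*} [AddCommGroup M] [Module ℂ M] {i : Fin r}
    {F : (Fin r → ℤ) → M} (hF : UpperBounded i F) (p : MvPolynomial (Fin r) ℂ) :
    UpperBounded i (polyMul p F) := by
  refine polyMul_induction p (fun F G hF hG => ?_) (fun c F hF => ?_) (fun k F hF => ?_) hF
  · obtain ⟨N, hN⟩ := hF
    obtain ⟨N', hN'⟩ := hG
    exact ⟨max N N', fun n hn => by
      rw [Pi.add_apply, hN n (by omega), hN' n (by omega), add_zero]⟩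
  · obtain ⟨N, hN⟩ := hF
    exact ⟨N, fun n hn => by rw [Pi.smul_apply, hN n hn, smul_zero]⟩
  · obtain ⟨N, hN⟩ := hF
    refine ⟨N + 1, fun n hn => ?_⟩
    rw [polyMul_X]
    have := (sub_single_apply_le n k i).1
    exact hN _ (by omega)

/-- There are finitely many variables, so separate bounds combine into one. This lets each variable
be treated with its own rearrangement of the operators. -/
theorem isTruncated_iff {r : ℕ} {T : (Fin r → ℤ) → Module.End ℂ W} :
    IsTruncated T ↔ ∀ (w : W) (i : Fin r), UpperBounded i fun n => T n w := by
  constructor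
  · intro h w i
    obtain ⟨N, hN⟩ := h w
    exact ⟨N, fun n hn => hN n ⟨i, hn⟩⟩
  · intro h w
    choose N hN using h w
    obtain ⟨B, hB⟩ := (Set.finite_range N).bddAbove
    exact ⟨B, fun n ⟨i, hi⟩ => hN i n ((hB ⟨i, rfl⟩).trans_lt hi)⟩

theorem opProd_succ {r : ℕ} (a : Fin (r + 1) → EInf W) (n : Fin (r + 1) → ℤ) :
    opProd a n = cf (a 0) (n 0) * opProd (Fin.tail a) (Fin.tail n) := by
  simp only [opProd, List.ofFn_succ, List.prod_cons]
  rfl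

theorem rename_pair {s t : ℕ} (e : Fin s → Fin t) (i j : Fin s) (p : MvPolynomial (Fin 2) ℂ) :
    rename e (rename ![i, j] p) = rename ![e i, e j] p := by
  rw [rename_rename]
  congr 1
  congr 1
  funext k
  fin_cases k <;> rfl

/-- Each factor `p j` pays for one transposition, and `a` passes through the `b j` one at a time. -/
theorem polyMul_prod_comm {s : ℕ} (a : EInf W) (b : Fin s → EInf W)
    (p : Fin s → MvPolynomial (Fin 2) ℂ) (h : ∀ j, polyMul (p j) (commSeries a (b j)) = 0) :
    polyMul (∏ j, rename ![0, j.succ] (p j))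
      (fun n : Fin (s + 1) → ℤ => cf a (n 0) * opProd b (Fin.tail n)) =
    polyMul (∏ j, rename ![0, j.succ] (p j))
      (fun n : Fin (s + 1) → ℤ => opProd b (Fin.tail n) * cf a (n 0)) := by
  induction s with
  | zero => simp [opProd]
  | succ s ih =>
    rw [Fin.prod_univ_succ]
    have h1 : polyMul (rename ![0, (0 : Fin (s + 1)).succ] (p 0))
        (fun n : Fin (s + 2) → ℤ => cf a (n 0) * opProd b (Fin.tail n)) =
        polyMul (rename ![0, (0 : Fin (s + 1)).succ] (p 0))
        (fun n : Fin (s + 2) → ℤ =>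
          cf (b 0) (n 1) * (cf a (n 0) * opProd (Fin.tail b) (Fin.tail (Fin.tail n)))) := by
      have hinj : Injective ![0, (0 : Fin (s + 1)).succ] :=
        pair_injective (Fin.succ_ne_zero 0).symm
      rw [← sub_eq_zero, ← polyMul_sub]
      funext n
      rw [polyMul_rename hinj]
      have : slice ![0, (0 : Fin (s + 1)).succ]
          ((fun n : Fin (s + 2) → ℤ => cf a (n 0) * opProd b (Fin.tail n)) -
            fun n : Fin (s + 2) → ℤ =>
              cf (b 0) (n 1) * (cf a (n 0) * opProd (Fin.tail b) (Fin.tail (Fin.tail n)))) n =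
          fun k => LinearMap.mulRight ℂ (opProd (Fin.tail b) (Fin.tail (Fin.tail n)))
            (commSeries a (b 0) k) := by
        funext k
        have e0 : extend ![0, (0 : Fin (s + 1)).succ] k n 0 = k 0 := hinj.extend_apply k n 0
        have e1 : extend ![0, (0 : Fin (s + 1)).succ] k n 1 = k 1 := hinj.extend_apply k n 1
        have e2 : Fin.tail (Fin.tail (extend ![0, (0 : Fin (s + 1)).succ] k n)) =
            Fin.tail (Fin.tail n) := by
          funext l
          refine extend_apply' _ _ _ ?_
          rintro ⟨t, ht⟩
          fin_cases t <;> simp [Fin.ext_iff] at ht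
        simp only [slice, Pi.sub_apply, opProd_succ b, e0, e2]
        change cf a (k 0) * (cf (b 0) (extend ![0, (0 : Fin (s + 1)).succ] k n 1) * _) - _ = _
        rw [e1]
        simp only [commSeries, LinearMap.mulRight_apply, sub_mul, mul_assoc]
      rw [this, ← map_polyMul, h 0]
      simp
    have h2 : polyMul (∏ j : Fin s, rename ![0, j.succ.succ] (p j.succ))
        (fun n : Fin (s + 2) → ℤ =>
          cf (b 0) (n 1) * (cf a (n 0) * opProd (Fin.tail b) (Fin.tail (Fin.tail n)))) =
        polyMul (∏ j : Fin s, rename ![0, j.succ.succ] (p j.succ))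
        (fun n : Fin (s + 2) → ℤ =>
          cf (b 0) (n 1) * (opProd (Fin.tail b) (Fin.tail (Fin.tail n)) * cf a (n 0))) := by
      -- The map `e` skips the variable of `b 0`: once `a` has passed it, `b 0` is a fixed operator
      -- on the left and induction applies to the rest.
      let e : Fin (s + 1) → Fin (s + 2) := Fin.succAbove 1
      have hinj : Injective e := Fin.succAbove_right_injective
      have e0 : e 0 = 0 := rfl
      have es : ∀ j : Fin s, e j.succ = j.succ.succ := fun j => by
        simp [e]
      have he : ∏ j : Fin s, rename ![0, j.succ.succ] (p j.succ) =
          rename e (∏ j : Fin s, rename ![0, j.succ] (p j.succ)) := by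
        rw [map_prod]
        refine Finset.prod_congr rfl fun j _ => ?_
        rw [rename_pair, e0, es]
      have hs : ∀ G : ((Fin (s + 1) → ℤ) → Module.End ℂ W),
          ∀ n : Fin (s + 2) → ℤ, polyMul (∏ j : Fin s, rename ![0, j.succ.succ] (p j.succ))
            (fun n : Fin (s + 2) → ℤ => cf (b 0) (n 1) * G (n ∘ e)) n =
          cf (b 0) (n 1) * polyMul (∏ j : Fin s, rename ![0, j.succ] (p j.succ)) G (n ∘ e) := by
        intro G n
        rw [he, polyMul_rename hinj]
        have : slice e (fun n : Fin (s + 2) → ℤ => cf (b 0) (n 1) * G (n ∘ e)) n =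
            fun k => LinearMap.mulLeft ℂ (cf (b 0) (n 1)) (G k) := by
          funext k
          have e1 : extend e k n 1 = n 1 :=
            extend_apply' _ _ _ (by rintro ⟨t, ht⟩; exact Fin.succAbove_ne 1 t ht)
          have e2 : extend e k n ∘ e = k := funext fun t => hinj.extend_apply k n t
          simp only [slice, e1, e2, LinearMap.mulLeft_apply]
        rw [this, ← map_polyMul, LinearMap.mulLeft_apply]
      have hc : ∀ n : Fin (s + 2) → ℤ, Fin.tail (Fin.tail n) = Fin.tail (n ∘ e) := fun n => by
        funext j
        simp only [Fin.tail, comp_apply, es]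
      funext n
      have i1 := hs (fun k => cf a (k 0) * opProd (Fin.tail b) (Fin.tail k)) n
      have i2 := hs (fun k => opProd (Fin.tail b) (Fin.tail k) * cf a (k 0)) n
      simp only [← hc] at i1 i2
      refine i1.trans (Eq.trans ?_ i2.symm)
      rw [ih (Fin.tail b) (fun j => p j.succ) fun j => h j.succ]
    rw [polyMul_mul, polyMul_comm, h1, polyMul_comm, h2, polyMul_mul]
    congr 2
    funext n
    rw [opProd_succ, mul_assoc]
    rfl

theorem prod_pairs_succ {r : ℕ} {R : Type*} [CommMonoid R] (f : Fin (r + 1) → Fin (r + 1) → R) :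
    (∏ ij : Fin (r + 1) × Fin (r + 1) with ij.1 < ij.2, f ij.1 ij.2) =
      (∏ j : Fin r, f 0 j.succ) * ∏ ij : Fin r × Fin r with ij.1 < ij.2, f ij.1.succ ij.2.succ := by
  simp only [Finset.prod_filter, Fintype.prod_prod_type, Fin.prod_univ_succ]
  simp

/-- Induction on the number of operators. The exponents of the later variables are bounded because
`a 0` only acts on the left of a product already treated. Those of the first variable are bounded
because `a 0` can be moved to the right, where it meets the fixed vector `w`. -/
theorem isTruncated_of_comm {r : ℕ} (a : Fin r → EInf W)
    (p : Fin r → Fin r → MvPolynomial (Fin 2) ℂ)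
    (h : ∀ i j, i < j → polyMul (p i j) (commSeries (a i) (a j)) = 0) :
    IsTruncated (polyMul (∏ ij : Fin r × Fin r with ij.1 < ij.2,
      rename ![ij.1, ij.2] (p ij.1 ij.2)) (opProd a)) := by
  induction r with
  | zero => exact fun w => ⟨0, fun n ⟨i, _⟩ => i.elim0⟩
  | succ r ih =>
    rw [prod_pairs_succ fun i j => rename ![i, j] (p i j)]
    have hQ : (∏ ij : Fin r × Fin r with ij.1 < ij.2,
        rename ![ij.1.succ, ij.2.succ] (p ij.1.succ ij.2.succ)) =
        rename Fin.succ (∏ ij : Fin r × Fin r with ij.1 < ij.2,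
          rename ![ij.1, ij.2] (p ij.1.succ ij.2.succ)) := by
      rw [map_prod]
      exact Finset.prod_congr rfl fun ij _ => (rename_pair _ _ _ _).symm
    rw [hQ]
    have ih' := ih (Fin.tail a) (fun i j => p i.succ j.succ)
      fun i j hij => h _ _ (Fin.succ_lt_succ_iff.2 hij)
    set Q := ∏ ij : Fin r × Fin r with ij.1 < ij.2, rename ![ij.1, ij.2] (p ij.1.succ ij.2.succ)
    rw [isTruncated_iff] at ih' ⊢
    have ha : opProd a = fun n => cf (a 0) (n 0) * opProd (Fin.tail a) (Fin.tail n) :=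
      funext fun n => opProd_succ a n
    intro w i
    refine Fin.cases ?_ (fun i => ?_) i
    -- Move `a 0` to the far right, so that a single bound for `a 0` on `w` suffices.
    · rw [polyMul_mul, polyMul_comm, ha,
        polyMul_prod_comm (a 0) (Fin.tail a) (fun j => p 0 j.succ) fun j => h _ _ (Fin.succ_pos j)]
      simp only [polyMul_apply]
      obtain ⟨N, hN⟩ := cf_bound (a 0) w
      have hb : UpperBounded (0 : Fin (r + 1)) fun n : Fin (r + 1) → ℤ =>
          (opProd (Fin.tail a) (Fin.tail n) * cf (a 0) (n 0)) w :=
        ⟨N, fun n hn => by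
          change (_ * _ : Module.End ℂ W) w = 0
          rw [Module.End.mul_apply, hN _ hn, map_zero]⟩
      exact (hb.polyMul _).polyMul _
    -- The bound for the remaining operators survives the application of any coefficient of `a 0`.
    · obtain ⟨N, hN⟩ := ih' w i
      have hb : UpperBounded i.succ fun n : Fin (r + 1) → ℤ =>
          polyMul (rename Fin.succ Q) (opProd a) n w := by
        refine ⟨N, fun n hn => ?_⟩
        have hinj : Injective (Fin.succ : Fin r → Fin (r + 1)) := Fin.succ_injective r
        change (polyMul _ _ n : Module.End ℂ W) w = 0
        rw [polyMul_rename hinj]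
        have hs : slice Fin.succ (opProd a) n =
            fun k => LinearMap.mulLeft ℂ (cf (a 0) (n 0)) (opProd (Fin.tail a) k) := by
          funext k
          have e0 : extend Fin.succ k n 0 = n 0 :=
            extend_apply' _ _ _ (by rintro ⟨t, ht⟩; exact Fin.succ_ne_zero t ht)
          have e1 : Fin.tail (extend Fin.succ k n) = k :=
            funext fun t => hinj.extend_apply k n t
          rw [slice, opProd_succ, e0, e1, LinearMap.mulLeft_apply]
        rw [hs, ← map_polyMul, LinearMap.mulLeft_apply, Module.End.mul_apply]
        exact (congrArg (cf (a 0) (n 0)) (hN (n ∘ Fin.succ) hn)).trans (map_zero _)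
      have := hb.polyMul (∏ j : Fin r, rename ![0, j.succ] (p 0 j.succ))
      convert this using 2 with n
      rw [polyMul_mul, polyMul_apply]

theorem isTruncated_pair_of_comm {a b : EInf W} {p : MvPolynomial (Fin 2) ℂ}
    (h : polyMul p (commSeries a b) = 0) : IsTruncated (polyMul p (opProd ![a, b])) := by
  have := isTruncated_of_comm ![a, b] (fun _ _ => p) (by
    intro i j hij
    fin_cases i <;> fin_cases j <;> first | exact h | exact absurd hij (by decide))
  convert this using 2
  have : (![(0 : Fin 2), 1] : Fin 2 → Fin 2) = id := by
    funext k; fin_cases k <;> rfl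
  simp [Finset.prod_filter, Fintype.prod_prod_type, Fin.prod_univ_two, this]

theorem isTruncated_triple_of_comm {a b c : EInf W} {p q s : MvPolynomial (Fin 2) ℂ}
    (hab : polyMul p (commSeries a b) = 0) (hac : polyMul q (commSeries a c) = 0)
    (hbc : polyMul s (commSeries b c) = 0) :
    IsTruncated (polyMul (rename ![0, 1] p * rename ![0, 2] q * rename ![1, 2] s)
      (opProd ![a, b, c])) := by
  have := isTruncated_of_comm ![a, b, c] (fun i j => if i = 0 then (if j = 1 then p else q) else s)
    (by
      intro i j hij
      fin_cases i <;> fin_cases j <;>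
        first | exact hab | exact hac | exact hbc | exact absurd hij (by decide))
  convert this using 2
  simp [Finset.prod_filter, Fintype.prod_prod_type, Fin.prod_univ_three]

theorem linFactor_ne_zero (g : LinTransf) : linFactor g ≠ 0 := by
  intro h
  have := congrArg (aeval ![(1 + g.c₁ : ℂ), 0]) h
  simp [linFactor] at this

theorem prod_linFactor_ne_zero (l : List LinTransf) : (l.map linFactor).prod ≠ 0 := by
  refine List.prod_ne_zero fun h => ?_
  obtain ⟨g, -, hg⟩ := List.mem_map.1 h
  exact linFactor_ne_zero g hg

variable {Γ : Subgroup LinTransf}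

theorem GammaLocal.quasiCompatible {S : Set (EInf W)} (hS : GammaLocal Γ S) :
    QuasiCompatible S := by
  intro r a ha
  choose l hl e using fun i j => hS (a i) (ha i) (a j) (ha j)
  -- Quasi-compatibility asks for one polynomial serving all pairs, so the polynomials of all pairs
  -- are multiplied.
  refine ⟨∏ i, ∏ j, ((l i j).map linFactor).prod, ?_, ?_⟩
  · exact Finset.prod_ne_zero_iff.2 fun i _ => Finset.prod_ne_zero_iff.2 fun j _ =>
      prod_linFactor_ne_zero _
  · refine isTruncated_of_comm a (fun _ _ => ∏ i, ∏ j, ((l i j).map linFactor).prod)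
      fun i j _ => ?_
    have hd : ((l i j).map linFactor).prod ∣ ∏ i, ∏ j, ((l i j).map linFactor).prod :=
      (Finset.dvd_prod_of_mem (fun j => ((l i j).map linFactor).prod) (Finset.mem_univ j)).trans
        (Finset.dvd_prod_of_mem (fun i => ∏ j, ((l i j).map linFactor).prod) (Finset.mem_univ i))
    obtain ⟨c, hc⟩ := hd
    rw [hc, mul_comm, polyMul_mul, e, polyMul_zero]

theorem LocalPair.qcPair {a b : EInf W} (h : LocalPair Γ a b) : QCPair a b := by
  obtain ⟨l, -, e⟩ := h
  exact ⟨_, prod_linFactor_ne_zero l, isTruncated_pair_of_comm e⟩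

/-! ### The closed subspace generated by a local set -/

-- Commutant and double commutant: let `S'` be the space of series Γ-local with `S`, and take `U =
-- S' ∩ S''`. Any two elements of `U` are Γ-local, one being regarded in `S''` and the other in
-- `S'`. Dong's lemma closes both commutants under the products, and `S ⊆ U` since Γ-locality is
-- symmetric.
variable (Γ) in
theorem exists_gammaLocal_closed {S : Set (EInf W)} (hS : GammaLocal Γ S) :
    ∃ U ∈ closedContaining S, GammaLocal Γ (U : Set (EInf W)) := by
  let U := localWith Γ S ⊓ localWith Γ (localWith Γ S : Set (EInf W))
  have hU : GammaLocal Γ (U : Set (EInf W)) := fun a ha b hb => ha.2 b hb.1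
  refine ⟨U, ⟨⟨hU.quasiCompatible, fun a ha b hb n => ?_⟩, fun a ha => ?_, ?_⟩, hU⟩
  · exact ⟨fun c hc => (ha.1 c hc).nProd (hb.1 c hc) n,
      fun c hc => (ha.2 c hc).nProd (hb.2 c hc) n⟩
  · exact ⟨fun c hc => hS a ha c hc, fun c hc => (hc a ha : LocalPair Γ c a).symm⟩
  · exact ⟨fun c _ => localPair_oneW c, fun c _ => localPair_oneW c⟩

theorem generated_gammaLocal {S : Set (EInf W)} (hS : GammaLocal Γ S) :
    GammaLocal Γ (generated S : Set (EInf W)) := by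
  obtain ⟨U, hU, hl⟩ := exists_gammaLocal_closed Γ hS
  exact fun a ha b hb => hl a (sInf_le hU ha) b (sInf_le hU hb)

theorem subset_generated (S : Set (EInf W)) : S ⊆ generated S := fun _ ha =>
  Submodule.mem_sInf.2 fun _ hU => hU.2.1 ha

theorem oneW_mem_generated (S : Set (EInf W)) : oneW ∈ generated S :=
  Submodule.mem_sInf.2 fun _ hU => hU.2.2

theorem nProd_mem_generated (S : Set (EInf W)) {a b : EInf W} (ha : a ∈ generated S)
    (hb : b ∈ generated S) (n : ℤ) : nProd a b n ∈ generated S :=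
  Submodule.mem_sInf.2 fun U hU =>
    hU.1.closed a (Submodule.mem_sInf.1 ha U hU) b (Submodule.mem_sInf.1 hb U hU) n

/-- The intersection is contained in the Γ-local member supplied by `exists_gammaLocal_closed`,
hence is Γ-local and so quasi-compatible. It therefore belongs to the family itself. -/
theorem isLeast_generated {S : Set (EInf W)} (hS : GammaLocal Γ S) :
    IsLeast (closedContaining S) (generated S) :=
  ⟨⟨⟨(generated_gammaLocal hS).quasiCompatible, fun _ ha _ hb n => nProd_mem_generated S ha hb n⟩,
    subset_generated S, oneW_mem_generated S⟩, fun _ hU => sInf_le hU⟩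

end Compat

/-! ### Compositions of substitutions -/

section Kernels

variable {M : Type*} [AddCommGroup M] [Module ℂ M]

theorem finsum_eq_sum_of_ne_zero {f : ℤ → M} (B : Finset ℤ) (h : ∀ m, f m ≠ 0 → m ∈ B) :
    ∑ᶠ m, f m = ∑ m ∈ B, f m :=
  finsum_eq_sum_of_support_subset f fun m hm => h m hm

theorem finsum_swap {F : ℤ → ℤ → M} (B B' : Finset ℤ) (h : ∀ m l, F m l ≠ 0 → m ∈ B ∧ l ∈ B') :
    ∑ᶠ m, ∑ᶠ l, F m l = ∑ᶠ l, ∑ᶠ m, F m l := by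
  have h1 : ∀ m, ∑ᶠ l, F m l = ∑ l ∈ B', F m l := fun m =>
    finsum_eq_sum_of_ne_zero B' fun l hl => (h m l hl).2
  have h2 : ∀ l, ∑ᶠ m, F m l = ∑ m ∈ B, F m l := fun l =>
    finsum_eq_sum_of_ne_zero B fun m hm => (h m l hm).1
  simp only [h1, h2]
  rw [finsum_eq_sum_of_ne_zero B, finsum_eq_sum_of_ne_zero B', Finset.sum_comm]
  · intro l hl
    obtain ⟨m, -, hm⟩ := Finset.exists_ne_zero_of_sum_ne_zero hl
    exact (h m l hm).2
  · intro m hm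
    obtain ⟨l, -, hl⟩ := Finset.exists_ne_zero_of_sum_ne_zero hm
    exact (h m l hl).1

theorem finsum_eq_sum_range (a : ℤ) (L : ℕ) {f : ℤ → M} (hf : ∀ m, f m ≠ 0 → a ≤ m ∧ m ≤ a + L) :
    ∑ᶠ m, f m = ∑ i ∈ Finset.range (L + 1), f (a + i) := by
  rw [← finsum_nat_eq_finsum_int (M := M) a f fun m hm => by
    by_contra h
    exact absurd (hf m h).1 (not_le.2 hm)]
  refine finsum_eq_sum_of_support_subset _ fun i hi => ?_
  have := (hf _ hi).2
  simp only [Finset.coe_range, Set.mem_Iio]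
  omega

theorem kerZero_ne_zero {c₀ c₁ : ℂ} {m a : ℤ} (h : kerZero c₀ c₁ m a ≠ 0) : a ≤ m :=
  not_lt.1 fun hlt => h (kerZero_of_lt hlt)

theorem kerInf_ne_zero {m a : ℤ} (h : kerInf m a ≠ 0) : 0 ≤ a :=
  not_lt.1 fun hlt => h (kerInf_of_neg hlt)

/-- Both sides equal `binom(m, s+t) · binom(s+t, s)`. -/
theorem choose_mul_choose_sub (m : ℤ) (s t : ℕ) :
    Ring.choose m s * Ring.choose (m - s) t = Ring.choose m t * Ring.choose (m - t) s := by
  have h1 := Ring.choose_smul_choose m (Nat.le_add_right s t)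
  have h2 := Ring.choose_smul_choose m (Nat.le_add_left t s)
  rw [Nat.add_sub_cancel_left] at h1
  rw [Nat.add_sub_cancel, ← Nat.choose_symm_add] at h2
  rw [← h1, ← h2]

theorem vandermonde (m n : ℤ) (k : ℕ) :
    Ring.choose (m + n) k = ∑ i ∈ Finset.range (k + 1), Ring.choose m i * Ring.choose n (k - i) := by
  rw [Ring.add_choose_eq k (Commute.all m n), Finset.Nat.sum_antidiagonal_eq_sum_range_succ
    fun i j => Ring.choose m i * Ring.choose n j]

/-- Coefficients of `x^k` in `h(g(x))^l`, expanded in one step or in two. Regrouping the binomials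
turns the double expansion into the binomial theorem for `(h₀ g₁ + h₁)^(l-k)`. -/
theorem kerZero_comp {g₀ g₁ h₀ h₁ : ℂ} (hh : h₀ ≠ 0) (k l : ℤ) :
    ∑ᶠ m, kerZero g₀ g₁ m k * kerZero h₀ h₁ l m =
      kerZero (h₀ * g₀) (h₀ * g₁ + h₁) l k := by
  rcases lt_or_ge l k with hlt | hle
  · rw [kerZero_of_lt hlt]
    refine finsum_eq_zero_of_forall_eq_zero fun m => ?_
    by_contra hne
    have := kerZero_ne_zero (left_ne_zero_of_mul hne)
    have := kerZero_ne_zero (right_ne_zero_of_mul hne)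
    omega
  · obtain ⟨L, rfl⟩ : ∃ L : ℕ, l = k + L := ⟨(l - k).toNat, by omega⟩
    rw [finsum_eq_sum_range k L, kerZero_add_natCast, add_pow, Finset.mul_sum]
    · refine Finset.sum_congr rfl fun i hi => ?_
      have hi' : i ≤ L := Nat.lt_succ_iff.1 (Finset.mem_range.1 hi)
      rw [kerZero_add_natCast]
      have e : kerZero h₀ h₁ (k + L) (k + i) =
          ((Ring.choose (k + L) (L - i) : ℤ) : ℂ) * h₀ ^ (k + i) * h₁ ^ (L - i) := by
        rw [show k + (L : ℤ) = (k + i) + ((L - i : ℕ) : ℤ) by push_cast [hi']; ring,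
          kerZero_add_natCast]
      have c := Ring.choose_smul_choose (k + L : ℤ) (Nat.sub_le L i)
      rw [Nat.sub_sub_self hi', Nat.choose_symm hi', nsmul_eq_mul,
        show (k + L : ℤ) - ((L - i : ℕ) : ℤ) = k + i by push_cast [hi']; ring] at c
      have c' : ((L.choose i : ℕ) : ℂ) * ((Ring.choose (k + L : ℤ) L : ℤ) : ℂ) =
          ((Ring.choose (k + L : ℤ) (L - i) : ℤ) : ℂ) * ((Ring.choose (k + i : ℤ) i : ℤ) : ℂ) := by
        exact_mod_cast congrArg (Int.cast : ℤ → ℂ) c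
      rw [e, zpow_add₀ hh, mul_zpow, mul_pow, zpow_natCast]
      linear_combination -(g₀ ^ k * g₁ ^ i * h₀ ^ k * h₀ ^ i * h₁ ^ (L - i)) * c'
    · intro m hm
      exact ⟨kerZero_ne_zero (left_ne_zero_of_mul hm), kerZero_ne_zero (right_ne_zero_of_mul hm)⟩

/-- Both sides are the coefficient of `x₀^t x^k` in `g(x + x₀)^{m₁} g(x)^{m₂}`. On the left
`g(x₁)^{m₁} g(x)^{m₂}` is expanded before setting `x₁ = x + x₀`; on the right `g(x + x₀) = g(x) + g₀
x₀` is expanded in `x₀` first. The combinatorial content is Vandermonde's identity. -/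
theorem kerInf_kerZero_comp {g₀ : ℂ} (hg : g₀ ≠ 0) (g₁ : ℂ) (m₁ m₂ t k : ℤ) :
    ∑ᶠ m, kerInf m t * (kerZero g₀ g₁ m₁ m * kerZero g₀ g₁ m₂ (k + t - m)) =
      g₀ ^ t * (kerInf m₁ t * kerZero g₀ g₁ (m₁ + m₂ - t) k) := by
  have hz : ∀ m, kerInf m t * (kerZero g₀ g₁ m₁ m * kerZero g₀ g₁ m₂ (k + t - m)) ≠ 0 →
      0 ≤ t ∧ m ≤ m₁ ∧ k + t - m ≤ m₂ := fun m hm =>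
    ⟨kerInf_ne_zero (left_ne_zero_of_mul hm),
      kerZero_ne_zero (left_ne_zero_of_mul (right_ne_zero_of_mul hm)),
      kerZero_ne_zero (right_ne_zero_of_mul (right_ne_zero_of_mul hm))⟩
  rcases lt_or_ge t 0 with ht | ht
  · rw [kerInf_of_neg ht, zero_mul, mul_zero]
    refine finsum_eq_zero_of_forall_eq_zero fun m => ?_
    by_contra hne
    have := hz m hne
    omega
  rcases lt_or_ge (m₁ + m₂ - t) k with hlt | hle
  · rw [kerZero_of_lt hlt, mul_zero, mul_zero]
    refine finsum_eq_zero_of_forall_eq_zero fun m => ?_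
    by_contra hne
    have := hz m hne
    omega
  obtain ⟨u, rfl⟩ := Int.eq_ofNat_of_zero_le ht
  obtain ⟨s, hs⟩ := Int.eq_ofNat_of_zero_le (sub_nonneg.2 hle)
  have e₂ : m₁ + m₂ - u = k + s := by omega
  rw [finsum_eq_sum_range (m₁ - s) s (fun m hm => by have := hz m hm; omega), e₂,
    kerInf_natCast, kerZero_add_natCast, ← Finset.sum_range_reflect]
  have hv := vandermonde (m₁ - u) m₂ s
  rw [show m₁ - (u : ℤ) + m₂ = k + s by omega] at hv
  rw [hv, Int.cast_sum, Finset.sum_mul, Finset.sum_mul, Finset.mul_sum, Finset.mul_sum]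
  refine Finset.sum_congr rfl fun i hi => ?_
  have hi' : i ≤ s := Nat.lt_succ_iff.1 (Finset.mem_range.1 hi)
  have a₁ : m₁ - (s : ℤ) + ((s + 1 - 1 - i : ℕ) : ℤ) = m₁ - i := by omega
  rw [a₁, kerInf_natCast]
  have b₁ : kerZero g₀ g₁ m₁ (m₁ - i) = ((Ring.choose m₁ i : ℤ) : ℂ) * g₀ ^ (m₁ - i) * g₁ ^ i := by
    have := kerZero_add_natCast g₀ g₁ (m₁ - i) i
    rwa [sub_add_cancel] at this
  have b₂ : kerZero g₀ g₁ m₂ (k + u - (m₁ - i)) =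
      ((Ring.choose m₂ (s - i) : ℤ) : ℂ) * g₀ ^ (k + u - (m₁ - i)) * g₁ ^ (s - i) := by
    have := kerZero_add_natCast g₀ g₁ (k + u - (m₁ - i)) (s - i)
    rwa [show k + u - (m₁ - i) + ((s - i : ℕ) : ℤ) = m₂ by omega] at this
  have c := congrArg (Int.cast : ℤ → ℂ) (choose_mul_choose_sub m₁ i u)
  push_cast at c
  have d : g₀ ^ (m₁ - i) * g₀ ^ (k + u - (m₁ - i)) = g₀ ^ (u : ℤ) * g₀ ^ k := by
    rw [← zpow_add₀ hg, ← zpow_add₀ hg]; congr 1; ring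
  have f : g₁ ^ s = g₁ ^ i * g₁ ^ (s - i) := by rw [← pow_add]; congr 1; omega
  rw [b₁, b₂, f]
  push_cast
  linear_combination ((Ring.choose m₂ (s - i) : ℤ) : ℂ) * g₁ ^ i * g₁ ^ (s - i) *
      ((Ring.choose (m₁ - i) u : ℤ) : ℂ) * ((Ring.choose m₁ i : ℤ) : ℂ) * d +
    ((Ring.choose m₂ (s - i) : ℤ) : ℂ) * g₁ ^ i * g₁ ^ (s - i) * g₀ ^ (u : ℤ) * g₀ ^ k * c

/-- Both sides are the coefficient of `x₀^i x₁^j` in `(x₀ + x₁ + x)^{m₁} (x₁ + x)^{m₂}` with `x` set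
to `1`. On the left the first factor is expanded in `y = x₀ + x₁`, then `y^m` is expanded; on the
right it is expanded in `x₀` alone. -/
theorem kerZero_kerInf_comp (m₁ m₂ i j : ℤ) :
    ∑ᶠ m, kerZero 1 1 m i * (kerInf m₁ m * kerInf m₂ (i + j - m)) =
      kerInf m₁ i * kerInf (m₁ + m₂ - i) j := by
  have hz : ∀ m, kerZero 1 1 m i * (kerInf m₁ m * kerInf m₂ (i + j - m)) ≠ 0 →
      i ≤ m ∧ 0 ≤ m ∧ m ≤ i + j := fun m hm => by
    have h1 := kerZero_ne_zero (left_ne_zero_of_mul hm)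
    have h2 := kerInf_ne_zero (left_ne_zero_of_mul (right_ne_zero_of_mul hm))
    have h3 := kerInf_ne_zero (right_ne_zero_of_mul (right_ne_zero_of_mul hm))
    omega
  rcases lt_or_ge i 0 with hi | hi
  · rw [kerInf_of_neg hi, zero_mul]
    refine finsum_eq_zero_of_forall_eq_zero fun m => ?_
    by_contra hne
    have h := hz m hne
    -- Since `m ≥ 0`, the power `(x₀ + x₁)^m` is a polynomial and has no negative powers of `x₀`.
    obtain ⟨u, rfl⟩ := Int.eq_ofNat_of_zero_le h.2.1
    refine hne ?_
    rw [kerZero, if_pos h.1]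
    have : Ring.choose (u : ℤ) ((u : ℤ) - i).toNat = 0 := by
      have := Ring.choose_natCast (R := ℤ) u ((u : ℤ) - i).toNat
      rw [this, Nat.choose_eq_zero_of_lt (by omega), Nat.cast_zero]
    simp [this]
  rcases lt_or_ge j 0 with hj | hj
  · rw [kerInf_of_neg hj, mul_zero]
    refine finsum_eq_zero_of_forall_eq_zero fun m => ?_
    by_contra hne
    have := hz m hne
    omega
  obtain ⟨u, rfl⟩ := Int.eq_ofNat_of_zero_le hi
  obtain ⟨v, rfl⟩ := Int.eq_ofNat_of_zero_le hj
  rw [finsum_eq_sum_range (u : ℤ) v fun m hm => by have := hz m hm; omega]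
  rw [kerInf_natCast, kerInf_natCast, show m₁ + m₂ - (u : ℤ) = m₁ - u + m₂ by ring, vandermonde,
    Int.cast_sum, Finset.mul_sum]
  refine Finset.sum_congr rfl fun s hs => ?_
  have hs' : s ≤ v := Nat.lt_succ_iff.1 (Finset.mem_range.1 hs)
  rw [show (u : ℤ) + v - (u + s) = ((v - s : ℕ) : ℤ) by omega, kerInf_natCast,
    show (u : ℤ) + s = ((u + s : ℕ) : ℤ) by push_cast; ring, kerInf_natCast]
  have h0 : kerZero 1 1 ((u + s : ℕ) : ℤ) u = (((u + s).choose u : ℕ) : ℂ) := by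
    have h := kerZero_add_natCast 1 1 (u : ℤ) s
    rw [one_zpow, one_pow, mul_one, mul_one, ← Nat.cast_add, Ring.choose_natCast,
      ← Nat.choose_symm_add] at h
    rw [h]; push_cast; rfl
  have c := Ring.choose_smul_choose m₁ (Nat.le_add_right u s)
  rw [Nat.add_sub_cancel_left, nsmul_eq_mul] at c
  have c' := congrArg (Int.cast : ℤ → ℂ) c
  push_cast at c'
  rw [h0]
  push_cast
  linear_combination ((Ring.choose m₂ (v - s) : ℤ) : ℂ) * c'

theorem finsum_triple_comm {F : ℤ → ℤ → ℤ → M} (B B₁ B₂ : Finset ℤ)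
    (h : ∀ m l k, F m l k ≠ 0 → m ∈ B ∧ l ∈ B₁ ∧ k ∈ B₂) :
    ∑ᶠ m, ∑ᶠ l, ∑ᶠ k, F m l k = ∑ᶠ l, ∑ᶠ k, ∑ᶠ m, F m l k := by
  rw [finsum_swap B B₁]
  · exact finsum_congr fun l => finsum_swap B B₂ fun m k hmk => ⟨(h m l k hmk).1, (h m l k hmk).2.2⟩
  · intro m l hml
    by_contra hne
    refine hml (finsum_eq_zero_of_forall_eq_zero fun k => ?_)
    by_contra hk
    exact hne ⟨(h m l k hk).1, (h m l k hk).2.1⟩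

/-! ### The substitutions in coordinates, in two and three variables -/

theorem affineSubst_zero_apply (F : (Fin 2 → ℤ) → M) (g : LinTransf) (t k : ℤ) :
    affineSubst 0 g F ![t, k] = ∑ᶠ m, kerZero g.c₀ g.c₁ m t • F ![m, k] := by
  refine finsum_congr fun m => ?_
  congr 2
  funext l
  fin_cases l <;> simp

theorem affineSubst_one_apply (F : (Fin 2 → ℤ) → M) (g : LinTransf) (t k : ℤ) :
    affineSubst 1 g F ![t, k] = ∑ᶠ m, kerZero g.c₀ g.c₁ m k • F ![t, m] := by
  refine finsum_congr fun m => ?_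
  congr 2
  funext l
  fin_cases l <;> simp

theorem shiftInf_apply₂ (F : (Fin 2 → ℤ) → M) (t k : ℤ) :
    shiftInf 0 1 F ![t, k] = ∑ᶠ m, kerInf m t • F ![m, k + t - m] := by
  refine finsum_congr fun m => ?_
  congr 2
  funext l
  fin_cases l <;> simp
  ring

theorem shiftInf01_apply (F : (Fin 3 → ℤ) → M) (i j k : ℤ) :
    shiftInf 0 1 F ![i, j, k] = ∑ᶠ m, kerInf m i • F ![m, j + i - m, k] := by
  refine finsum_congr fun m => ?_
  congr 2
  funext l
  fin_cases l <;> simp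
  ring

theorem shiftInf02_apply (F : (Fin 3 → ℤ) → M) (i j k : ℤ) :
    shiftInf 0 2 F ![i, j, k] = ∑ᶠ m, kerInf m i • F ![m, j, k + i - m] := by
  refine finsum_congr fun m => ?_
  congr 2
  funext l
  fin_cases l <;> simp
  ring

theorem shiftInf12_apply (F : (Fin 3 → ℤ) → M) (i j k : ℤ) :
    shiftInf 1 2 F ![i, j, k] = ∑ᶠ m, kerInf m j • F ![i, m, k + j - m] := by
  refine finsum_congr fun m => ?_
  congr 2
  funext l
  fin_cases l <;> simp
  ring

theorem shiftZero01_apply (F : (Fin 3 → ℤ) → M) (i j k : ℤ) :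
    shiftZero 0 1 F ![i, j, k] = ∑ᶠ m, kerZero 1 1 m i • F ![m, j + i - m, k] := by
  refine finsum_congr fun m => ?_
  congr 2
  funext l
  fin_cases l <;> simp
  ring

/-- The transformation `x ↦ c₀ x`. -/
def LinTransf.scale (c₀ : ℂˣ) : LinTransf := ⟨c₀, 0⟩

theorem kerZero_zero (c : ℂ) (m t : ℤ) : kerZero c 0 m t = if m = t then c ^ t else 0 := by
  rcases lt_trichotomy m t with h | rfl | h
  · rw [kerZero_of_lt h, if_neg h.ne]
  · simp [kerZero]
  · rw [if_neg h.ne', kerZero, if_pos h.le, zero_pow (by omega), mul_zero]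

theorem affineSubst_scale_apply (F : (Fin 2 → ℤ) → M) (c : ℂˣ) (n : Fin 2 → ℤ) :
    affineSubst 0 (LinTransf.scale c) F n = (c : ℂ) ^ n 0 • F n := by
  have hn : n = ![n 0, n 1] := by funext i; fin_cases i <;> rfl
  rw [hn, affineSubst_zero_apply, finsum_eq_single _ (n 0)]
  · simp [LinTransf.scale, kerZero_zero]
  · intro m hm
    simp [LinTransf.scale, kerZero_zero, hm]

/-- `g(x + x₀) = g(x) + c₀ x₀` on the level of series. -/
theorem affineSubst_shiftInf (g : LinTransf) {T : (Fin 2 → ℤ) → M} {N : ℤ}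
    (hT : ∀ n : Fin 2 → ℤ, (∃ i, N < n i) → T n = 0) :
    affineSubst 1 g (affineSubst 0 (LinTransf.scale g.c₀) (shiftInf 0 1 T)) =
      shiftInf 0 1 (affineSubst 0 g (affineSubst 1 g T)) := by
  funext n
  obtain ⟨t, k, rfl⟩ : ∃ t k, n = ![t, k] := ⟨n 0, n 1, by funext i; fin_cases i <;> rfl⟩
  have hT' : ∀ m₁ m₂, T ![m₁, m₂] ≠ 0 → m₁ ≤ N ∧ m₂ ≤ N := fun m₁ m₂ h => by
    refine ⟨not_lt.1 fun hlt => h (hT _ ⟨0, hlt⟩), not_lt.1 fun hlt => h (hT _ ⟨1, hlt⟩)⟩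
  simp only [affineSubst_one_apply, affineSubst_scale_apply]
  simp only [affineSubst_one_apply, affineSubst_zero_apply, shiftInf_apply₂, smul_finsum,
    smul_smul, Matrix.cons_val_zero]
  refine (finsum_swap (Finset.Icc k (2 * N - t)) (Finset.Icc (k + t - N) N) ?_).trans
    (Eq.trans ?_ (finsum_triple_comm (Finset.Icc (k + t - N) N) (Finset.Icc (k + t - N) N)
      (Finset.Icc (k + t - N) N) ?_).symm)
  rotate_left
  · refine finsum_congr fun m₁ => ?_
    -- Reindex by `m₁ + m₂ - t`, the exponent of `g(x)` that remains when `x₀^t` is taken out of the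
    -- first factor.
    rw [← finsum_comp_equiv (Equiv.addLeft (m₁ - t))]
    refine finsum_congr fun m₂ => ?_
    rw [← finsum_smul]
    simp only [Equiv.coe_addLeft]
    rw [kerInf_kerZero_comp g.c₀.ne_zero, show m₁ - t + m₂ = m₁ + m₂ - t by ring,
      show m₁ + m₂ - t + t - m₁ = m₂ by ring]
    congr 1
    ring
  · intro m m₁ m₂ h
    have h0 := hT' _ _ (right_ne_zero_of_smul h)
    have h1 := kerZero_ne_zero (left_ne_zero_of_mul (right_ne_zero_of_mul (left_ne_zero_of_smul h)))
    have h2 := kerZero_ne_zero (right_ne_zero_of_mul (right_ne_zero_of_mul (left_ne_zero_of_smul h)))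
    simp only [Finset.mem_Icc]
    omega
  · intro l m h
    have h0 := hT' _ _ (right_ne_zero_of_smul h)
    have h1 := kerZero_ne_zero (left_ne_zero_of_mul (left_ne_zero_of_smul h))
    simp only [Finset.mem_Icc]
    omega

section Three

variable {T : (Fin 3 → ℤ) → M} {N : ℤ}

theorem le_of_ne_zero (hT : ∀ n : Fin 3 → ℤ, (∃ i, N < n i) → T n = 0) (a b c : ℤ)
    (h : T ![a, b, c] ≠ 0) : a ≤ N ∧ b ≤ N ∧ c ≤ N :=
  ⟨not_lt.1 fun hlt => h (hT _ ⟨0, hlt⟩), not_lt.1 fun hlt => h (hT _ ⟨1, hlt⟩),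
    not_lt.1 fun hlt => h (hT _ ⟨2, hlt⟩)⟩

/-- The substitutions `x₀ ↦ x₀ + x₂` and `x₁ ↦ x₁ + x₂` change different variables; the upper bounds
on `T` make the double sum finite, so the order is immaterial. -/
theorem shiftInf_comm (hT : ∀ n : Fin 3 → ℤ, (∃ i, N < n i) → T n = 0) :
    shiftInf 0 2 (shiftInf 1 2 T) = shiftInf 1 2 (shiftInf 0 2 T) := by
  funext n
  obtain ⟨i, j, k, rfl⟩ : ∃ i j k, n = ![i, j, k] :=
    ⟨n 0, n 1, n 2, by funext i; fin_cases i <;> rfl⟩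
  have hT' := le_of_ne_zero hT
  simp only [shiftInf02_apply, shiftInf12_apply, smul_finsum, smul_smul]
  rw [finsum_swap (Finset.Icc (k + i + j - 2 * N) N) (Finset.Icc (k + i + j - 2 * N) N)]
  · refine finsum_congr fun m => finsum_congr fun l => ?_
    rw [mul_comm, show k + i - l + j - m = k + j - m + i - l by ring]
  · intro m l h
    have h0 := hT' _ _ _ (right_ne_zero_of_smul h)
    simp only [Finset.mem_Icc]
    omega

/-- Both sides are `T(x₀ + x₂ + x, x₂ + x, x)`. -/
theorem shiftZero_shiftInf (hT : ∀ n : Fin 3 → ℤ, (∃ i, N < n i) → T n = 0) :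
    shiftZero 0 1 (shiftInf 0 2 (shiftInf 1 2 T)) = shiftInf 1 2 (shiftInf 0 1 T) := by
  funext n
  obtain ⟨i, j, k, rfl⟩ : ∃ i j k, n = ![i, j, k] :=
    ⟨n 0, n 1, n 2, by funext i; fin_cases i <;> rfl⟩
  have hT' := le_of_ne_zero hT
  simp only [shiftInf02_apply, shiftInf12_apply, shiftInf01_apply, shiftZero01_apply, smul_finsum,
    smul_smul]
  refine (finsum_triple_comm (Finset.Icc i (i + j)) (Finset.Icc (k + i + j - 2 * N) N)
    (Finset.Icc (k + i + j - 2 * N) N) ?_).trans (Eq.trans ?_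
      (finsum_swap (Finset.Icc (k + j - N) (2 * N - i)) (Finset.Icc (k + i + j - 2 * N) N) ?_).symm)
  rotate_left
  · refine finsum_congr fun m₁ => ?_
    refine Eq.trans ?_ (finsum_comp_equiv (Equiv.addLeft (m₁ - i)))
    refine finsum_congr fun m₂ => ?_
    have e : ∀ m, k + m - m₁ + (j + i - m) - m₂ = k + j - (m₁ - i + m₂) := fun m => by ring
    simp only [e, Equiv.coe_addLeft]
    rw [← finsum_smul]
    have h := kerZero_kerInf_comp m₁ m₂ i j
    simp only [add_comm i j] at h
    rw [h, show m₁ - i + m₂ = m₁ + m₂ - i by ring, show m₁ + m₂ - i + i - m₁ = m₂ by ring]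
    congr 1
    ring
  · intro l m h
    have h0 := hT' _ _ _ (right_ne_zero_of_smul h)
    simp only [Finset.mem_Icc]
    omega
  · intro m m₁ m₂ h
    have h0 := hT' _ _ _ (right_ne_zero_of_smul h)
    have h1 := kerZero_ne_zero (left_ne_zero_of_mul (left_ne_zero_of_smul h))
    have h2 := kerInf_ne_zero (right_ne_zero_of_mul (right_ne_zero_of_mul (left_ne_zero_of_smul h)))
    simp only [Finset.mem_Icc]
    omega

end Three

end Kernels

/-! ### The action of affine transformations on series -/

section Action

variable {W : Type*} [AddCommGroup W] [Module ℂ W]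

open MvPolynomial Function

theorem cf_subst_finite (g : LinTransf) (a : EInf W) (k : ℤ) (w : W) :
    (support fun m : ℤ => kerZero g.c₀ g.c₁ m k • cf a m w).Finite := by
  obtain ⟨N, hN⟩ := cf_bound a w
  refine (Set.finite_Icc k N).subset fun m hm => ?_
  have h1 := kerZero_ne_zero (left_ne_zero_of_smul hm)
  refine ⟨h1, not_lt.1 fun h => right_ne_zero_of_smul hm (hN m h)⟩

theorem finsum_map_cf_subst {N : Type*} [AddCommGroup N] [Module ℂ N] (L : W →ₗ[ℂ] N)
    (g : LinTransf) (a : EInf W) (k : ℤ) (w : W) :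
    ∑ᶠ m : ℤ, kerZero g.c₀ g.c₁ m k • L (cf a m w) = L (cf (subst g a) k w) := by
  have h := L.toAddMonoidHom.map_finsum (cf_subst_finite g a k w)
  simp only [LinearMap.toAddMonoidHom_coe, map_smul] at h
  rw [cf_subst_apply, h]

/-- `a(x) ↦ a(g(x))` as a linear map. -/
def substL (g : LinTransf) : EInf W →ₗ[ℂ] EInf W where
  toFun := subst g
  map_add' a b := by
    refine cf_ext fun k w => ?_
    rw [cf_add, LinearMap.add_apply, cf_subst_apply, cf_subst_apply, cf_subst_apply,
      ← finsum_add_distrib (cf_subst_finite g a k w) (cf_subst_finite g b k w)]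
    simp only [cf_add, LinearMap.add_apply, smul_add]
  map_smul' c a := by
    refine cf_ext fun k w => ?_
    rw [RingHom.id_apply, cf_smul, LinearMap.smul_apply, cf_subst_apply, cf_subst_apply,
      smul_finsum]
    simp only [cf_smul, LinearMap.smul_apply, smul_comm c]

theorem substL_apply (g : LinTransf) (a : EInf W) : substL g a = subst g a := rfl

/-- This is `kerZero_comp` on coefficients, after an interchange of sums that is finite because
`a(x) w` has exponents bounded above. In the group, `g * h` means `h ∘ g`, so the result is a left
action. -/
theorem subst_mul (g h : LinTransf) (a : EInf W) : subst (g * h) a = subst g (subst h a) := by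
  refine cf_ext fun k w => ?_
  obtain ⟨N, hN⟩ := cf_bound a w
  rw [cf_subst_apply, cf_subst_apply]
  simp only [cf_subst_apply h, smul_finsum, smul_smul]
  rw [finsum_swap (Finset.Icc k N) (Finset.Icc k N)]
  · refine finsum_congr fun l => ?_
    rw [← finsum_smul, kerZero_comp h.c₀.ne_zero]
    rfl
  · intro m l hne
    have h1 := kerZero_ne_zero (left_ne_zero_of_mul (left_ne_zero_of_smul hne))
    have h2 := kerZero_ne_zero (right_ne_zero_of_mul (left_ne_zero_of_smul hne))
    have h3 : l ≤ N := not_lt.1 fun h => right_ne_zero_of_smul hne (hN l h)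
    simp only [Finset.mem_Icc]
    omega

theorem subst_one (a : EInf W) : subst 1 a = a := by
  refine cf_ext fun k w => ?_
  rw [cf_subst_apply, finsum_eq_single _ k]
  · simp [LinTransf.one_def, kerZero_zero]
  · intro m hm
    simp [LinTransf.one_def, kerZero_zero, hm]

theorem subst_oneW (g : LinTransf) : subst g (oneW : EInf W) = oneW := by
  refine cf_ext fun k w => ?_
  rw [cf_subst_apply, finsum_eq_single _ 0]
  · simp only [cf_oneW, if_true]
    rcases lt_trichotomy k 0 with h | rfl | h
    · rw [if_neg h.ne, kerZero, if_pos h.le, Ring.choose_zero_pos ℤ (by omega : 0 < (0 - k).toNat)]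
      simp
    · simp [kerZero]
    · rw [kerZero_of_lt h, if_neg h.ne']; simp
  · intro m hm
    rw [cf_oneW, if_neg hm]; simp

/-! ### Affine substitutions in operator products -/

theorem affineDom_of_upper {r : ℕ} {M : Type*} [AddCommGroup M] [Module ℂ M] {i : Fin r}
    (g : LinTransf) {F : (Fin r → ℤ) → M}
    (h : ∀ n : Fin r → ℤ, ∃ N : ℤ, ∀ m : ℤ, N < m → F (n + m • Pi.single i 1) = 0) :
    AffineDom i g F := by
  intro n a
  obtain ⟨N, hN⟩ := h n
  exact (Set.finite_Icc a N).subset fun m hm =>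
    ⟨kerZero_ne_zero hm.1, not_lt.1 fun hlt => hm.2 (hN m hlt)⟩

/-- Expanding `g(x_i)^m` in nonnegative powers of the constant term produces only exponents at most
`m`, so upper bounds are preserved. -/
theorem affineSubst_eq_zero {r : ℕ} {M : Type*} [AddCommGroup M] [Module ℂ M] {i : Fin r}
    (g : LinTransf) {F : (Fin r → ℤ) → M} {n : Fin r → ℤ}
    (h : ∀ m : ℤ, 0 ≤ m → F (n + m • Pi.single i 1) = 0) : affineSubst i g F n = 0 := by
  refine finsum_eq_zero_of_forall_eq_zero fun m => ?_
  rcases lt_or_ge m (n i) with hlt | hle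
  · rw [kerZero_of_lt hlt, zero_smul]
  · rw [h _ (sub_nonneg.2 hle), smul_zero]

theorem affineDom_opProd (a b : EInf W) (h : LinTransf) (w : W) :
    AffineDom 1 h fun n : Fin 2 → ℤ => cf a (n 0) (cf b (n 1) w) :=
  affineDom_of_upper h fun n => by
    obtain ⟨N, hN⟩ := cf_bound b w
    refine ⟨N - n 1, fun m hm => ?_⟩
    simp [hN (n 1 + m) (by omega)]

theorem affineDom_opProd_zero (a b : EInf W) (h : LinTransf) (w : W) :
    AffineDom 0 h fun n : Fin 2 → ℤ => cf a (n 0) (cf b (n 1) w) :=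
  affineDom_of_upper h fun n => by
    obtain ⟨N, hN⟩ := cf_bound a (cf b (n 1) w)
    refine ⟨N - n 0, fun m hm => ?_⟩
    simp [hN (n 0 + m) (by omega)]

theorem affineDom_opProd_swap (a b : EInf W) (h : LinTransf) (w : W) :
    AffineDom 1 h fun n : Fin 2 → ℤ => cf b (n 1) (cf a (n 0) w) :=
  affineDom_of_upper h fun n => by
    obtain ⟨N, hN⟩ := cf_bound b (cf a (n 0) w)
    refine ⟨N - n 1, fun m hm => ?_⟩
    simp [hN (n 1 + m) (by omega)]

theorem affineDom_opProd_swap_zero (a b : EInf W) (h : LinTransf) (w : W) :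
    AffineDom 0 h fun n : Fin 2 → ℤ => cf b (n 1) (cf a (n 0) w) :=
  affineDom_of_upper h fun n => by
    obtain ⟨N, hN⟩ := cf_bound a w
    refine ⟨N - n 0, fun m hm => ?_⟩
    simp [hN (n 0 + m) (by omega)]

theorem eta₂ (n : Fin 2 → ℤ) : ![n 0, n 1] = n := by
  funext i; fin_cases i <;> rfl

theorem affineSubst_one_opProd (a b : EInf W) (h : LinTransf) (w : W) :
    affineSubst 1 h (fun n : Fin 2 → ℤ => cf a (n 0) (cf b (n 1) w)) =
      fun n => cf a (n 0) (cf (subst h b) (n 1) w) := by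
  funext n
  rw [← eta₂ n, affineSubst_one_apply]
  exact finsum_map_cf_subst (cf a (n 0)) h b (n 1) w

theorem affineSubst_zero_opProd (a b : EInf W) (g : LinTransf) (w : W) :
    affineSubst 0 g (fun n : Fin 2 → ℤ => cf a (n 0) (cf b (n 1) w)) =
      fun n => cf (subst g a) (n 0) (cf b (n 1) w) := by
  funext n
  rw [← eta₂ n, affineSubst_zero_apply]
  exact (cf_subst_apply g a (n 0) (cf b (n 1) w)).symm

theorem affineSubst_one_opProd_swap (a b : EInf W) (h : LinTransf) (w : W) :
    affineSubst 1 h (fun n : Fin 2 → ℤ => cf b (n 1) (cf a (n 0) w)) =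
      fun n => cf (subst h b) (n 1) (cf a (n 0) w) := by
  funext n
  rw [← eta₂ n, affineSubst_one_apply]
  exact (cf_subst_apply h b (n 1) (cf a (n 0) w)).symm

theorem affineSubst_zero_opProd_swap (a b : EInf W) (g : LinTransf) (w : W) :
    affineSubst 0 g (fun n : Fin 2 → ℤ => cf b (n 1) (cf a (n 0) w)) =
      fun n => cf b (n 1) (cf (subst g a) (n 0) w) := by
  funext n
  rw [← eta₂ n, affineSubst_zero_apply]
  exact finsum_map_cf_subst (cf b (n 1)) g a (n 0) w

/-- `g(x₁) - f(h(x₂)) = g₀ (x₁ - g⁻¹(f(h(x₂))))`, and in the group `h * f * g⁻¹` is the map `g⁻¹ ∘ f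
∘ h`, which stays in Γ when `f`, `g` and `h` do. -/
theorem affinePolyVar_linFactor (g h f : LinTransf) :
    affinePolyVar 0 g (affinePolyVar 1 h (linFactor f)) =
      C (g.c₀ : ℂ) * linFactor (h * f * g⁻¹) := by
  have hg : (C (g.c₀ : ℂ) * C ((g.c₀⁻¹ : ℂˣ) : ℂ) : MvPolynomial (Fin 2) ℂ) = 1 := by
    rw [← C_mul, ← Units.val_mul, mul_inv_cancel, Units.val_one, C_1]
  simp only [linFactor, affinePolyVar, LinTransf.mul_def, LinTransf.inv_def, Units.val_mul,
    map_sub, map_add, map_mul, aeval_X, aeval_C, algebraMap_eq, update_self,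
    map_neg, ne_eq, zero_ne_one, one_ne_zero, not_false_eq_true, update_of_ne]
  linear_combination ((C (f.c₀ : ℂ)) * (C (h.c₀ : ℂ) * X 1 + C h.c₁) + C f.c₁ - C g.c₁ :
    MvPolynomial (Fin 2) ℂ) * hg

variable {Γ : Subgroup LinTransf}

/-- Substitute `x₁ ↦ g(x₁)` and `x₂ ↦ h(x₂)` in the locality relation. The substitution is applied
to the two operator orders separately, since each has its own reason for the sums to be finite. -/
theorem LocalPair.subst {a b : EInf W} (hab : LocalPair Γ a b) {g h : LinTransf} (hg : g ∈ Γ)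
    (hh : h ∈ Γ) : LocalPair Γ (subst g a) (subst h b) := by
  obtain ⟨l, hl, e⟩ := hab
  refine ⟨l.map fun f => h * f * g⁻¹, fun f hf => ?_, ?_⟩
  · obtain ⟨f', hf', rfl⟩ := List.mem_map.1 hf
    exact Γ.mul_mem (Γ.mul_mem hh (hl f' hf')) (Γ.inv_mem hg)
  have hp : ∀ l : List LinTransf, affinePolyVar 0 g (affinePolyVar 1 h (l.map linFactor).prod) =
      C ((g.c₀ : ℂ) ^ l.length) * ((l.map fun f => h * f * g⁻¹).map linFactor).prod := by
    intro l
    induction l with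
    | nil => simp
    | cons f l ih =>
      simp only [List.map_cons, List.prod_cons, map_mul, List.length_cons, pow_succ, ih,
        affinePolyVar_linFactor]
      ring
  have key : polyMul (affinePolyVar 0 g (affinePolyVar 1 h (l.map linFactor).prod))
      (commSeries (AtInfinity.subst g a) (AtInfinity.subst h b)) = 0 := by
    funext n
    refine LinearMap.ext fun w => ?_
    rw [polyMul_apply]
    let F : (Fin 2 → ℤ) → W := fun n => cf a (n 0) (cf b (n 1) w)
    let G : (Fin 2 → ℤ) → W := fun n => cf b (n 1) (cf a (n 0) w)
    have hF : affineSubst 0 g (affineSubst 1 h F) =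
        fun n => cf (AtInfinity.subst g a) (n 0) (cf (AtInfinity.subst h b) (n 1) w) := by
      rw [affineSubst_one_opProd, affineSubst_zero_opProd]
    have hG : affineSubst 0 g (affineSubst 1 h G) =
        fun n => cf (AtInfinity.subst h b) (n 1) (cf (AtInfinity.subst g a) (n 0) w) := by
      rw [affineSubst_one_opProd_swap, affineSubst_zero_opProd_swap]
    have d1F : AffineDom 1 h F := affineDom_opProd a b h w
    have d1G : AffineDom 1 h G := affineDom_opProd_swap a b h w
    have d0F : AffineDom 0 g (affineSubst 1 h F) := by
      rw [affineSubst_one_opProd]; exact affineDom_opProd_zero _ _ _ _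
    have d0G : AffineDom 0 g (affineSubst 1 h G) := by
      rw [affineSubst_one_opProd_swap]; exact affineDom_opProd_swap_zero _ _ _ _
    have h0 : polyMul (l.map linFactor).prod F = polyMul (l.map linFactor).prod G := by
      rw [← sub_eq_zero, ← polyMul_sub]
      exact polyMul_apply_eq_zero e w
    have h1 := congrArg (fun H => affineSubst 0 g (affineSubst 1 h H)) h0
    rw [affineSubst_polyMul _ _ _ d1F, affineSubst_polyMul _ _ _ d1G, affineSubst_polyMul _ _ _ d0F,
      affineSubst_polyMul _ _ _ d0G, hF, hG, ← sub_eq_zero, ← polyMul_sub] at h1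
    exact congrFun h1 n
  rw [hp, polyMul_mul, polyMul_C] at key
  exact (smul_eq_zero_iff_right (pow_ne_zero _ g.c₀.ne_zero)).1 key

/-- Locality is linear in one argument at a time: pass to the span in the first argument, use
symmetry, and pass to the span again. -/
theorem gammaSpan_gammaLocal {S : Set (EInf W)} (hS : GammaLocal Γ S) :
    GammaLocal Γ (gammaSpan Γ S : Set (EInf W)) := by
  set G : Set (EInf W) := {b | ∃ g ∈ Γ, ∃ a ∈ S, b = subst g a} with hG
  have h1 : ∀ a ∈ G, ∀ b ∈ G, LocalPair Γ a b := by
    rintro _ ⟨g, hg, a, ha, rfl⟩ _ ⟨h, hh, b, hb, rfl⟩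
    exact LocalPair.subst (hS a ha b hb) hg hh
  have h2 : gammaSpan Γ S ≤ localWith Γ G := Submodule.span_le.2 h1
  have h3 : gammaSpan Γ S ≤ localWith Γ (gammaSpan Γ S : Set (EInf W)) :=
    Submodule.span_le.2 fun a ha b hb => (h2 hb a ha : LocalPair Γ b a).symm
  exact fun a ha b hb => h3 ha b hb

theorem affinePolyVar_injective {r : ℕ} (i : Fin r) (g : LinTransf) :
    Injective (affinePolyVar i g) := by
  refine LeftInverse.injective (g := affinePolyVar i g⁻¹) fun p => ?_
  have : (affinePolyVar i g⁻¹).comp (affinePolyVar i g) = AlgHom.id ℂ _ := by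
    have hg : (C (g.c₀ : ℂ) * C ((g.c₀⁻¹ : ℂˣ) : ℂ) : MvPolynomial (Fin r) ℂ) = 1 := by
      rw [← C_mul, ← Units.val_mul, mul_inv_cancel, Units.val_one, C_1]
    refine MvPolynomial.algHom_ext fun k => ?_
    by_cases hk : k = i
    · subst hk
      simp only [AlgHom.comp_apply, AlgHom.id_apply, affinePolyVar, aeval_X, update_self, map_add,
        map_mul, aeval_C, algebraMap_eq, LinTransf.inv_def, map_neg]
      linear_combination (X k - C g.c₁ : MvPolynomial (Fin r) ℂ) * hg
    · simp [affinePolyVar, hk]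
  exact DFunLike.congr_fun this p

/-- `R_g (Y(a(x), x₀) b(x)) = Y(R_g a(x), c₀⁻¹ x₀) R_g b(x)`. -/
theorem subst_YCoeff {a b : EInf W} (hab : QCPair a b) (g : LinTransf) (j : ℤ) :
    (g.c₀ : ℂ) ^ j • subst g (YCoeff a b j) = YCoeff (subst g a) (subst g b) j := by
  obtain ⟨p, hp, hT⟩ := id hab
  -- `q(x₁, x) = p(g(x₁), g(x))` is the polynomial suited to the pair `a(g(x)), b(g(x))`.
  set q := affinePolyVar 0 g (affinePolyVar 1 g p) with hq
  have hq0 : q ≠ 0 := by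
    rw [hq, map_ne_zero_iff _ (affinePolyVar_injective _ _),
      map_ne_zero_iff _ (affinePolyVar_injective _ _)]
    exact hp
  have hprod : ∀ w n, polyMul q (opProd ![subst g a, subst g b]) n w =
      affineSubst 0 g (affineSubst 1 g fun n => polyMul p (opProd ![a, b]) n w) n := by
    intro w n
    have e : (fun n => polyMul p (opProd ![a, b]) n w) =
        polyMul p fun n : Fin 2 → ℤ => cf a (n 0) (cf b (n 1) w) :=
      _root_.funext fun n => polyMul_opProd_pair a b p n w
    rw [e, affineSubst_polyMul _ _ _ (affineDom_opProd a b g w), affineSubst_one_opProd,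
      affineSubst_polyMul _ _ _ (affineDom_opProd_zero a (subst g b) g w), affineSubst_zero_opProd,
      polyMul_opProd_pair]
  have hT' : IsTruncated (polyMul q (opProd ![subst g a, subst g b])) := by
    intro w
    obtain ⟨N, hN⟩ := hT w
    refine ⟨N, fun n ⟨i, hi⟩ => ?_⟩
    rw [hprod]
    refine affineSubst_eq_zero g fun m hm => affineSubst_eq_zero g fun l hl => hN _ ⟨i, ?_⟩
    have h1 : 0 ≤ (m • Pi.single (M := fun _ : Fin 2 => ℤ) 0 1) i := by
      fin_cases i <;> simp [hm]
    have h2 : 0 ≤ (l • Pi.single (M := fun _ : Fin 2 => ℤ) 1 1) i := by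
      fin_cases i <;> simp [hl]
    simp only [Pi.add_apply]
    omega
  have hab' : QCPair (subst g a) (subst g b) := ⟨q, hq0, hT'⟩
  refine cf_ext fun k w => ?_
  let s := LinTransf.scale g.c₀
  -- The series `Y(a(y), c₀ x₀) b(y) w` at `y = g(x)`. It is compared with `Y(a(g(x)), x₀) b(g(x))
  -- w` by uniqueness.
  let D : (Fin 2 → ℤ) → W := affineSubst 1 g (affineSubst 0 s (Yser a b w))
  have d0 : AffineDom 0 s (Yser a b w) := by
    intro n c
    refine (Set.finite_singleton c).subset fun m hm => ?_
    by_contra hne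
    refine hm.1 ?_
    have hne' : m ≠ c := hne
    simp [s, LinTransf.scale, kerZero_zero, hne']
  have d1 : AffineDom 1 g (affineSubst 0 s (Yser a b w)) := affineDom_of_upper g fun n => by
    obtain ⟨N, hN⟩ := (Yser_iterBounded a b w).upper (n 0)
    refine ⟨N - n 1, fun m hm => ?_⟩
    rw [affineSubst_scale_apply, hN _ (by simp) (by simp; omega), smul_zero]
  have hD : ∀ n, D n = (g.c₀ : ℂ) ^ n 0 • cf (subst g (YCoeff a b (n 0))) (n 1) w := by
    intro n
    simp only [D]
    rw [← eta₂ n, affineSubst_one_apply, cf_subst_apply, smul_finsum]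
    refine finsum_congr fun m => ?_
    rw [affineSubst_scale_apply, smul_comm]
    rfl
  have hDb : IterBounded D := by
    obtain ⟨J, hJ⟩ := YCoeff_lower a b
    refine ⟨⟨J, fun n hn => ?_⟩, fun i => ?_⟩
    · rw [hD, hJ _ hn, ← substL_apply, map_zero, cf_zero]; simp
    · obtain ⟨N, hN⟩ := cf_bound (subst g (YCoeff a b i)) w
      exact ⟨N, fun n h0 hn => by rw [hD, h0, hN _ hn, smul_zero]⟩
  -- On polynomials: `p(g(x) + c₀ x₀, g(x)) = p(g(x + x₀), g(x))`.
  have hpoly : affinePolyVar 1 g (affinePolyVar 0 s (shiftPolyVar 0 1 p)) = shiftPolyVar 0 1 q := by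
    have : ((affinePolyVar 1 g).comp (affinePolyVar 0 s)).comp (shiftPolyVar (0 : Fin 2) 1) =
        ((shiftPolyVar (0 : Fin 2) 1).comp (affinePolyVar 0 g)).comp (affinePolyVar 1 g) := by
      refine MvPolynomial.algHom_ext fun i => ?_
      fin_cases i
      · simp [affinePolyVar, shiftPolyVar, s, LinTransf.scale]
        ring
      · simp [affinePolyVar, shiftPolyVar, s, LinTransf.scale]
    exact DFunLike.congr_fun this p
  have heq : polyMul (shiftPolyVar 0 1 q) D =
      polyMul (shiftPolyVar 0 1 q) (Yser (subst g a) (subst g b) w) := by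
    rw [Yser_spec hab' hT' w]
    obtain ⟨N, hN⟩ := hT w
    have e : (fun n => polyMul q (opProd ![subst g a, subst g b]) n w) =
        affineSubst 0 g (affineSubst 1 g fun n => polyMul p (opProd ![a, b]) n w) :=
      _root_.funext (hprod w)
    rw [e, ← affineSubst_shiftInf g hN, ← Yser_spec hab hT w, affineSubst_polyMul _ _ _ d0,
      affineSubst_polyMul _ _ _ d1, hpoly]
  have := congrFun (hDb.eq (Yser_iterBounded _ _ w) (shiftPolyVar_ne_zero (by decide) hq0) heq)
    ![j, k]
  rw [hD] at this
  rw [cf_smul]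
  exact this

theorem subst_nProd {a b : EInf W} (hab : QCPair a b) (g : LinTransf) (n : ℤ) :
    subst g (nProd a b n) =
      ((g.c₀ : ℂ)⁻¹) ^ (-n - 1) • nProd (subst g a) (subst g b) n := by
  rw [nProd, nProd, ← subst_YCoeff hab, smul_smul, ← mul_zpow, inv_mul_cancel₀ g.c₀.ne_zero,
    one_zpow, one_smul]

theorem subst_mem_gammaSpan {S : Set (EInf W)} {g : LinTransf} (hg : g ∈ Γ) {a : EInf W}
    (ha : a ∈ gammaSpan Γ S) : subst g a ∈ gammaSpan Γ S := by
  have : gammaSpan Γ S ≤ (gammaSpan Γ S).comap (substL g) := by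
    refine Submodule.span_le.2 ?_
    rintro _ ⟨h, hh, b, hb, rfl⟩
    refine Submodule.subset_span ⟨g * h, Γ.mul_mem hg hh, b, hb, ?_⟩
    rw [substL_apply, subst_mul]
  exact this ha

/-- By minimality: the elements of the generated space `U` whose image under `g` is again in `U`
form a closed quasi-compatible subspace containing the generators and `1_W`, hence all of `U`.
Closure holds because `g` carries products to multiples of products. -/
theorem subst_mem_generated {S : Set (EInf W)} (hS : GammaLocal Γ S) {g : LinTransf} (hg : g ∈ Γ)
    {a : EInf W} (ha : a ∈ generated (gammaSpan Γ S : Set (EInf W))) :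
    subst g a ∈ generated (gammaSpan Γ S : Set (EInf W)) := by
  set U := generated (gammaSpan Γ S : Set (EInf W)) with hU
  have hl : GammaLocal Γ (U : Set (EInf W)) := generated_gammaLocal (gammaSpan_gammaLocal hS)
  have hmem : U ⊓ U.comap (substL g) ∈ closedContaining (gammaSpan Γ S : Set (EInf W)) := by
    refine ⟨⟨?_, ?_⟩, ?_, ?_⟩
    · exact fun r a ha => hl.quasiCompatible r a fun i => (ha i).1
    · intro a ha b hb n
      refine ⟨nProd_mem_generated _ ha.1 hb.1 n, ?_⟩
      have hab : QCPair a b := LocalPair.qcPair (Γ := Γ) (hl a ha.1 b hb.1)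
      change subst g (nProd a b n) ∈ U
      rw [subst_nProd hab]
      exact U.smul_mem _ (nProd_mem_generated _ ha.2 hb.2 n)
    · exact fun a ha => ⟨subset_generated _ ha, subset_generated _ (subst_mem_gammaSpan hg ha)⟩
    · refine ⟨oneW_mem_generated _, ?_⟩
      change subst g oneW ∈ U
      rw [subst_oneW]
      exact oneW_mem_generated _
  exact ((sInf_le hmem : U ≤ _) ha).2

end Action

/-! ### Iterated vertex operators -/

section Iterated

variable {W : Type*} [AddCommGroup W] [Module ℂ W]

open MvPolynomial Function

theorem IsTruncated.polyMul {r : ℕ} {T : (Fin r → ℤ) → Module.End ℂ W} (hT : IsTruncated T)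
    (p : MvPolynomial (Fin r) ℂ) : IsTruncated (polyMul p T) := by
  rw [isTruncated_iff] at hT ⊢
  intro w i
  have := (hT w i).polyMul p
  convert this using 2 with n
  exact polyMul_apply p T n w

theorem IsTruncated.add {r : ℕ} {T T' : (Fin r → ℤ) → Module.End ℂ W} (hT : IsTruncated T)
    (hT' : IsTruncated T') : IsTruncated (T + T') := by
  intro w
  obtain ⟨N, hN⟩ := hT w
  obtain ⟨N', hN'⟩ := hT' w
  refine ⟨max N N', fun n ⟨i, hi⟩ => ?_⟩
  rw [Pi.add_apply, LinearMap.add_apply, hN n ⟨i, by omega⟩, hN' n ⟨i, by omega⟩, add_zero]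

theorem IsTruncated.smul {r : ℕ} {T : (Fin r → ℤ) → Module.End ℂ W} (hT : IsTruncated T)
    (c : ℂ) : IsTruncated (c • T) := by
  intro w
  obtain ⟨N, hN⟩ := hT w
  exact ⟨N, fun n hn => by rw [Pi.smul_apply, LinearMap.smul_apply, hN n hn, smul_zero]⟩

theorem isTruncated_polyMul_of_dvd {r : ℕ} {T : (Fin r → ℤ) → Module.End ℂ W}
    {p q : MvPolynomial (Fin r) ℂ} (hpq : p ∣ q) (hT : IsTruncated (polyMul p T)) :
    IsTruncated (polyMul q T) := by
  obtain ⟨c, rfl⟩ := hpq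
  rw [mul_comm, polyMul_mul]
  exact hT.polyMul c

theorem opProd_pair_apply (a b : EInf W) (n : Fin 2 → ℤ) :
    opProd ![a, b] n = cf a (n 0) * cf b (n 1) := by
  simp [opProd]

/-- Uniqueness of `Y(a(x), x₀) b(x)`. -/
theorem Yser_unique {a b : EInf W} {p : MvPolynomial (Fin 2) ℂ} (hp : p ≠ 0)
    (hT : IsTruncated (polyMul p (opProd ![a, b]))) {w : W} {D : (Fin 2 → ℤ) → W}
    (hD : IterBounded D) (h : polyMul (shiftPolyVar 0 1 p) D =
      shiftInf 0 1 fun n => polyMul p (opProd ![a, b]) n w) : Yser a b w = D :=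
  (Yser_iterBounded a b w).eq hD (shiftPolyVar_ne_zero (by decide) hp)
    ((Yser_spec ⟨p, hp, hT⟩ hT w).trans h.symm)

theorem IterBounded.add {D E : (Fin 2 → ℤ) → W} (hD : IterBounded D) (hE : IterBounded E) :
    IterBounded (D + E) := by
  obtain ⟨J, hJ⟩ := hD.lower
  obtain ⟨K, hK⟩ := hE.lower
  refine ⟨⟨min J K, fun n hn => ?_⟩, fun i => ?_⟩
  · rw [Pi.add_apply, hJ n (by omega), hK n (by omega), add_zero]
  · obtain ⟨N, hN⟩ := hD.upper i
    obtain ⟨N', hN'⟩ := hE.upper i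
    exact ⟨max N N', fun n h0 hn => by
      rw [Pi.add_apply, hN n h0 (by omega), hN' n h0 (by omega), add_zero]⟩

theorem IterBounded.smul {D : (Fin 2 → ℤ) → W} (hD : IterBounded D) (c : ℂ) :
    IterBounded (c • D) := by
  obtain ⟨J, hJ⟩ := hD.lower
  refine ⟨⟨J, fun n hn => ?_⟩, fun i => ?_⟩
  · rw [Pi.smul_apply, hJ n hn, smul_zero]
  · obtain ⟨N, hN⟩ := hD.upper i
    exact ⟨N, fun n h0 hn => by rw [Pi.smul_apply, hN n h0 hn, smul_zero]⟩

/-! ### Bilinearity of the products -/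

theorem YCoeff_eq_of_Yser {a b e : EInf W} {j : ℤ}
    (h : ∀ w k, Yser a b w ![j, k] = cf e k w) : YCoeff a b j = e :=
  cf_ext fun k w => h w k

/-- A linear combination of pairs whose operator products add up. -/
theorem YCoeff_add_of_opProd {a b a' b' a'' b'' : EInf W} (h : QCPair a b) (h' : QCPair a' b')
    (hsum : opProd ![a'', b''] = opProd ![a, b] + opProd ![a', b']) (j : ℤ) :
    YCoeff a'' b'' j = YCoeff a b j + YCoeff a' b' j := by
  obtain ⟨p, hp, hT⟩ := id h
  obtain ⟨p', hp', hT'⟩ := id h'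
  -- The product `p * p'` is a common polynomial for both pairs.
  have t1 := isTruncated_polyMul_of_dvd (dvd_mul_right p p') hT
  have t2 := isTruncated_polyMul_of_dvd (dvd_mul_left p' p) hT'
  have t3 : IsTruncated (polyMul (p * p') (opProd ![a'', b''])) := by
    rw [hsum, polyMul_add]; exact t1.add t2
  refine YCoeff_eq_of_Yser fun w k => ?_
  rw [Yser_unique (mul_ne_zero hp hp') t3 ((Yser_iterBounded a b w).add (Yser_iterBounded a' b' w))]
  · rw [cf_add]; rfl
  · rw [polyMul_add, Yser_spec h t1, Yser_spec h' t2]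
    refine (kerSubst_add (t1.shiftInfDom w) (t2.shiftInfDom w)).symm.trans ?_
    rw [hsum, polyMul_add]
    rfl

theorem YCoeff_smul_of_opProd {a b a' b' : EInf W} (h : QCPair a b) (c : ℂ)
    (hsum : opProd ![a', b'] = c • opProd ![a, b]) (j : ℤ) :
    YCoeff a' b' j = c • YCoeff a b j := by
  obtain ⟨p, hp, hT⟩ := id h
  have t3 : IsTruncated (polyMul p (opProd ![a', b'])) := by
    rw [hsum, polyMul_smul]; exact hT.smul c
  refine YCoeff_eq_of_Yser fun w k => ?_
  rw [Yser_unique hp t3 ((Yser_iterBounded a b w).smul c)]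
  · rw [cf_smul]; rfl
  · rw [polyMul_smul, Yser_spec h hT]
    refine (kerSubst_smul c).symm.trans ?_
    rw [hsum, polyMul_smul]
    rfl

theorem YCoeff_add_left {a a' b : EInf W} (h : QCPair a b) (h' : QCPair a' b) (j : ℤ) :
    YCoeff (a + a') b j = YCoeff a b j + YCoeff a' b j :=
  YCoeff_add_of_opProd h h' (by
    funext n; simp only [opProd_pair_apply, cf_add, add_mul, Pi.add_apply]) j

theorem YCoeff_add_right {a b b' : EInf W} (h : QCPair a b) (h' : QCPair a b') (j : ℤ) :
    YCoeff a (b + b') j = YCoeff a b j + YCoeff a b' j :=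
  YCoeff_add_of_opProd h h' (by
    funext n; simp only [opProd_pair_apply, cf_add, mul_add, Pi.add_apply]) j

theorem YCoeff_smul_left {a b : EInf W} (h : QCPair a b) (c : ℂ) (j : ℤ) :
    YCoeff (c • a) b j = c • YCoeff a b j :=
  YCoeff_smul_of_opProd h c (by
    funext n; simp only [opProd_pair_apply, cf_smul, smul_mul_assoc, Pi.smul_apply]) j

theorem YCoeff_smul_right {a b : EInf W} (h : QCPair a b) (c : ℂ) (j : ℤ) :
    YCoeff a (c • b) j = c • YCoeff a b j :=
  YCoeff_smul_of_opProd h c (by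
    funext n; simp only [opProd_pair_apply, cf_smul, mul_smul_comm, Pi.smul_apply]) j

theorem YCoeff_eq_zero_of_opProd {a b : EInf W} (h : opProd ![a, b] = 0) (j : ℤ) :
    YCoeff a b j = 0 := by
  have hq : QCPair a b := ⟨1, one_ne_zero, by rw [h, polyMul_zero]; exact fun w => ⟨0, fun _ _ => rfl⟩⟩
  have := YCoeff_smul_of_opProd (a' := a) (b' := b) hq 0 (by rw [h, smul_zero]) j
  rwa [zero_smul] at this

theorem opProd_pair_eq_zero {a b : EInf W} (h : a = 0 ∨ b = 0) : opProd ![a, b] = 0 := by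
  funext n
  rw [opProd_pair_apply]
  rcases h with rfl | rfl <;> simp

/-! ### Families of pairs indexed by the exponent of a further variable -/

section Row

variable {r : ℕ} {ρ i j : Fin r}

theorem shiftPolyVar_rename_pair (hij : i ≠ j) (p : MvPolynomial (Fin 2) ℂ) :
    shiftPolyVar i j (rename ![i, j] p) = rename ![i, j] (shiftPolyVar 0 1 p) := by
  have : (shiftPolyVar i j).comp (rename ![i, j]) = (rename ![i, j]).comp (shiftPolyVar 0 1) := by
    refine MvPolynomial.algHom_ext fun k => ?_
    fin_cases k <;> simp [shiftPolyVar, hij.symm]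
  exact DFunLike.congr_fun this p

theorem extend_pair_of_ne {k : Fin r} (hi : k ≠ i) (hj : k ≠ j) (l : Fin 2 → ℤ) (n : Fin r → ℤ) :
    extend ![i, j] l n k = n k := by
  refine extend_apply' _ _ _ ?_
  rintro ⟨t, rfl⟩
  fin_cases t
  · exact hi rfl
  · exact hj rfl

theorem extend_pair_zero (hij : i ≠ j) (l : Fin 2 → ℤ) (n : Fin r → ℤ) :
    extend ![i, j] l n i = l 0 := (pair_injective hij).extend_apply l n 0

theorem extend_pair_one (hij : i ≠ j) (l : Fin 2 → ℤ) (n : Fin r → ℤ) :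
    extend ![i, j] l n j = l 1 := (pair_injective hij).extend_apply l n 1

/-- The part of a series with powers of `x_ρ` at most `c`. -/
def cut {M : Type*} [Zero M] (ρ : Fin r) (c : ℤ) (F : (Fin r → ℤ) → M) : (Fin r → ℤ) → M :=
  fun n => if n ρ ≤ c then F n else 0

theorem slice_cut (hi : ρ ≠ i) (hj : ρ ≠ j) (c : ℤ) (F : (Fin r → ℤ) → W) (n : Fin r → ℤ) :
    slice ![i, j] (cut ρ c F) n = if n ρ ≤ c then slice ![i, j] F n else 0 := by
  funext k
  simp only [slice, cut, extend_pair_of_ne hi hj]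
  split_ifs <;> rfl

theorem cut_of_le {c : ℤ} (F : (Fin r → ℤ) → W) {n : Fin r → ℤ} (h : n ρ ≤ c) :
    cut ρ c F n = F n := if_pos h

theorem polyMul_cut_of_le {c : ℤ} (p : MvPolynomial (Fin r) ℂ) (F : (Fin r → ℤ) → W)
    {n : Fin r → ℤ} (h : n ρ ≤ c) : polyMul p (cut ρ c F) n = polyMul p F n :=
  polyMul_congr fun _ hm => cut_of_le F ((hm ρ).trans h)

theorem polyMul_rename_cut (hij : i ≠ j) (hi : ρ ≠ i) (hj : ρ ≠ j) (c : ℤ)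
    (p : MvPolynomial (Fin 2) ℂ) (F : (Fin r → ℤ) → W) :
    polyMul (rename ![i, j] p) (cut ρ c F) = cut ρ c (polyMul (rename ![i, j] p) F) := by
  funext n
  have hinj := pair_injective hij
  rw [polyMul_rename hinj, slice_cut hi hj, cut, polyMul_rename hinj]
  split_ifs
  · rfl
  · simp

theorem shiftInf_congr (hi : ρ ≠ i) (hj : ρ ≠ j) {F G : (Fin r → ℤ) → W} {n : Fin r → ℤ}
    (h : ∀ m : Fin r → ℤ, m ρ = n ρ → F m = G m) : shiftInf i j F n = shiftInf i j G n := by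
  rw [shiftInf_apply, shiftInf_apply]
  refine finsum_congr fun m => ?_
  rw [h]
  simp [hi, hj]

/-- The series `Y(α_t(x), x₀) β_t(x)` for sequences `α_t, β_t`, with `t` the exponent of `x_ρ`. -/
def YRow (ρ i j : Fin r) (α β : ℤ → EInf W) (w : W) : (Fin r → ℤ) → W :=
  fun n => cf (YCoeff (α (n ρ)) (β (n ρ)) (n i)) (n j) w

/-- The series `α_t(x₁) β_t(x)`, with `t` the exponent of `x_ρ`. -/
def opRow (ρ i j : Fin r) (α β : ℤ → EInf W) (w : W) : (Fin r → ℤ) → W :=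
  fun n => cf (α (n ρ)) (n i) (cf (β (n ρ)) (n j) w)

theorem slice_YRow (hij : i ≠ j) (hi : ρ ≠ i) (hj : ρ ≠ j) (α β : ℤ → EInf W) (w : W)
    (n : Fin r → ℤ) : slice ![i, j] (YRow ρ i j α β w) n = Yser (α (n ρ)) (β (n ρ)) w := by
  funext k
  simp only [slice, YRow, Yser, extend_pair_of_ne hi hj, extend_pair_zero hij,
    extend_pair_one hij]

theorem slice_opRow (hij : i ≠ j) (hi : ρ ≠ i) (hj : ρ ≠ j) (α β : ℤ → EInf W) (w : W)
    (n : Fin r → ℤ) : slice ![i, j] (opRow ρ i j α β w) n =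
      fun k => opProd ![α (n ρ), β (n ρ)] k w := by
  funext k
  simp only [slice, opRow, opProd_pair_apply, extend_pair_of_ne hi hj, extend_pair_zero hij,
    extend_pair_one hij, Module.End.mul_apply]

theorem sliceBounded_YRow (hi : ρ ≠ i) (hj : ρ ≠ j) (hij : i ≠ j) (α β : ℤ → EInf W) (w : W) :
    SliceBounded i j (YRow ρ i j α β w) := by
  refine ⟨fun n => ?_, fun n => ?_⟩
  · obtain ⟨J, hJ⟩ := YCoeff_lower (α (n ρ)) (β (n ρ))
    refine ⟨J, fun m hm h => ?_⟩
    rw [YRow, hm ρ hi hj, hJ _ h]; simp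
  · obtain ⟨N, hN⟩ := cf_bound (YCoeff (α (n ρ)) (β (n ρ)) (n i)) w
    refine ⟨N, fun m hm h => ?_⟩
    rw [YRow, hm ρ hj, hm i hij, hN _ h]

/-- If `∑_t Q_t(x₁, x) α_t(x₁) β_t(x)` has powers of `x₁` and `x` bounded above, then
`∑_t Q_t(x₀ + x, x) Y(α_t(x), x₀) β_t(x)` is obtained from it by `x₁ = x + x₀`. -/
theorem polyMul_YRow (hij : i ≠ j) (hi : ρ ≠ i) (hj : ρ ≠ j)
    {α β : ℤ → EInf W} (hqc : ∀ t, QCPair (α t) (β t))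
    {J : ℤ} (hJ : ∀ t < J, α t = 0 ∨ β t = 0) (w : W) (Q : MvPolynomial (Fin r) ℂ)
    (hQ : ∀ c : ℤ, ∃ N : ℤ, ∀ n : Fin r → ℤ, n ρ = c → (N < n i ∨ N < n j) →
      polyMul Q (opRow ρ i j α β w) n = 0) :
    polyMul (shiftPolyVar i j Q) (YRow ρ i j α β w) =
      shiftInf i j (polyMul Q (opRow ρ i j α β w)) := by
  funext n₀
  set c := n₀ ρ with hc
  set H := opRow ρ i j α β w with hH
  set G := YRow ρ i j α β w with hG
  have hinj := pair_injective hij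
  choose p hp hpT using hqc
  -- The polynomials `p t` vary with `t`, and no common one need exist. But the coefficient at `n₀`
  -- involves only rows `t ≤ c`, because polynomials have nonnegative exponents, and rows below `J`
  -- vanish. A finite product therefore suffices.
  set h := ∏ t ∈ Finset.Icc J c, p t with hh
  have hh0 : h ≠ 0 := Finset.prod_ne_zero_iff.2 fun t _ => hp t
  have hT : ∀ t ≤ c, IsTruncated (polyMul h (opProd ![α t, β t])) := by
    intro t ht
    by_cases htJ : t < J
    · rw [opProd_pair_eq_zero (hJ t htJ), polyMul_zero]
      exact fun w => ⟨0, fun _ _ => rfl⟩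
    · exact isTruncated_polyMul_of_dvd
        (Finset.dvd_prod_of_mem p (Finset.mem_Icc.2 ⟨not_lt.1 htJ, ht⟩)) (hpT t)
  have hqc : ∀ t, QCPair (α t) (β t) := fun t => ⟨p t, hp t, hpT t⟩
  set hr := rename ![i, j] h with hhr
  -- Rows above `c`, to which `h` is not adapted, are discarded; they do not affect the coefficients
  -- under consideration.
  set H₂ := cut ρ c (polyMul hr H) with hH₂
  have sl : ∀ n : Fin r → ℤ, slice ![i, j] (polyMul hr H) n =
      fun k => polyMul h (opProd ![α (n ρ), β (n ρ)]) k w := by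
    intro n
    rw [slice_polyMul hinj, hH, slice_opRow hij hi hj]
    exact _root_.funext fun k => (polyMul_apply _ _ _ _).symm
  have dH₂ : ShiftInfDom i j H₂ := shiftInfDom_of_slice hij fun n => by
    rw [hH₂, slice_cut hi hj]
    split_ifs with hle
    · rw [sl]; exact (hT _ hle).shiftInfDom w
    · intro _ _; simp
  have sH₂ : shiftInf i j H₂ = cut ρ c (polyMul (rename ![i, j] (shiftPolyVar 0 1 h)) G) := by
    funext n
    rw [← slice_self hinj (shiftInf i j H₂), slice_shiftInf hij, hH₂, slice_cut hi hj, cut]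
    split_ifs with hle
    · rw [sl, ← Yser_spec (hqc _) (hT _ hle), polyMul_rename hinj, hG, slice_YRow hij hi hj]
    · simp [shiftInf_apply]
  set F := cut ρ c (polyMul Q H) with hF
  have bF : ∀ n : Fin r → ℤ, ∃ N : ℤ, ∀ m : Fin r → ℤ, m ρ = n ρ → (N < m i ∨ N < m j) →
      F m = 0 := by
    intro n
    obtain ⟨N, hN⟩ := hQ (n ρ)
    refine ⟨N, fun m hm h => ?_⟩
    rw [hF, cut]
    split_ifs
    · exact hN m hm h
    · rfl
  have dF : ShiftInfDom i j F := by
    intro n a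
    obtain ⟨N, hN⟩ := bF n
    refine (Set.finite_Icc (n j - N) (N - n i)).subset fun m hm => ?_
    by_contra hmem
    refine hm.2 (hN _ (by simp [hi, hj]) ?_)
    rw [Set.mem_Icc, not_and_or] at hmem
    simp only [Pi.add_apply, Pi.smul_apply, Pi.sub_apply, Pi.single_eq_same, Pi.single_eq_of_ne hij,
      Pi.single_eq_of_ne hij.symm, smul_eq_mul]
    omega
  have bS : SliceBounded i j (shiftInf i j F) := by
    refine ⟨fun n => ⟨0, fun m _ hm => shiftInf_of_neg hm⟩, fun n => ?_⟩
    obtain ⟨N, hN⟩ := bF n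
    refine ⟨2 * N - n i, fun m hm hlt => ?_⟩
    rw [shiftInf_apply]
    refine finsum_eq_zero_of_forall_eq_zero fun l => ?_
    rw [hN, smul_zero]
    · simp [hi, hj, hm ρ hj]
    · simp only [Pi.add_apply, Pi.smul_apply, Pi.sub_apply, Pi.single_eq_same,
        Pi.single_eq_of_ne hij, Pi.single_eq_of_ne hij.symm, smul_eq_mul]
      rw [hm i hij]
      omega
  -- Both sides are multiplied by `h(x_i + x_j, x_j)`, compared on rows up to `c`, and this factor
  -- is cancelled.
  have final : polyMul (shiftPolyVar i j Q) G n₀ = shiftInf i j F n₀ := by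
    refine ((sliceBounded_YRow hi hj hij α β w).polyMul _).eq hij bS
      (shiftPolyVar_ne_zero (i := (0 : Fin 2)) (j := 1) (by decide) hh0) n₀ fun k => ?_
    have hrow : (extend ![i, j] k n₀) ρ ≤ c := (extend_pair_of_ne hi hj k n₀).le
    rw [slice, slice]
    set n := extend ![i, j] k n₀
    have e1 : polyMul (rename ![i, j] (shiftPolyVar 0 1 h)) (shiftInf i j F) =
        shiftInf i j (polyMul hr F) := by
      rw [shiftInf_polyMul hij _ dF, hhr, shiftPolyVar_rename_pair hij]
    have e2 : shiftInf i j (polyMul hr F) n = shiftInf i j (polyMul Q H₂) n := by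
      refine shiftInf_congr hi hj fun m hm => ?_
      rw [hF, hhr, polyMul_rename_cut hij hi hj, cut_of_le _ (hm.le.trans hrow), hH₂,
        polyMul_cut_of_le _ _ (hm.le.trans hrow), polyMul_comm]
    rw [e1, e2, shiftInf_polyMul hij _ dH₂, sH₂, polyMul_cut_of_le _ _ hrow, polyMul_comm]
  rw [final]
  exact shiftInf_congr hi hj fun m hm => cut_of_le _ hm.le

/-- The substitution `x_i = x_j + x_i` in a product one of whose factors makes each slice
truncated. -/
theorem shiftInf_polyMul_slice (hij : i ≠ j) {F Y : (Fin r → ℤ) → W} {p : MvPolynomial (Fin 2) ℂ}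
    (hF : ∀ n, ShiftInfDom 0 1 (polyMul p (slice ![i, j] F n)))
    (hY : ∀ n, shiftInf 0 1 (polyMul p (slice ![i, j] F n)) =
      polyMul (shiftPolyVar 0 1 p) (slice ![i, j] Y n)) (P : MvPolynomial (Fin r) ℂ) :
    polyMul (shiftPolyVar i j (P * rename ![i, j] p)) Y =
      shiftInf i j (polyMul (P * rename ![i, j] p) F) := by
  have hinj := pair_injective hij
  have d : ShiftInfDom i j (polyMul (rename ![i, j] p) F) := shiftInfDom_of_slice hij fun n => by
    rw [slice_polyMul hinj]; exact hF n
  have e : shiftInf i j (polyMul (rename ![i, j] p) F) =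
      polyMul (rename ![i, j] (shiftPolyVar 0 1 p)) Y := by
    funext n
    rw [← slice_self hinj (shiftInf i j _), slice_shiftInf hij, slice_polyMul hinj, hY,
      polyMul_rename hinj]
  rw [polyMul_mul, shiftInf_polyMul hij _ d, e, map_mul, polyMul_mul, shiftPolyVar_rename_pair hij]

end Row

end Iterated

/-! ### Cancellation of polynomials for series in three variables -/

section Lex

variable {W : Type*} [AddCommGroup W] [Module ℂ W]

open MvPolynomial Function

/-- A series in one variable is regarded as a series in two variables concentrated in exponent `0`
of the first, where cancellation is known. -/
theorem eq_zero_of_polyMul_eq_zero {u : MvPolynomial (Fin 1) ℂ} (hu : u ≠ 0)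
    {f : (Fin 1 → ℤ) → W} (hf : UpperBounded 0 f) (h : polyMul u f = 0) : f = 0 := by
  have hinj : Injective ![(1 : Fin 2)] := injective_of_subsingleton _
  let E : (Fin 2 → ℤ) → W := fun k => if k 0 = 0 then f fun _ => k 1 else 0
  have hE : IterBounded E := by
    refine ⟨⟨0, fun n hn => if_neg hn.ne⟩, fun i => ?_⟩
    obtain ⟨N, hN⟩ := hf
    refine ⟨N, fun n _ hn => ?_⟩
    simp only [E]
    rw [hN _ hn, ite_self]
  have hs : ∀ k, slice ![(1 : Fin 2)] E k = if k 0 = 0 then f else 0 := by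
    intro k
    funext t
    have e0 : extend ![(1 : Fin 2)] t k 0 = k 0 := by
      refine extend_apply' _ _ _ ?_
      rintro ⟨s, hs⟩
      fin_cases s
      exact absurd hs (by decide)
    have e1 : extend ![(1 : Fin 2)] t k 1 = t 0 := hinj.extend_apply t k 0
    simp only [slice, E, e0, e1]
    split_ifs
    · congr 1
      funext s
      fin_cases s
      rfl
    · rfl
  have hz : E = 0 := by
    refine hE.eq_zero (q := rename ![(1 : Fin 2)] u) ?_ ?_
    · exact (map_ne_zero_iff _ (rename_injective _ hinj)).2 hu
    · funext k
      rw [polyMul_rename hinj, hs]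
      split_ifs
      · rw [h]; rfl
      · rw [polyMul_zero]; rfl
  have h0 := hs 0
  rw [hz] at h0
  rw [if_pos (show (0 : Fin 2 → ℤ) 0 = 0 from rfl)] at h0
  exact h0.symm

/-- Series with powers of `x_ρ` bounded below, for each power of `x_ρ` powers of `x_i` bounded
below, and powers of `x_j` bounded above when all other exponents are fixed. -/
structure LexBounded {r : ℕ} (ρ i j : Fin r) (D : (Fin r → ℤ) → W) : Prop where
  lower : ∃ J : ℤ, ∀ n, n ρ < J → D n = 0
  row : ∀ c : ℤ, ∃ I : ℤ, ∀ n, n ρ = c → n i < I → D n = 0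
  upper : ∀ n : Fin r → ℤ, ∃ N : ℤ, ∀ m : Fin r → ℤ, (∀ k, k ≠ j → m k = n k) → N < m j → D m = 0

section

variable {r : ℕ} {ρ i j : Fin r} {D E : (Fin r → ℤ) → W}

theorem LexBounded.add (hD : LexBounded ρ i j D) (hE : LexBounded ρ i j E) :
    LexBounded ρ i j (D + E) := by
  refine ⟨?_, fun c => ?_, fun n => ?_⟩
  · obtain ⟨J, hJ⟩ := hD.lower
    obtain ⟨K, hK⟩ := hE.lower
    exact ⟨min J K, fun n hn => by
      rw [Pi.add_apply, hJ n (by omega), hK n (by omega), add_zero]⟩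
  · obtain ⟨J, hJ⟩ := hD.row c
    obtain ⟨K, hK⟩ := hE.row c
    exact ⟨min J K, fun n h hn => by
      rw [Pi.add_apply, hJ n h (by omega), hK n h (by omega), add_zero]⟩
  · obtain ⟨J, hJ⟩ := hD.upper n
    obtain ⟨K, hK⟩ := hE.upper n
    exact ⟨max J K, fun m h hm => by
      rw [Pi.add_apply, hJ m h (by omega), hK m h (by omega), add_zero]⟩

theorem LexBounded.smul (c : ℂ) (hD : LexBounded ρ i j D) : LexBounded ρ i j (c • D) := by
  refine ⟨?_, fun t => ?_, fun n => ?_⟩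
  · obtain ⟨J, hJ⟩ := hD.lower
    exact ⟨J, fun n hn => by rw [Pi.smul_apply, hJ n hn, smul_zero]⟩
  · obtain ⟨J, hJ⟩ := hD.row t
    exact ⟨J, fun n h hn => by rw [Pi.smul_apply, hJ n h hn, smul_zero]⟩
  · obtain ⟨J, hJ⟩ := hD.upper n
    exact ⟨J, fun m h hm => by rw [Pi.smul_apply, hJ m h hm, smul_zero]⟩

theorem LexBounded.X (k : Fin r) (hD : LexBounded ρ i j D) :
    LexBounded ρ i j (polyMul (X k) D) := by
  refine ⟨?_, fun t => ?_, fun n => ?_⟩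
  · obtain ⟨J, hJ⟩ := hD.lower
    refine ⟨J, fun n hn => ?_⟩
    rw [polyMul_X]
    exact hJ _ ((sub_single_apply_le n k ρ).2.trans_lt hn)
  · obtain ⟨J, hJ⟩ := hD.row (t - (Pi.single k 1 : Fin r → ℤ) ρ)
    refine ⟨J, fun n h hn => ?_⟩
    rw [polyMul_X]
    exact hJ _ (by rw [Pi.sub_apply, h]) ((sub_single_apply_le n k i).2.trans_lt hn)
  · obtain ⟨J, hJ⟩ := hD.upper (n - Pi.single k 1)
    refine ⟨J + 1, fun m hm h => ?_⟩
    rw [polyMul_X]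
    refine hJ _ (fun l h1 => ?_) ?_
    · rw [Pi.sub_apply, Pi.sub_apply, hm l h1]
    · have := (sub_single_apply_le m k j).1
      omega

theorem LexBounded.polyMul (hD : LexBounded ρ i j D) (p : MvPolynomial (Fin r) ℂ) :
    LexBounded ρ i j (polyMul p D) :=
  polyMul_induction p (fun _ _ => LexBounded.add) (fun c _ => LexBounded.smul c)
    (fun k _ => LexBounded.X k) hD

/-- Cancellation of a polynomial that does not vanish identically on `x_ρ = x_i = 0`, over a set
of exponents of `x_ρ` and `x_i` closed downwards. -/
theorem LexBounded.eq_zero_on (hρ : ρ ≠ j) (hi : i ≠ j) (hD : LexBounded ρ i j D)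
    {u : MvPolynomial (Fin 1) ℂ} (hu : u ≠ 0) {R R' : MvPolynomial (Fin r) ℂ} {Z : ℤ → ℤ → Prop}
    (hZ : ∀ s t s' t', s' ≤ s → t' ≤ t → Z s t → Z s' t')
    (h : ∀ n, Z (n ρ) (n i) → AtInfinity.polyMul
      (rename ![j] u + MvPolynomial.X ρ * R + MvPolynomial.X i * R') D n = 0)
    (n : Fin r → ℤ) (hn : Z (n ρ) (n i)) : D n = 0 := by
  have hinj : Injective ![j] := injective_of_subsingleton _
  have ext_ne : ∀ (t : Fin 1 → ℤ) (n : Fin r → ℤ) (k : Fin r), k ≠ j →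
      extend ![j] t n k = n k := fun t n k hk => by
    refine extend_apply' _ _ _ ?_
    rintro ⟨s, rfl⟩
    fin_cases s
    exact hk rfl
  -- If the lexicographically smaller coefficients in `Z` vanish, the multiples of `x_ρ` and `x_i`
  -- contribute nothing. Then `u(x_j)` alone kills the slice in `x_j`, which is bounded above and so
  -- vanishes.
  have step : ∀ n : Fin r → ℤ, Z (n ρ) (n i) → (∀ m : Fin r → ℤ, Z (m ρ) (m i) →
      (m ρ < n ρ ∨ m ρ = n ρ ∧ m i < n i) → D m = 0) → D n = 0 := by
    intro n hn ih
    have key : ∀ m : Fin r → ℤ, m ρ = n ρ → m i = n i → AtInfinity.polyMul (rename ![j] u) D m = 0 := by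
      intro m h1 h2
      have hm := h m (by rwa [h1, h2])
      have z1 : AtInfinity.polyMul (MvPolynomial.X ρ * R) D m = 0 := by
        rw [polyMul_mul, polyMul_X, polyMul_congr (G := 0), polyMul_zero, Pi.zero_apply]
        intro k hk
        have a1 := hk ρ
        have a2 := (hk i).trans (sub_single_apply_le m ρ i).2
        simp only [Pi.sub_apply, Pi.single_eq_same] at a1
        exact ih k (hZ _ _ _ _ (by omega) (by omega) hn) (Or.inl (by omega))
      have z2 : AtInfinity.polyMul (MvPolynomial.X i * R') D m = 0 := by
        rw [polyMul_mul, polyMul_X, polyMul_congr (G := 0), polyMul_zero, Pi.zero_apply]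
        intro k hk
        have a1 := hk i
        have a2 := (hk ρ).trans (sub_single_apply_le m i ρ).2
        simp only [Pi.sub_apply, Pi.single_eq_same] at a1
        exact ih k (hZ _ _ _ _ (by omega) (by omega) hn) (by omega)
      rwa [polyMul_add_left, polyMul_add_left, Pi.add_apply, Pi.add_apply, z1, z2, add_zero,
        add_zero] at hm
    have hz : slice ![j] D n = 0 := by
      refine eq_zero_of_polyMul_eq_zero hu ?_ ?_
      · obtain ⟨N, hN⟩ := hD.upper n
        refine ⟨N, fun t ht => hN _ (ext_ne t n) ?_⟩
        have : extend ![j] t n j = t 0 := hinj.extend_apply t n 0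
        rwa [this]
      · rw [← slice_polyMul hinj]
        funext t
        exact key _ (ext_ne t n ρ hρ) (ext_ne t n i hi)
    rw [← slice_self hinj D n, hz]
    rfl
  obtain ⟨J, hJ⟩ := hD.lower
  choose I hI using hD.row
  -- Double induction, on the exponent of `x_ρ` and then on that of `x_i` within the row; the
  -- starting point in `x_i` may depend on the row.
  have outer : ∀ (a : ℕ) (n : Fin r → ℤ), n ρ < J + a → Z (n ρ) (n i) → D n = 0 := by
    intro a
    induction a with
    | zero => intro n hn _; exact hJ n (by simpa using hn)
    | succ a iha =>
      have inner : ∀ (b : ℕ) (n : Fin r → ℤ), n ρ = J + a → n i < I (J + a) + b →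
          Z (n ρ) (n i) → D n = 0 := by
        intro b
        induction b with
        | zero => intro n h1 h2 _; exact hI _ n h1 (by simpa using h2)
        | succ b ihb =>
          intro n h1 h2 hZn
          refine step n hZn fun m hZm hlt => ?_
          rcases hlt with hlt | ⟨e, hlt⟩
          · exact iha m (by omega) hZm
          · exact ihb m (by omega) (by push_cast at h2; omega) hZm
      intro n hn hZn
      by_cases hlt : n ρ < J + a
      · exact iha n hlt hZn
      · exact inner ((n i - I (J + a)).toNat + 1) n (by push_cast at hn; omega)
          (by push_cast; omega) hZn
  exact outer ((n ρ - J).toNat + 1) n (by push_cast; omega) hn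

/-- Two series bounded in different orders coincide if a polynomial multiple of each is the same
series in nonnegative powers of `x_ρ` and `x_i`. -/
theorem LexBounded.eq_of_polyMul (hρ : ρ ≠ j) (hi : i ≠ j) (hD : LexBounded ρ i j D)
    (hE : LexBounded i ρ j E) {u : MvPolynomial (Fin 1) ℂ} (hu : u ≠ 0)
    {R R' : MvPolynomial (Fin r) ℂ}
    (h : AtInfinity.polyMul (rename ![j] u + MvPolynomial.X ρ * R + MvPolynomial.X i * R') D =
      AtInfinity.polyMul (rename ![j] u + MvPolynomial.X ρ * R + MvPolynomial.X i * R') E)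
    (h0 : ∀ n, n ρ < 0 ∨ n i < 0 →
      AtInfinity.polyMul (rename ![j] u + MvPolynomial.X ρ * R + MvPolynomial.X i * R') D n = 0) :
    D = E := by
  -- The common multiple has only nonnegative powers of `x_ρ` and `x_i`, and cancellation on the
  -- complementary region passes this to `D` and `E`. The opposite orders of boundedness then no
  -- longer matter, and `D - E` admits cancellation.
  have hD0 : ∀ n, n ρ < 0 ∨ n i < 0 → D n = 0 :=
    hD.eq_zero_on hρ hi hu (Z := fun s t => s < 0 ∨ t < 0) (by omega) h0
  have hE0 : ∀ n, n i < 0 ∨ n ρ < 0 → E n = 0 :=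
    hE.eq_zero_on hi hρ hu (Z := fun s t => s < 0 ∨ t < 0) (by omega) fun n hn => by
      rw [add_right_comm, ← h]
      exact h0 n hn.symm
  have hDE : LexBounded ρ i j (D - E) := by
    refine ⟨⟨0, fun n hn => ?_⟩, fun c => ⟨0, fun n _ hn => ?_⟩, fun n => ?_⟩
    · rw [Pi.sub_apply, hD0 n (Or.inl hn), hE0 n (Or.inr hn), sub_zero]
    · rw [Pi.sub_apply, hD0 n (Or.inr hn), hE0 n (Or.inl hn), sub_zero]
    · obtain ⟨J, hJ⟩ := hD.upper n
      obtain ⟨K, hK⟩ := hE.upper n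
      exact ⟨max J K, fun m h hm => by
        rw [Pi.sub_apply, hJ m h (by omega), hK m h (by omega), sub_zero]⟩
  refine sub_eq_zero.1 (_root_.funext fun n => ?_)
  refine hDE.eq_zero_on hρ hi hu (Z := fun _ _ => True) (fun _ _ _ _ _ _ _ => trivial)
    (R := R) (R' := R') (fun n _ => ?_) n trivial
  rw [polyMul_sub, h, sub_self]
  rfl

theorem polyMul_X_injective (i : Fin r) : Injective (AtInfinity.polyMul (M := W) (MvPolynomial.X i)) := by
  intro F G h
  funext n
  have := congrFun h (n + Pi.single i 1)
  rwa [polyMul_X, polyMul_X, add_sub_cancel_right] at this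

theorem polyMul_X_pow_injective (i : Fin r) (m : ℕ) :
    Injective (AtInfinity.polyMul (M := W) (MvPolynomial.X i ^ m)) := by
  induction m with
  | zero => intro F G h; simpa using h
  | succ m ih =>
    intro F G h
    simp only [pow_succ, polyMul_mul] at h
    exact polyMul_X_injective i (ih h)

end

/-! ### Factors of products of polynomials `x₁ - g(x₂)` -/

/-- The form `x₁ - g(x₂)` vanishes on the diagonal only for `g = 1`, when it is `x₁ - x₂`.
Separating these factors leaves a polynomial that is nonzero on the diagonal. This separation turns
Γ-locality of the series into ordinary locality of the vertex operators. -/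
theorem exists_factor_prod_linFactor (l : List LinTransf) :
    ∃ (m : ℕ) (p : MvPolynomial (Fin 2) ℂ), (l.map linFactor).prod = (X 0 - X 1) ^ m * p ∧
      aeval ![(X 0 : MvPolynomial (Fin 1) ℂ), X 0] p ≠ 0 := by
  induction l with
  | nil => exact ⟨0, 1, by simp, by simp⟩
  | cons g l ih =>
    obtain ⟨m, p, hp, hp0⟩ := ih
    rw [List.map_cons, List.prod_cons, hp]
    by_cases hg : g = 1
    · refine ⟨m + 1, p, ?_, hp0⟩
      rw [hg, linFactor, LinTransf.one_def]
      simp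
      ring
    · refine ⟨m, linFactor g * p, by ring, ?_⟩
      rw [map_mul]
      refine mul_ne_zero (fun h0 => hg ?_) hp0
      have key : ∀ z : ℂ, z - (g.c₀ * z + g.c₁) = 0 := fun z => by
        have := congrArg (MvPolynomial.eval fun _ => z) h0
        simpa [linFactor, algebraMap_eq] using this
      have k0 := key 0
      have k1 := key 1
      have c1 : g.c₁ = 0 := by simpa using k0
      rw [c1] at k1
      refine LinTransf.ext (Units.ext ?_) c1
      change (g.c₀ : ℂ) = 1
      linear_combination -k1

theorem exists_eq_rename_add (V : MvPolynomial (Fin 3) ℂ) :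
    ∃ R R', V = rename ![2] (aeval ![(0 : MvPolynomial (Fin 1) ℂ), 0, X 0] V) + X 0 * R + X 1 * R' := by
  induction V using MvPolynomial.induction_on with
  | C c => exact ⟨0, 0, by simp [algebraMap_eq]⟩
  | add p q hp hq =>
    obtain ⟨R, R', h⟩ := hp
    obtain ⟨S, S', h'⟩ := hq
    exact ⟨R + S, R' + S', by rw [map_add, map_add]; linear_combination h + h'⟩
  | mul_X p i hp =>
    obtain ⟨R, R', h⟩ := hp
    fin_cases i
    · exact ⟨p, 0, by simp; ring⟩
    · exact ⟨0, p, by simp; ring⟩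
    · refine ⟨R * X 2, R' * X 2, ?_⟩
      rw [map_mul, map_mul]
      simp only [aeval_X, rename_X, Fin.reduceFinMk, Matrix.cons_val]
      linear_combination X 2 * h

end Lex

/-! ### Commutativity and associativity of the vertex operators `Y(a(x), x₀)` -/

section Identities

variable {W : Type*} [AddCommGroup W] [Module ℂ W]

open MvPolynomial Function

section Row

variable {r : ℕ} {i j k : Fin r}

/-- The substitution keeps the total exponent of `x_i` and `x_j`, which is at most `2N`, and leaves
the other exponents alone. -/
theorem shiftInf_eq_zero_of_bound (hij : i ≠ j) {T : (Fin r → ℤ) → W} {N : ℤ}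
    (hT : ∀ n, (∃ l, N < n l) → T n = 0) {n : Fin r → ℤ}
    (h : (∃ l, l ≠ i ∧ l ≠ j ∧ N < n l) ∨ 2 * N < n i + n j) : shiftInf i j T n = 0 := by
  rw [shiftInf_apply]
  refine finsum_eq_zero_of_forall_eq_zero fun m => ?_
  rw [hT, smul_zero]
  rcases h with ⟨l, hi, hj, hl⟩ | h
  · exact ⟨l, by simpa [hi, hj] using hl⟩
  · by_cases hm : N < m
    · exact ⟨i, by simpa [hij] using hm⟩
    · exact ⟨j, by simp [hij.symm]; omega⟩

/-- The series `a(x_i) b(x_j) c(x_k) w`. -/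
def tripleSeries (i j k : Fin r) (a b c : EInf W) (w : W) : (Fin r → ℤ) → W :=
  fun n => cf a (n i) (cf b (n j) (cf c (n k) w))

theorem lexBounded_YRow {ρ : Fin r} (hρ : ρ ≠ j) (hij : i ≠ j) {α β : ℤ → EInf W} {J : ℤ}
    (hJ : ∀ t < J, α t = 0 ∨ β t = 0) (w : W) : LexBounded ρ i j (YRow ρ i j α β w) := by
  refine ⟨⟨J, fun n hn => ?_⟩, fun c => ?_, fun n => ?_⟩
  · rw [YRow, YCoeff_eq_zero_of_opProd (opProd_pair_eq_zero (hJ _ hn)), cf_zero,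
      LinearMap.zero_apply]
  · obtain ⟨I, hI⟩ := YCoeff_lower (α c) (β c)
    exact ⟨I, fun n h hn => by rw [YRow, h, hI _ hn, cf_zero, LinearMap.zero_apply]⟩
  · obtain ⟨N, hN⟩ := cf_bound (YCoeff (α (n ρ)) (β (n ρ)) (n i)) w
    exact ⟨N, fun m h hm => by rw [YRow, h ρ hρ, h i hij, hN _ hm]⟩

/-- `Y(a(x), x_i) Y(b(x), x_k) c(x)` in terms of the product of `a`, `b` and `c`. -/
theorem polyMul_YRow_right (hij : i ≠ j) (hik : i ≠ k) (hkj : k ≠ j) {a b c : EInf W}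
    (hbc : QCPair b c) (hqa : ∀ t, QCPair a (YCoeff b c t)) {p : MvPolynomial (Fin 2) ℂ}
    (hp : IsTruncated (polyMul p (opProd ![b, c]))) (P : MvPolynomial (Fin r) ℂ) (w : W) {N : ℤ}
    (hT : ∀ n, (∃ l, N < n l) →
      polyMul (P * rename ![k, j] p) (tripleSeries i k j a b c w) n = 0) :
    polyMul (shiftPolyVar i j (shiftPolyVar k j (P * rename ![k, j] p)))
        (YRow k i j (fun _ => a) (YCoeff b c) w) =
      shiftInf i j (shiftInf k j
        (polyMul (P * rename ![k, j] p) (tripleSeries i k j a b c w))) := by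
  have sF : ∀ n, slice ![k, j] (tripleSeries i k j a b c w) n =
      fun l => cf a (n i) (opProd ![b, c] l w) := by
    intro n
    funext l
    simp only [slice, tripleSeries, extend_pair_of_ne hik hij, extend_pair_zero hkj,
      extend_pair_one hkj, opProd_pair_apply, Module.End.mul_apply]
  have sF' : ∀ n, polyMul p (slice ![k, j] (tripleSeries i k j a b c w) n) =
      fun l => cf a (n i) (polyMul p (opProd ![b, c]) l w) := by
    intro n
    funext l
    rw [sF, polyMul_apply, map_polyMul]
  have sY : ∀ n, slice ![k, j] (opRow k i j (fun _ => a) (YCoeff b c) w) n =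
      fun l => cf a (n i) (Yser b c w l) := by
    intro n
    funext l
    simp only [slice, opRow, Yser, extend_pair_of_ne hik hij, extend_pair_zero hkj,
      extend_pair_one hkj]
  have s1 := shiftInf_polyMul_slice hkj (F := tripleSeries i k j a b c w)
    (Y := opRow k i j (fun _ => a) (YCoeff b c) w) (p := p)
    (fun n => by rw [sF']; exact KerDom.map (cf a (n i)) (hp.shiftInfDom w))
    (fun n => by
      rw [sF', sY]
      funext l
      have h1 := kerSubst_map (i := (0 : Fin 2)) (cf a (n i)) (hp.shiftInfDom w) l
      change shiftInf 0 1 _ _ = cf a (n i) (shiftInf 0 1 _ _) at h1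
      rw [h1, ← Yser_spec hbc hp, map_polyMul]) P
  obtain ⟨J, hJ⟩ := YCoeff_lower b c
  rw [polyMul_YRow hij hik.symm hkj hqa (J := J) (fun t ht => Or.inr (hJ t ht)), s1]
  intro t
  -- With the exponent `t` of `x_k` fixed, that of `x_j` is at most `2N - t`, since the inner
  -- substitution preserves their sum; `x_i` keeps the bound `N`.
  refine ⟨max N (2 * N - t), fun n hn h => ?_⟩
  rw [s1]
  refine shiftInf_eq_zero_of_bound hkj hT ?_
  rcases h with h | h
  · exact Or.inl ⟨i, hik, hij, by omega⟩
  · exact Or.inr (by omega)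

/-- `Y(Y(a(x), x_i) b(x), x_j) c(x)` in terms of the product of `a`, `b` and `c`. -/
theorem polyMul_YRow_left (hij : i ≠ j) (hik : i ≠ k) (hjk : j ≠ k) {a b c : EInf W}
    (hab : QCPair a b) (hqc : ∀ t, QCPair (YCoeff a b t) c) {p : MvPolynomial (Fin 2) ℂ}
    (hp : IsTruncated (polyMul p (opProd ![a, b]))) (P : MvPolynomial (Fin r) ℂ) (w : W) {N : ℤ}
    (hT : ∀ n, (∃ l, N < n l) →
      polyMul (P * rename ![i, j] p) (tripleSeries i j k a b c w) n = 0) :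
    polyMul (shiftPolyVar j k (shiftPolyVar i j (P * rename ![i, j] p)))
        (YRow i j k (YCoeff a b) (fun _ => c) w) =
      shiftInf j k (shiftInf i j
        (polyMul (P * rename ![i, j] p) (tripleSeries i j k a b c w))) := by
  have sF : ∀ n, slice ![i, j] (tripleSeries i j k a b c w) n =
      fun l => opProd ![a, b] l (cf c (n k) w) := by
    intro n
    funext l
    simp only [slice, tripleSeries, extend_pair_of_ne hik.symm hjk.symm, extend_pair_zero hij,
      extend_pair_one hij, opProd_pair_apply, Module.End.mul_apply]
  have sF' : ∀ n, polyMul p (slice ![i, j] (tripleSeries i j k a b c w) n) =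
      fun l => polyMul p (opProd ![a, b]) l (cf c (n k) w) := by
    intro n
    funext l
    rw [sF, polyMul_apply]
  have sY : ∀ n, slice ![i, j] (opRow i j k (YCoeff a b) (fun _ => c) w) n =
      Yser a b (cf c (n k) w) := by
    intro n
    funext l
    simp only [slice, opRow, Yser, extend_pair_of_ne hik.symm hjk.symm, extend_pair_zero hij,
      extend_pair_one hij]
  have s1 := shiftInf_polyMul_slice hij (F := tripleSeries i j k a b c w)
    (Y := opRow i j k (YCoeff a b) (fun _ => c) w) (p := p)
    (fun n => by rw [sF']; exact hp.shiftInfDom _)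
    (fun n => by rw [sF', sY, ← Yser_spec hab hp]) P
  obtain ⟨J, hJ⟩ := YCoeff_lower a b
  rw [polyMul_YRow hjk hij hik hqc (J := J) (fun t ht => Or.inl (hJ t ht)), s1]
  intro t
  refine ⟨max N (2 * N - t), fun n hn h => ?_⟩
  rw [s1]
  refine shiftInf_eq_zero_of_bound hij hT ?_
  rcases h with h | h
  · exact Or.inr (by omega)
  · exact Or.inl ⟨k, hik.symm, hjk.symm, by omega⟩

end Row

variable {Γ : Subgroup LinTransf}

theorem opProd_triple_apply (a b c : EInf W) (w : W) :
    (fun n => opProd ![a, b, c] n w) = tripleSeries 0 1 2 a b c w := by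
  funext n
  simp [opProd, tripleSeries]

theorem polyMul_tripleSeries_comm {a b : EInf W} {p : MvPolynomial (Fin 2) ℂ}
    (h : polyMul p (commSeries a b) = 0) (c : EInf W) (w : W) :
    polyMul (rename ![0, 1] p) (tripleSeries (0 : Fin 3) 1 2 a b c w) =
      polyMul (rename ![0, 1] p) (tripleSeries (1 : Fin 3) 0 2 b a c w) := by
  refine sub_eq_zero.1 ?_
  rw [← polyMul_sub]
  funext n
  rw [polyMul_rename inj01]
  have : slice ![0, 1] (tripleSeries (0 : Fin 3) 1 2 a b c w - tripleSeries (1 : Fin 3) 0 2 b a c w)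
      n = fun k => commSeries a b k (cf c (n 2) w) := by
    funext k
    simp only [slice, extend01]
    simp [commSeries, tripleSeries]
  rw [this, polyMul_apply_eq_zero h]
  rfl

theorem exists_bound_tripleSeries {a b c : EInf W} {p q s : MvPolynomial (Fin 2) ℂ}
    (hab : polyMul p (commSeries a b) = 0) (hac : polyMul q (commSeries a c) = 0)
    (hbc : polyMul s (commSeries b c) = 0) (w : W) :
    ∃ N : ℤ, ∀ n : Fin 3 → ℤ, (∃ l, N < n l) →
      polyMul (rename ![0, 1] p * rename ![0, 2] q * rename ![1, 2] s)
        (tripleSeries 0 1 2 a b c w) n = 0 := by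
  obtain ⟨N, hN⟩ := isTruncated_triple_of_comm hab hac hbc w
  refine ⟨N, fun n hn => ?_⟩
  rw [← opProd_triple_apply, ← polyMul_apply]
  exact hN n hn

theorem shiftPolyVar_shiftPolyVar_comm (P : MvPolynomial (Fin 3) ℂ) :
    shiftPolyVar 1 2 (shiftPolyVar 0 2 P) = shiftPolyVar 0 2 (shiftPolyVar 1 2 P) := by
  have : (shiftPolyVar (1 : Fin 3) 2).comp (shiftPolyVar 0 2) =
      (shiftPolyVar 0 2).comp (shiftPolyVar 1 2) := by
    refine MvPolynomial.algHom_ext fun k => ?_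
    fin_cases k <;> simp [shiftPolyVar]
  exact DFunLike.congr_fun this P

theorem shiftPolyVar_triple (P : MvPolynomial (Fin 3) ℂ) :
    shiftPolyVar 0 1 (shiftPolyVar 0 2 (shiftPolyVar 1 2 P)) =
      shiftPolyVar 1 2 (shiftPolyVar 0 1 P) := by
  have : (shiftPolyVar (0 : Fin 3) 1).comp ((shiftPolyVar 0 2).comp (shiftPolyVar 1 2)) =
      (shiftPolyVar 1 2).comp (shiftPolyVar 0 1) := by
    refine MvPolynomial.algHom_ext fun k => ?_
    fin_cases k <;> simp [shiftPolyVar]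
    ring
  exact DFunLike.congr_fun this P

/-- The restriction of a polynomial obtained from `p(x₁, x₂)` by a substitution to the locus
`x₀ = x₁ = 0`. -/
theorem aeval_comp_rename (φ : MvPolynomial (Fin 3) ℂ →ₐ[ℂ] MvPolynomial (Fin 3) ℂ) (e : Fin 2 → Fin 3)
    (h : ∀ k, aeval ![(0 : MvPolynomial (Fin 1) ℂ), 0, X 0] (φ (X (e k))) = X 0)
    (p : MvPolynomial (Fin 2) ℂ) :
    aeval ![(0 : MvPolynomial (Fin 1) ℂ), 0, X 0] (φ (rename e p)) =
      aeval ![(X 0 : MvPolynomial (Fin 1) ℂ), X 0] p := by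
  have : ((aeval ![(0 : MvPolynomial (Fin 1) ℂ), 0, X 0]).comp (φ.comp (rename e))) =
      aeval ![(X 0 : MvPolynomial (Fin 1) ℂ), X 0] := by
    refine MvPolynomial.algHom_ext fun k => ?_
    rw [AlgHom.comp_apply, AlgHom.comp_apply, rename_X, h, aeval_X]
    fin_cases k <;> rfl
  exact DFunLike.congr_fun this p

/-- The vertex operators `Y(a(x), x₀)` and `Y(b(x), x₁)` are mutually local. -/
theorem exists_YRow_comm {a b : EInf W} (hab : LocalPair Γ a b) : ∃ m : ℕ, ∀ c : EInf W,
    LocalPair Γ a c → LocalPair Γ b c → ∀ w : W,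
      polyMul ((X 0 - X 1) ^ m) (YRow (1 : Fin 3) 0 2 (fun _ => a) (YCoeff b c) w) =
        polyMul ((X 0 - X 1) ^ m) (YRow (0 : Fin 3) 1 2 (fun _ => b) (YCoeff a c) w) := by
  obtain ⟨lab, -, eab⟩ := id hab
  obtain ⟨m, pab, fab, dab⟩ := exists_factor_prod_linFactor lab
  -- The exponent comes from the pair `a, b` alone: locality of operators requires one power for all
  -- `c`.
  refine ⟨m, fun c hac hbc w => ?_⟩
  obtain ⟨lac, -, eac⟩ := id hac
  obtain ⟨lbc, -, ebc⟩ := id hbc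
  obtain ⟨m₁, pac, fac, dac⟩ := exists_factor_prod_linFactor lac
  obtain ⟨m₂, pbc, fbc, dbc⟩ := exists_factor_prod_linFactor lbc
  rw [fab] at eab
  rw [fac] at eac
  rw [fbc] at ebc
  obtain ⟨N, hN⟩ := exists_bound_tripleSeries eab eac ebc w
  set sab := (X 0 - X 1) ^ m * pab
  set sac := (X 0 - X 1) ^ m₁ * pac
  set sbc := (X 0 - X 1) ^ m₂ * pbc
  set T := polyMul (rename ![0, 1] sab * rename ![0, 2] sac * rename ![1, 2] sbc)
    (tripleSeries (0 : Fin 3) 1 2 a b c w) with hTdef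
  have hT' : polyMul (rename ![0, 1] sab * rename ![1, 2] sbc * rename ![0, 2] sac)
      (tripleSeries (1 : Fin 3) 0 2 b a c w) = T := by
    rw [hTdef, show (rename ![0, 1] sab * rename ![0, 2] sac * rename ![1, 2] sbc : MvPolynomial (Fin 3) ℂ) =
      rename ![1, 2] sbc * rename ![0, 2] sac * rename ![0, 1] sab by ring,
      show (rename ![0, 1] sab * rename ![1, 2] sbc * rename ![0, 2] sac : MvPolynomial (Fin 3) ℂ) =
      rename ![1, 2] sbc * rename ![0, 2] sac * rename ![0, 1] sab by ring, polyMul_mul,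
      ← polyMul_tripleSeries_comm eab, ← polyMul_mul]
  -- Both orders are expressed through the same truncated series `T`; Dong's lemma provides the
  -- compatibility of the outer operator with the inner products.
  have k1 := polyMul_YRow_right (i := (0 : Fin 3)) (j := 2) (k := 1) (by decide) (by decide)
    (by decide) hbc.qcPair (fun t => (hab.symm.YCoeff hac.symm t).symm.qcPair)
    (isTruncated_pair_of_comm ebc) (rename ![0, 1] sab * rename ![0, 2] sac) w hN
  have k2 := polyMul_YRow_right (i := (1 : Fin 3)) (j := 2) (k := 0) (by decide) (by decide)
    (by decide) hac.qcPair (fun t => (hab.YCoeff hbc.symm t).symm.qcPair)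
    (isTruncated_pair_of_comm eac) (rename ![0, 1] sab * rename ![1, 2] sbc) w (N := N)
    (by rw [hT']; exact hN)
  rw [hT', ← shiftInf_comm hN, shiftPolyVar_shiftPolyVar_comm, mul_right_comm] at k2
  set σ := (shiftPolyVar (0 : Fin 3) 2).comp (shiftPolyVar 1 2) with hσ
  set U := σ (rename ![0, 1] pab * rename ![0, 2] pac * rename ![1, 2] pbc) with hU
  -- After the shift by `x₂` the diagonal factors become `x₀ - x₁`, `x₀` and `x₁`. All other factors
  -- go into `U`, which is nonzero at `x₀ = x₁ = 0`.
  have hfac : shiftPolyVar 0 2 (shiftPolyVar 1 2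
      (rename ![0, 1] sab * rename ![0, 2] sac * rename ![1, 2] sbc)) =
      U * (X 0 ^ m₁ * X 1 ^ m₂ * (X 0 - X 1) ^ m) := by
    change σ _ = _
    have s0 : σ (X 0) = X 0 + X 2 := by simp [hσ, shiftPolyVar]
    have s1 : σ (X 1) = X 1 + X 2 := by simp [hσ, shiftPolyVar]
    have s2 : σ (X 2) = X 2 := by simp [hσ, shiftPolyVar]
    simp only [sab, sac, sbc, hU, map_mul, map_pow, map_sub, rename_X, Matrix.cons_val_zero,
      Matrix.cons_val_one, s0, s1, s2]
    ring
  obtain ⟨R, R', hR⟩ := exists_eq_rename_add U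
  have hu : aeval ![(0 : MvPolynomial (Fin 1) ℂ), 0, X 0] U ≠ 0 := by
    rw [hU, map_mul, map_mul, map_mul, map_mul, aeval_comp_rename, aeval_comp_rename,
      aeval_comp_rename]
    · exact mul_ne_zero (mul_ne_zero dab dac) dbc
    all_goals
      intro k
      fin_cases k <;> simp [hσ, shiftPolyVar]
  rw [hfac, polyMul_mul, polyMul_mul] at k1 k2
  obtain ⟨J, hJ⟩ := YCoeff_lower b c
  obtain ⟨J', hJ'⟩ := YCoeff_lower a c
  have b1 : LexBounded (1 : Fin 3) 0 2 (YRow (1 : Fin 3) 0 2 (fun _ => a) (YCoeff b c) w) :=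
    lexBounded_YRow (by decide) (by decide) (fun t ht => Or.inr (hJ t ht)) w
  have b2 : LexBounded (0 : Fin 3) 1 2 (YRow (0 : Fin 3) 1 2 (fun _ => b) (YCoeff a c) w) :=
    lexBounded_YRow (by decide) (by decide) (fun t ht => Or.inr (hJ' t ht)) w
  -- `U` is cancelled here. The monomials in `x₀` and `x₁` are cancelled afterwards, multiplication
  -- by a variable being injective on all series.
  have key := ((b2.polyMul ((X 0 - X 1) ^ m)).polyMul (X 0 ^ m₁ * X 1 ^ m₂)).eq_of_polyMul
    (by decide) (by decide) ((b1.polyMul ((X 0 - X 1) ^ m)).polyMul (X 0 ^ m₁ * X 1 ^ m₂)) hu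
    (R := R) (R' := R') (by rw [← hR, k1, k2]) (fun n hn => by
      rw [← hR, k2]
      rcases hn with hn | hn
      · exact shiftInf_of_neg hn
      · rw [shiftInf_comm hN]; exact shiftInf_of_neg hn)
  rw [polyMul_mul (X 0 ^ m₁), polyMul_mul (X 0 ^ m₁)] at key
  exact (polyMul_X_pow_injective 1 m₂ (polyMul_X_pow_injective 0 m₁ key)).symm

/-! ### Weak associativity -/

theorem shiftZeroDom_of_lower {F : (Fin 3 → ℤ) → W} {J : ℤ} (hJ : ∀ n, n 1 < J → F n = 0) :
    ShiftZeroDom 0 1 F := by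
  intro n a
  refine (Set.finite_Icc a (n 1 - J)).subset fun m hm => ?_
  refine ⟨kerZero_ne_zero hm.1, ?_⟩
  by_contra hlt
  exact hm.2 (hJ _ (by simp; omega))

/-- Expanding `x₀ + x₁` in nonnegative powers of `x₁` raises exponents of `x₁` at the expense of
`x₀`. Only the finitely many rows between the lower bound and the given one contribute, so their
bounds can be combined. -/
theorem LexBounded.shiftZero {F : (Fin 3 → ℤ) → W} (hF : LexBounded 1 0 2 F) :
    LexBounded 1 0 2 (shiftZero 0 1 F) := by
  obtain ⟨J, hJ⟩ := hF.lower
  have eta : ∀ n : Fin 3 → ℤ, n = ![n 0, n 1, n 2] := fun n => by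
    funext i; fin_cases i <;> rfl
  have vanish : ∀ n : Fin 3 → ℤ, (∀ m, n 0 ≤ m → m ≤ n 0 + n 1 - J →
      F ![m, n 1 + n 0 - m, n 2] = 0) → AtInfinity.shiftZero 0 1 F n = 0 := by
    intro n h
    rw [eta n, shiftZero01_apply]
    refine finsum_eq_zero_of_forall_eq_zero fun m => ?_
    by_cases h1 : n 0 ≤ m
    · by_cases h2 : m ≤ n 0 + n 1 - J
      · rw [h m h1 h2, smul_zero]
      · rw [hJ _ (by simp; omega), smul_zero]
    · rw [kerZero_of_lt (not_le.1 h1), zero_smul]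
  refine ⟨⟨J, fun n hn => vanish n fun m _ _ => by omega⟩, fun c => ?_, fun n => ?_⟩
  · choose I hI using hF.row
    obtain ⟨B, hB⟩ := ((Set.finite_Icc J c).image I).bddBelow
    refine ⟨B - (c - J).toNat, fun n h hn => vanish n fun m h1 h2 => ?_⟩
    have := hB ⟨n 1 + n 0 - m, ⟨by omega, by omega⟩, rfl⟩
    exact hI _ _ rfl (by simp; omega)
  · choose N hN using hF.upper
    obtain ⟨B, hB⟩ := ((Set.finite_Icc (n 0) (n 0 + n 1 - J)).image
      fun m => N ![m, n 1 + n 0 - m, 0]).bddAbove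
    refine ⟨B, fun m hm h => vanish m fun l h1 h2 => ?_⟩
    rw [hm 0 (by decide), hm 1 (by decide)] at *
    have := hB ⟨l, ⟨h1, h2⟩, rfl⟩
    refine hN ![l, n 1 + n 0 - l, 0] _ (fun k hk => ?_) (by simp at this ⊢; omega)
    fin_cases k
    · rfl
    · rfl
    · exact absurd rfl hk

/-- Weak associativity of the vertex operators. -/
theorem exists_YRow_assoc {a c : EInf W} (hac : LocalPair Γ a c) : ∃ l : ℕ, ∀ b : EInf W,
    LocalPair Γ a b → LocalPair Γ b c → ∀ w : W,
      polyMul ((X 0 + X 1) ^ l)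
          (shiftZero 0 1 (YRow (1 : Fin 3) 0 2 (fun _ => a) (YCoeff b c) w)) =
        polyMul ((X 0 + X 1) ^ l) (YRow (0 : Fin 3) 1 2 (YCoeff a b) (fun _ => c) w) := by
  obtain ⟨lac, -, eac⟩ := id hac
  obtain ⟨l, pac, fac, dac⟩ := exists_factor_prod_linFactor lac
  -- The exponent depends on `a` and `c` only, since it comes from the diagonal factors of their
  -- locality polynomial.
  refine ⟨l, fun b hab hbc w => ?_⟩
  obtain ⟨lab, -, eab⟩ := id hab
  obtain ⟨lbc, -, ebc⟩ := id hbc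
  obtain ⟨m₁, pab, fab, dab⟩ := exists_factor_prod_linFactor lab
  obtain ⟨m₂, pbc, fbc, dbc⟩ := exists_factor_prod_linFactor lbc
  rw [fab] at eab
  rw [fac] at eac
  rw [fbc] at ebc
  obtain ⟨N, hN⟩ := exists_bound_tripleSeries eab eac ebc w
  set sab := (X 0 - X 1) ^ m₁ * pab
  set sac := (X 0 - X 1) ^ l * pac
  set sbc := (X 0 - X 1) ^ m₂ * pbc
  set T := polyMul (rename ![0, 1] sab * rename ![0, 2] sac * rename ![1, 2] sbc)
    (tripleSeries (0 : Fin 3) 1 2 a b c w) with hTdef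
  have hP : (rename ![0, 2] sac * rename ![1, 2] sbc * rename ![0, 1] sab :
      MvPolynomial (Fin 3) ℂ) =
      rename ![0, 1] sab * rename ![0, 2] sac * rename ![1, 2] sbc := by ring
  have k1 := polyMul_YRow_right (i := (0 : Fin 3)) (j := 2) (k := 1) (by decide) (by decide)
    (by decide) hbc.qcPair (fun t => (hab.symm.YCoeff hac.symm t).symm.qcPair)
    (isTruncated_pair_of_comm ebc) (rename ![0, 1] sab * rename ![0, 2] sac) w hN
  have k2 := polyMul_YRow_left (i := (0 : Fin 3)) (j := 1) (k := 2) (by decide) (by decide)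
    (by decide) hab.qcPair (fun t => (hac.YCoeff hbc t).qcPair)
    (isTruncated_pair_of_comm eab) (rename ![0, 2] sac * rename ![1, 2] sbc) w (N := N)
    (by rw [hP]; exact hN)
  rw [hP] at k2
  obtain ⟨J, hJ⟩ := YCoeff_lower b c
  obtain ⟨J', hJ'⟩ := YCoeff_lower a b
  have b1 : LexBounded (1 : Fin 3) 0 2 (YRow (1 : Fin 3) 0 2 (fun _ => a) (YCoeff b c) w) :=
    lexBounded_YRow (by decide) (by decide) (fun t ht => Or.inr (hJ t ht)) w
  have b2 : LexBounded (0 : Fin 3) 1 2 (YRow (0 : Fin 3) 1 2 (YCoeff a b) (fun _ => c) w) :=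
    lexBounded_YRow (by decide) (by decide) (fun t ht => Or.inl (hJ' t ht)) w
  obtain ⟨K, hK⟩ := b1.lower
  -- Substituting `x₀ + x₁` for `x₀` makes both sides the expansion of `T(x₀ + x₁ + x₂, x₁ + x₂,
  -- x₂)`.
  replace k1 := congrArg (AtInfinity.shiftZero 0 1) k1
  rw [shiftZero_polyMul (by decide) _ (shiftZeroDom_of_lower hK), shiftZero_shiftInf hN,
    shiftPolyVar_triple] at k1
  set σ := (shiftPolyVar (1 : Fin 3) 2).comp (shiftPolyVar 0 1) with hσ
  set U := σ (rename ![0, 1] pab * rename ![0, 2] pac * rename ![1, 2] pbc) with hU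
  -- The diagonal factors of the pairs `a, b`, `b, c` and `a, c` become `x₀`, `x₁` and `x₀ + x₁`.
  have hfac : shiftPolyVar 1 2 (shiftPolyVar 0 1
      (rename ![0, 1] sab * rename ![0, 2] sac * rename ![1, 2] sbc)) =
      U * (X 0 ^ m₁ * X 1 ^ m₂ * (X 0 + X 1) ^ l) := by
    change σ _ = _
    have s0 : σ (X 0) = X 0 + X 1 + X 2 := by simp [hσ, shiftPolyVar]; ring
    have s1 : σ (X 1) = X 1 + X 2 := by simp [hσ, shiftPolyVar]
    have s2 : σ (X 2) = X 2 := by simp [hσ, shiftPolyVar]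
    simp only [sab, sac, sbc, hU, map_mul, map_pow, map_sub, rename_X, Matrix.cons_val_zero,
      Matrix.cons_val_one, s0, s1, s2]
    ring
  obtain ⟨R, R', hR⟩ := exists_eq_rename_add U
  have hu : aeval ![(0 : MvPolynomial (Fin 1) ℂ), 0, X 0] U ≠ 0 := by
    rw [hU, map_mul, map_mul, map_mul, map_mul, aeval_comp_rename, aeval_comp_rename,
      aeval_comp_rename]
    · exact mul_ne_zero (mul_ne_zero dab dac) dbc
    all_goals
      intro k
      fin_cases k <;> simp [hσ, shiftPolyVar]
  rw [hfac, polyMul_mul, polyMul_mul] at k1 k2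
  have key := ((b2.polyMul ((X 0 + X 1) ^ l)).polyMul (X 0 ^ m₁ * X 1 ^ m₂)).eq_of_polyMul
    (by decide) (by decide) ((b1.shiftZero.polyMul ((X 0 + X 1) ^ l)).polyMul
      (X 0 ^ m₁ * X 1 ^ m₂)) hu
    (R := R) (R' := R') (by rw [← hR, k1, k2]) (fun n hn => by
      rw [← hR, k2]
      rcases hn with hn | hn
      · rw [shiftInf_apply]
        refine finsum_eq_zero_of_forall_eq_zero fun t => ?_
        rw [shiftInf_of_neg (by simpa using hn), smul_zero]
      · exact shiftInf_of_neg hn)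
  rw [polyMul_mul (X 0 ^ m₁), polyMul_mul (X 0 ^ m₁)] at key
  exact (polyMul_X_pow_injective 1 m₂ (polyMul_X_pow_injective 0 m₁ key)).symm

end Identities

/-! ### The vertex algebra structure on a closed local subspace -/

section Assembly

variable {W : Type*} [AddCommGroup W] [Module ℂ W]

open MvPolynomial Function

/-- The coefficient of `x ^ k` of a series applied to `w`, as a linear functional of the series. -/
def cfL (k : ℤ) (w : W) : EInf W →ₗ[ℂ] W where
  toFun a := cf a k w
  map_add' a b := by rw [cf_add, LinearMap.add_apply]
  map_smul' c a := by rw [cf_smul, LinearMap.smul_apply, RingHom.id_apply]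

theorem polyMul_fix_two (p : MvPolynomial (Fin 2) ℂ) (H : (Fin 3 → ℤ) → W) (n : Fin 2 → ℤ) (k : ℤ) :
    polyMul p (fun n : Fin 2 → ℤ => H ![n 0, n 1, k]) n =
      polyMul (rename ![0, 1] p) H ![n 0, n 1, k] := by
  rw [polyMul_rename inj01]
  have e : (![n 0, n 1, k] : Fin 3 → ℤ) ∘ ![0, 1] = n := by
    funext i; fin_cases i <;> rfl
  rw [e]
  congr 1
  funext m
  simp only [slice, extend01]
  rfl

theorem shiftZero_fix_two (H : (Fin 3 → ℤ) → W) (n : Fin 2 → ℤ) (k : ℤ) :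
    shiftZero 0 1 (fun n : Fin 2 → ℤ => H ![n 0, n 1, k]) n =
      shiftZero 0 1 H ![n 0, n 1, k] := by
  refine finsum_congr fun m => ?_
  refine congrArg (_ • H ·) (_root_.funext fun i => ?_)
  fin_cases i <;> simp

/-! ### The vacuum and creation properties of `1_W` -/

theorem Yser_oneW_left (b : EInf W) (w : W) :
    Yser oneW b w = fun n => if n 0 = 0 then cf b (n 1) w else 0 := by
  have hT : IsTruncated (polyMul (1 : MvPolynomial (Fin 2) ℂ) (opProd ![oneW, b])) := by
    intro w
    obtain ⟨N, hN⟩ := cf_bound b w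
    refine ⟨max 0 N, fun n ⟨i, hi⟩ => ?_⟩
    rw [polyMul_one, opProd_pair_apply, Module.End.mul_apply, cf_oneW]
    fin_cases i
    · rw [if_neg (by simp at hi; omega), LinearMap.zero_apply]
    · rw [hN _ (by simp at hi; omega), map_zero]
  refine Yser_unique one_ne_zero hT ⟨⟨0, fun n hn => if_neg hn.ne⟩, fun i => ?_⟩ ?_
  · obtain ⟨N, hN⟩ := cf_bound b w
    exact ⟨N, fun n _ hn => by rw [hN _ hn, ite_self]⟩
  · rw [map_one, polyMul_one, polyMul_one]
    funext n
    rw [shiftInf_apply]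
    rw [finsum_eq_single _ 0]
    · simp only [opProd_pair_apply, Module.End.mul_apply, cf_oneW]
      simp only [zero_sub, Pi.add_apply, Pi.smul_apply, Pi.sub_apply, Pi.single_eq_same, ne_eq,
        zero_ne_one, one_ne_zero, not_false_eq_true, Pi.single_eq_of_ne, sub_zero, smul_eq_mul,
        mul_one, add_neg_cancel, if_true, Module.End.one_apply]
      rcases lt_trichotomy (n 0) 0 with h | h | h
      · rw [kerInf_of_neg h, if_neg h.ne, zero_smul]
      · rw [if_pos h, h]; simp [kerInf]
      · obtain ⟨t, ht⟩ : ∃ t : ℕ, n 0 = (t + 1 : ℕ) := ⟨(n 0 - 1).toNat, by omega⟩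
        rw [if_neg h.ne', ht, kerInf_natCast, Ring.choose_zero_succ]
        simp
    · intro m hm
      have : cf (oneW : EInf W) ((n + (m - n 0) • (Pi.single 0 1 - Pi.single 1 1) : Fin 2 → ℤ) 0) = 0 := by
        rw [cf_oneW, if_neg]
        simpa using hm
      rw [opProd_pair_apply, this, zero_mul, LinearMap.zero_apply, smul_zero]

theorem YCoeff_oneW_left (b : EInf W) (j : ℤ) : YCoeff oneW b j = if j = 0 then b else 0 := by
  refine YCoeff_eq_of_Yser fun w k => ?_
  rw [Yser_oneW_left]
  change (if j = 0 then cf b k w else 0) = _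
  split_ifs <;> simp

/-- The product `a(x₁) 1_W` is already truncated, so `p = 1` is allowed and `Y(a(x), x₀) 1_W = a(x +
x₀)`. The creation property is read off at `x₀ = 0`. -/
theorem Yser_oneW_right (a : EInf W) (w : W) :
    Yser a oneW w = shiftInf 0 1 fun n => opProd ![a, oneW] n w := by
  have hT : IsTruncated (polyMul (1 : MvPolynomial (Fin 2) ℂ) (opProd ![a, oneW])) := by
    intro w
    obtain ⟨N, hN⟩ := cf_bound a w
    refine ⟨max 0 N, fun n ⟨i, hi⟩ => ?_⟩
    rw [polyMul_one, opProd_pair_apply, Module.End.mul_apply, cf_oneW]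
    fin_cases i
    · split_ifs
      · exact hN _ (by simp at hi; omega)
      · rw [LinearMap.zero_apply, map_zero]
    · rw [if_neg (by simp at hi; omega), LinearMap.zero_apply, map_zero]
  have := Yser_spec ⟨1, one_ne_zero, hT⟩ hT w
  rwa [map_one, polyMul_one, polyMul_one] at this

theorem YCoeff_oneW_right_of_neg (a : EInf W) {j : ℤ} (hj : j < 0) : YCoeff a oneW j = 0 := by
  refine YCoeff_eq_of_Yser fun w k => ?_
  rw [Yser_oneW_right, shiftInf_of_neg hj, cf_zero, LinearMap.zero_apply]

theorem YCoeff_oneW_right_zero (a : EInf W) : YCoeff a oneW 0 = a := by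
  refine YCoeff_eq_of_Yser fun w k => ?_
  rw [Yser_oneW_right, shiftInf_apply, finsum_eq_single _ k]
  · rw [opProd_pair_apply, Module.End.mul_apply, cf_oneW, if_pos (by simp), Module.End.one_apply]
    simp [kerInf]
  · intro m hm
    rw [opProd_pair_apply, Module.End.mul_apply, cf_oneW, if_neg, LinearMap.zero_apply, map_zero,
      smul_zero]
    simp
    omega

/-! ### The algebraic structures on a closed local space -/

variable {Γ : Subgroup LinTransf} {V : Type*} [AddCommGroup V] [Module ℂ V] {ι : V →ₗ[ℂ] EInf W}

/-- A closed `Γ`-local space of series that contains `1_W` and is stable under `Γ`, given as the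
range of an injective linear map. -/
structure IsGammaClosed (Γ : Subgroup LinTransf) (ι : V →ₗ[ℂ] EInf W) : Prop where
  injective : Injective ι
  localPair : ∀ a b, LocalPair Γ (ι a) (ι b)
  exists_YCoeff : ∀ a b j, ∃ c, ι c = YCoeff (ι a) (ι b) j
  exists_oneW : ∃ a, ι a = oneW
  exists_subst : ∀ g ∈ Γ, ∀ a, ∃ b, ι b = subst g (ι a)

/-- The homomorphism `c₀ x + c₁ ↦ c₀`. -/
def LinTransf.slope : LinTransf →* ℂˣ where
  toFun g := g.c₀
  map_one' := rfl
  -- The group product reverses composition, so the slopes appear in reversed order.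
  map_mul' _ _ := mul_comm _ _

namespace IsGammaClosed

variable (h : IsGammaClosed Γ ι)

include h in
theorem qcPair (a b : V) : QCPair (ι a) (ι b) := (h.localPair a b).qcPair

/-- The coefficient of `x₀ ^ j` in `Y(a(x), x₀) b(x)`. -/
def YFun (a b : V) (j : ℤ) : V := (h.exists_YCoeff a b j).choose

theorem map_YFun (a b : V) (j : ℤ) : ι (h.YFun a b j) = YCoeff (ι a) (ι b) j :=
  (h.exists_YCoeff a b j).choose_spec

/-- The coefficient of `x₀ ^ j` in `Y(a(x), x₀)`. -/
def YEnd (a : V) (j : ℤ) : Module.End ℂ V where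
  toFun b := h.YFun a b j
  map_add' b c := h.injective <| by
    rw [map_add, map_YFun, map_YFun, map_YFun, map_add]
    exact YCoeff_add_right (h.qcPair a b) (h.qcPair a c) j
  map_smul' t b := h.injective <| by
    rw [map_smul, map_YFun, map_YFun, map_smul]
    exact YCoeff_smul_right (h.qcPair a b) t j

theorem map_YEnd (a b : V) (j : ℤ) : ι (h.YEnd a j b) = YCoeff (ι a) (ι b) j := h.map_YFun a b j

theorem exists_YEnd_lower (a b : V) : ∃ J : ℤ, ∀ j < J, h.YEnd a j b = 0 := by
  obtain ⟨J, hJ⟩ := YCoeff_lower (ι a) (ι b)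
  exact ⟨J, fun j hj => h.injective (by rw [map_YEnd, hJ j hj, map_zero])⟩

theorem bddBelow_YEnd (a b : V) : BddBelow (support fun j => h.YEnd a j b) := by
  obtain ⟨J, hJ⟩ := h.exists_YEnd_lower a b
  exact ⟨J, fun j hj => not_lt.1 fun hlt => hj (hJ j hlt)⟩

/-- The map `a(x) ↦ Y(a(x), x₀)`. -/
def Y : V →ₗ[ℂ] VertexOperator ℂ V where
  toFun a := VertexOperator.of_coeff (h.YEnd a) (h.bddBelow_YEnd a)
  map_add' a b := HVertexOperator.coeff_inj <| _root_.funext fun j => LinearMap.ext fun c =>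
    h.injective <| by
      change ι (h.YEnd (a + b) j c) = ι (h.YEnd a j c + h.YEnd b j c)
      rw [map_add, map_YEnd, map_YEnd, map_YEnd, map_add]
      exact YCoeff_add_left (h.qcPair a c) (h.qcPair b c) j
  map_smul' t a := HVertexOperator.coeff_inj <| _root_.funext fun j => LinearMap.ext fun c =>
    h.injective <| by
      change ι (h.YEnd (t • a) j c) = ι (t • h.YEnd a j c)
      rw [map_smul, map_YEnd, map_YEnd, map_smul]
      exact YCoeff_smul_left (h.qcPair a c) t j

theorem coeff_Y (a : V) (j : ℤ) : HVertexOperator.coeff (h.Y a) j = h.YEnd a j := rfl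

theorem shiftZeroDom_YEnd (a b c : V) :
    ShiftZeroDom 0 1 fun n : Fin 2 → ℤ => h.YEnd a (n 0) (h.YEnd b (n 1) c) := by
  obtain ⟨J, hJ⟩ := h.exists_YEnd_lower b c
  intro n t
  refine (Set.finite_Icc t (n 1 - J)).subset fun m hm => ⟨kerZero_ne_zero hm.1, ?_⟩
  by_contra hlt
  refine hm.2 ?_
  simp only
  rw [hJ _ (by simp; omega), map_zero]

/-- The nonlocal vertex algebra structure. -/
def nonlocalVertexAlgebra : NonlocalVertexAlgebra V where
  Y := h.Y
  vac := h.exists_oneW.choose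
  vacuum b j := h.injective <| by
    rw [coeff_Y, map_YEnd, h.exists_oneW.choose_spec, YCoeff_oneW_left]
    split_ifs
    · rfl
    · rw [map_zero]
  creation_neg a j hj := h.injective <| by
    rw [coeff_Y, map_YEnd, h.exists_oneW.choose_spec, YCoeff_oneW_right_of_neg _ hj, map_zero]
  creation_zero a := h.injective <| by
    rw [coeff_Y, map_YEnd, h.exists_oneW.choose_spec, YCoeff_oneW_right_zero]
  weak_assoc a b c := by
    obtain ⟨l, hl⟩ := exists_YRow_assoc (h.localPair a c)
    refine ⟨l, ?_⟩
    simp only [coeff_Y]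
    rw [substZero_eq_shiftZero]
    funext n
    refine h.injective (cf_ext fun k w => ?_)
    -- Equality in `V` is tested on the maps `L`, which are jointly injective. The exponent `k` of
    -- `x` then serves as that of a third variable.
    let L : V →ₗ[ℂ] W := cfL k w ∘ₗ ι
    have hL : ∀ a b j, L (h.YEnd a j b) = cf (YCoeff (ι a) (ι b) j) k w := fun a b j =>
      congrArg (cfL k w) (h.map_YEnd a b j)
    change L _ = L _
    rw [map_polyMul, map_polyMul]
    have e1 : (fun n => L (shiftZero 0 1
        (fun n : Fin 2 → ℤ => h.YEnd a (n 0) (h.YEnd b (n 1) c)) n)) = fun n : Fin 2 → ℤ =>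
        shiftZero 0 1 (YRow (1 : Fin 3) 0 2 (fun _ => ι a) (YCoeff (ι b) (ι c)) w)
          ![n 0, n 1, k] := by
      funext n
      rw [← shiftZero_fix_two]
      refine (kerSubst_map L (h.shiftZeroDom_YEnd a b c) n).symm.trans ?_
      simp only [hL, map_YEnd]
      rfl
    have e2 : (fun n : Fin 2 → ℤ => L (h.YEnd (h.YEnd a (n 0) b) (n 1) c)) = fun n =>
        YRow (0 : Fin 3) 1 2 (YCoeff (ι a) (ι b)) (fun _ => ι c) w ![n 0, n 1, k] := by
      funext n
      rw [hL, map_YEnd]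
      rfl
    have e3 : rename ![(0 : Fin 3), 1] ((X 0 + X 1 : MvPolynomial (Fin 2) ℂ) ^ l) =
        (X 0 + X 1) ^ l := by simp
    rw [e1, e2, polyMul_fix_two, polyMul_fix_two, e3,
      hl (ι b) (h.localPair a b) (h.localPair b c) w]

/-- The vertex algebra structure. -/
def vertexAlgebra : VertexAlgebra V where
  toNonlocalVertexAlgebra := h.nonlocalVertexAlgebra
  locality a b := by
    obtain ⟨m, hm⟩ := exists_YRow_comm (h.localPair a b)
    refine ⟨m, ?_⟩
    change polyMul _ (fun n : Fin 2 → ℤ => h.YEnd a (n 0) * h.YEnd b (n 1)) =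
      polyMul _ fun n : Fin 2 → ℤ => h.YEnd b (n 1) * h.YEnd a (n 0)
    funext n
    refine LinearMap.ext fun c => h.injective (cf_ext fun k w => ?_)
    let L : V →ₗ[ℂ] W := cfL k w ∘ₗ ι
    have hL : ∀ a b j, L (h.YEnd a j b) = cf (YCoeff (ι a) (ι b) j) k w := fun a b j =>
      congrArg (cfL k w) (h.map_YEnd a b j)
    change L _ = L _
    rw [polyMul_apply, polyMul_apply, map_polyMul, map_polyMul]
    simp only [Module.End.mul_apply, hL, map_YEnd]
    refine (polyMul_fix_two _ (YRow (1 : Fin 3) 0 2 (fun _ => ι a)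
      (YCoeff (ι b) (ι c)) w) n k).trans ?_
    refine Eq.trans ?_ (polyMul_fix_two _ (YRow (0 : Fin 3) 1 2 (fun _ => ι b)
      (YCoeff (ι a) (ι c)) w) n k).symm
    have e2 : rename ![(0 : Fin 3), 1] ((X 0 - X 1 : MvPolynomial (Fin 2) ℂ) ^ m) =
        (X 0 - X 1) ^ m := by simp
    rw [e2, hm (ι c) (h.localPair a c) (h.localPair b c) w]

/-- The series `a(g(x))`. -/
def substFun (g : Γ) (a : V) : V := (h.exists_subst g g.2 a).choose

theorem map_substFun (g : Γ) (a : V) : ι (h.substFun g a) = subst (g : LinTransf) (ι a) :=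
  (h.exists_subst g g.2 a).choose_spec

/-- The operators `a(x) ↦ a(g(x))`. -/
def substHom : Γ →* Module.End ℂ V where
  toFun g :=
    { toFun := h.substFun g
      map_add' := fun a b => h.injective <| by
        rw [map_add, map_substFun, map_substFun, map_substFun, map_add]
        exact map_add (substL (g : LinTransf)) _ _
      map_smul' := fun t a => h.injective <| by
        rw [map_smul, map_substFun, map_substFun, map_smul]
        exact map_smul (substL (g : LinTransf)) _ _ }
  map_one' := LinearMap.ext fun a => h.injective <| by
    change ι (h.substFun 1 a) = ι a
    rw [map_substFun, Subgroup.coe_one, subst_one]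
  map_mul' g g' := LinearMap.ext fun a => h.injective <| by
    change ι (h.substFun (g * g') a) = ι (h.substFun g (h.substFun g' a))
    rw [map_substFun, map_substFun, map_substFun, Subgroup.coe_mul, subst_mul]

/-- The action of `Γ`. -/
def R : Γ →* (V ≃ₗ[ℂ] V) :=
  (LinearMap.GeneralLinearGroup.generalLinearEquiv ℂ V).toMonoidHom.comp h.substHom.toHomUnits

theorem map_R (g : Γ) (a : V) : ι (h.R g a) = subst (g : LinTransf) (ι a) :=
  h.map_substFun g a

/-- The `Γ`-vertex algebra structure. -/
def gammaVertexAlgebra : GammaVertexAlgebra Γ V where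
  toVertexAlgebra := h.vertexAlgebra
  R := h.R
  φ := LinTransf.slope.comp Γ.subtype
  R_vac g := h.injective <| by
    change ι (h.R g h.exists_oneW.choose) = ι h.exists_oneW.choose
    rw [map_R, h.exists_oneW.choose_spec, subst_oneW]
  R_Y g a b n := h.injective <| by
    change ι (h.R g (h.YEnd a n b)) =
      ι (((((g : LinTransf).c₀ : ℂ)⁻¹) ^ n) • h.YEnd (h.R g a) n (h.R g b))
    rw [map_smul, map_R, map_YEnd, map_YEnd, map_R, map_R, ← subst_YCoeff (h.qcPair a b), smul_smul,
      inv_zpow, inv_mul_cancel₀ (zpow_ne_zero _ (Units.ne_zero _)), one_smul]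

theorem map_vac : ι h.gammaVertexAlgebra.vac = oneW := h.exists_oneW.choose_spec

theorem map_ncoeff (a b : V) (n : ℤ) :
    ι (VertexOperator.ncoeff (h.gammaVertexAlgebra.Y a) n b) = nProd (ι a) (ι b) n :=
  h.map_YEnd a b (-n - 1)

/-- The quasi module-at-infinity structure on `W`. -/
def quasiModule : GammaQuasiModuleAtInfinity W h.gammaVertexAlgebra where
  YW := ι
  YW_vac := h.map_vac
  quasi_assoc a b := by
    obtain ⟨p, hp, hT⟩ := id (h.qcPair a b)
    refine ⟨p, hp, hT, fun w => ?_⟩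
    rw [substInf_eq_shiftInf]
    -- With `Y_W(α(x), x₀) = α(x₀)` the module axiom is the defining property of `Y(a(x), x₀) b(x)`.
    refine Eq.trans ?_ (Yser_spec (h.qcPair a b) hT w)
    have e1 : (fun n : Fin 2 → ℤ => cf (ι (HVertexOperator.coeff (h.gammaVertexAlgebra.Y a) (n 0) b))
        (n 1) w) = Yser (ι a) (ι b) w := by
      funext n
      change cf (ι (h.YEnd a (n 0) b)) (n 1) w = _
      rw [map_YEnd]
      rfl
    have e2 : (![X 0 + X 1, X 1] : Fin 2 → MvPolynomial (Fin 2) ℂ) = update X 0 (X 0 + X 1) := by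
      funext i
      fin_cases i <;> simp
    rw [e1, shiftPolyVar, e2]
  Φ := Γ.subtype
  Φ_c₀ _ := rfl
  YW_R g a := h.map_R g a
  gammaLocal := by
    rw [Subgroup.range_subtype]
    rintro _ ⟨a, rfl⟩ _ ⟨b, rfl⟩
    exact h.localPair a b

end IsGammaClosed

theorem isGammaClosed_generated {S : Set (EInf W)} (hS : GammaLocal Γ S) :
    IsGammaClosed (V := generated (gammaSpan Γ S : Set (EInf W))) Γ
      (generated (gammaSpan Γ S : Set (EInf W))).subtype where
  injective := Submodule.subtype_injective _
  localPair a b := generated_gammaLocal (gammaSpan_gammaLocal hS) a a.2 b b.2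
  exists_YCoeff a b j := by
    -- The coefficient of `x₀^j` is the product with index `n = -j - 1`.
    have := nProd_mem_generated _ a.2 b.2 (-j - 1)
    rw [nProd, show -(-j - 1) - 1 = j by ring] at this
    exact ⟨⟨_, this⟩, rfl⟩
  exists_oneW := ⟨⟨oneW, oneW_mem_generated _⟩, rfl⟩
  exists_subst _ hg a := ⟨⟨_, subst_mem_generated hS hg a.2⟩, rfl⟩

end Assembly

end AtInfinity

end

open AtInfinity
theorem theorem5p10 {W : Type*} [AddCommGroup W] [Module ℂ W]
    (Γ : Subgroup LinTransf) (S : Set (EInf W)) (hS : GammaLocal Γ S) :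
    -- `Γ · S` is `Γ`-local
    GammaLocal Γ (gammaSpan Γ S : Set (EInf W)) ∧
    -- `⟨Γ · S⟩` is the smallest closed quasi-compatible subspace containing `Γ · S` and `1_W`
    QuasiCompatible (gammaSpan Γ S : Set (EInf W)) ∧
    IsLeast (closedContaining (gammaSpan Γ S : Set (EInf W)))
      (generated (gammaSpan Γ S : Set (EInf W))) ∧
    -- the `Γ`-vertex algebra structure on `⟨Γ · S⟩`
    ∃ A : GammaVertexAlgebra Γ (generated (gammaSpan Γ S : Set (EInf W))),
      (A.vac : EInf W) = oneW ∧
      (∀ (a b : generated (gammaSpan Γ S : Set (EInf W))) (n : ℤ),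
        (VertexOperator.ncoeff (A.Y a) n b : EInf W) = nProd (a : EInf W) (b : EInf W) n) ∧
      (∀ (g : Γ) (a : generated (gammaSpan Γ S : Set (EInf W))),
        (A.R g a : EInf W) = subst (g : LinTransf) (a : EInf W)) ∧
      (∀ g : Γ, A.φ g = (g : LinTransf).c₀) ∧
      -- the quasi module-at-infinity structure on `W`
      ∃ M : GammaQuasiModuleAtInfinity W A,
        (∀ a : generated (gammaSpan Γ S : Set (EInf W)), M.YW a = (a : EInf W)) ∧
        M.Φ = Γ.subtype := by
  have hG := gammaSpan_gammaLocal hS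
  have h := isGammaClosed_generated hS
  exact ⟨hG, hG.quasiCompatible, isLeast_generated hG, h.gammaVertexAlgebra, h.map_vac,
    h.map_ncoeff, h.map_R, fun _ => rfl, h.quasiModule, fun _ => rfl, rfl⟩
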